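/- **Setting.** A Calabi–Yau manifold $(M,I,\omega,\Omega)$ of complex dimension $n$ is a complex manifold $(M,I)$ with a Kähler form $\omega$ and a holomorphic volume form $\Omega$ such that $\frac{\omega^n}{n!}=(-1)^{n(n-1)/2}\left(\frac{\sqrt{-1}}2\right)^n\Omega\wedge\overline\Omega$; its Kähler metric is $g(u,v)=\omega(u,Iv)$. For an immersion $f:N\to M$ of an $n$-dimensional manifold with $f^*\omega=0$ (a Lagrangian immersion), a local Lagrangian angle is a continuous real function $\theta$ on an open set $U\subset N$ with $f^*\Omega=e^{\sqrt{-1}\theta}\mathrm{vol}_{f^*g}$ on $U$ for some orientation of $U$; it is determined modulo $\pi$ at each point, and modulo $2\pi$ once the orientation is fixed. The immersion $f$ is special Lagrangian if $f^*\Omega=e^{\sqrt{-1}\theta_0}\mathrm{vol}_{f^*g}$ on $N$ for a constant $\theta_0$ and some orientation of $N$. Let $(M,I,\omega,\Omega)$ be a connected Calabi–Yau manifold of complex dimension $n$, and let $H$ be a connected Lie group with Lie algebra $\mathfrak h$ acting smoothly on $M$ and preserving $I$. For $h\in H$ let $L_h:M\to M$ be the translation, and for $\xi\in\mathfrak h$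 let $\xi^\#_p=\frac{d}{dt}\big|_{t=0}\exp(t\xi)p$. Suppose the action has a moment map $\mu:M\to\mathfrak h^*$, i.e. a smooth map with $\langle\mu(hp),\xi\rangle=\langle\mu(p),\mathrm{Ad}_{h^{-1}}\xi\rangle$ and $d\langle\mu,\xi\rangle=-\mathfrak i(\xi^\#)\omega$. Let $L$ be a Lagrangian submanifold of $M$, let $c\in\mathfrak h^*$, and let $V_c$ be a non-empty submanifold of $M$ with $V_c\subset\mu^{-1}(c)\cap L$. Assume: * the isotropy subgroup of $H$ at $p$ is the same subgroup $K$ for all $p\in V_c$; * $\xi^\#_p\perp T_pL$ for all $p\in V_c$ and all $\xi\in\mathfrak h$. Here $H/K$ carries its smooth structure as a homogeneous space, i.e. the one for which $H\to H/K$ is a smooth submersion. **Claim.** 1. $c$ lies in the center $Z(\mathfrak h^*)=\{c\in\mathfrak h^*: \langle c,\mathrm{Ad}_h\xi\rangle=\langle c,\xi\rangle\text{ for all }h\in H,\ \xi\in\mathfrak h\}$. 2. There is a unique $a_H\in\mathfrak h^*$ such that $L_h^*\Omega=\chi(h)\,\Omega$ for all $h\in H$ with a function $\chi:H\to\mathbb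 C$ satisfying $d\chi_e=\sqrt{-1}\,a_H$. 3. $H/K$ does carry such a smooth structure. Assume moreover $\dim (H/K)+\dim V_c=n$. Then: * the map $\phi_c:(H/K)\times V_c\to M$, $(hK,p)\mapsto hp$, is a Lagrangian immersion; * if $h=\exp\eta_1\cdots\exp\eta_l$ with $\eta_1,\dots,\eta_l\in\mathfrak h$, then $L_h^*\Omega=e^{\sqrt{-1}\langle a_H,\eta_1+\cdots+\eta_l\rangle}\Omega$; * if $\theta$ is a local Lagrangian angle of $L$ on an open set $U\subset L$, $p\in V_c\cap U$ and $h=\exp\eta_1\cdots\exp\eta_l$, then $$(\phi_c^*\Omega)_{(hK,p)}=\pm e^{\sqrt{-1}\theta_c}\,\mathrm{vol}_{\phi_c^*g},\qquad \theta_c=\langle a_H,\eta_1+\cdots+\eta_l\rangle+\theta(p)-\frac{\pi}{2}\dim(H/K);$$ * if there is a constant $\theta_0$ such that $(\Omega|_L)_p=\pm e^{\sqrt{-1}\theta_0}\,(\mathrm{vol}_{g|_L})_p$ for all $p\in V_c$ (the Lagrangian angle of $L$ is constant on $V_c$, e.g. $L$ is special Lagrangian), and $a_H=0$, then $\phi_c$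 is a special Lagrangian immersion. -/

import Mathlib

open scoped Manifold ContDiff
open Module

noncomputable section

namespace PerpSLag

/-! ### Smooth maps between manifolds -/

section Maps

variable {E₁ : Type*} [NormedAddCommGroup E₁] [NormedSpace ℝ E₁]
  {H₁ : Type*} [TopologicalSpace H₁] (I₁ : ModelWithCorners ℝ E₁ H₁)
  {E₂ : Type*} [NormedAddCommGroup E₂] [NormedSpace ℝ E₂]
  {H₂ : Type*} [TopologicalSpace H₂] (I₂ : ModelWithCorners ℝ E₂ H₂)
  {N : Type*} [TopologicalSpace N] [ChartedSpace H₁ N]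
  {P : Type*} [TopologicalSpace P] [ChartedSpace H₂ P]

/-- A smooth immersion between finite-dimensional manifolds: a smooth map all of whose
differentials are injective. -/
structure IsSmoothImmersion (f : N → P) : Prop where
  smooth : ContMDiff I₁ I₂ ∞ f
  injective_mfderiv : ∀ x, Function.Injective (mfderiv I₁ I₂ f x)

/-- A smooth submersion between finite-dimensional manifolds: a smooth map all of whose
differentials are surjective. -/
structure IsSmoothSubmersion (f : N → P) : Prop where
  smooth : ContMDiff I₁ I₂ ∞ f
  surjective_mfderiv : ∀ x, Function.Surjective (mfderiv I₁ I₂ f x)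

/-- `f` exhibits `N` as an (embedded) submanifold of `P`: an immersion that is a homeomorphism
onto its image. -/
structure IsSubmanifoldEmbedding (f : N → P) : Prop where
  immersion : IsSmoothImmersion I₁ I₂ f
  embedding : Topology.IsEmbedding f

end Maps

/-! ### Calabi–Yau manifolds -/

section CalabiYau

variable {E : Type*} [NormedAddCommGroup E] [NormedSpace ℂ E]
  {M : Type*} [TopologicalSpace M] [ChartedSpace E M]

/-- The complex structure `I_p : T_p M → T_p M` of a complex manifold, i.e. multiplication by `i`
in a holomorphic chart. The manifold `M` is modelled on the complex vector space `E`; its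
underlying real manifold is modelled on `E` regarded as a real vector space, and both tangent
spaces at `p` are identified with `E` through the same chart at `p`. -/
def complexStructure (p : M) : TangentSpace 𝓘(ℝ, E) p →L[ℝ] TangentSpace 𝓘(ℝ, E) p :=
  (Complex.I • ContinuousLinearMap.id ℝ E : E →L[ℝ] E)

/-- The expression, in the chart at `x₀`, of a real `k`-form on `M`: its pullback under the
inverse of the chart. -/
def realFormInChart {k : ℕ} (α : (p : M) → TangentSpace 𝓘(ℝ, E) p [⋀^Fin k]→L[ℝ] ℝ)
    (x₀ : M) : E → E [⋀^Fin k]→L[ℝ] ℝ := fun y =>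
  (α ((chartAt E x₀).symm y)).compContinuousLinearMap
    (mfderiv 𝓘(ℝ, E) 𝓘(ℝ, E) (chartAt E x₀).symm y)

/-- The expression, in the holomorphic chart at `x₀`, of a form of type `(k, 0)` on `M`. -/
def complexFormInChart {k : ℕ} (Ω : (p : M) → TangentSpace 𝓘(ℂ, E) p [⋀^Fin k]→L[ℂ] ℂ)
    (x₀ : M) : E → E [⋀^Fin k]→L[ℂ] ℂ := fun y =>
  (Ω ((chartAt E x₀).symm y)).compContinuousLinearMap
    (mfderiv 𝓘(ℂ, E) 𝓘(ℂ, E) (chartAt E x₀).symm y)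

/-- The value of the `n`-fold wedge power `α ∧ ⋯ ∧ α` of a `2`-form on `2n` vectors
`w₀, …, w₂ₙ₋₁`, namely
`2⁻ⁿ ∑_σ sgn σ α(w_σ(0), w_σ(1)) ⋯ α(w_σ(2n-2), w_σ(2n-1))`. -/
def wedgePower {T : Type*} (α : T → T → ℝ) (n : ℕ) (w : Fin (2 * n) → T) : ℝ :=
  (2 ^ n : ℝ)⁻¹ * ∑ σ : Equiv.Perm (Fin (2 * n)), ((Equiv.Perm.sign σ : ℤ) : ℝ) *
    ∏ i : Fin n, α (w (σ ⟨2 * i, by omega⟩)) (w (σ ⟨2 * i + 1, by omega⟩))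

/-- The value of `Ω ∧ conj Ω`, for an `n`-form `Ω`, on `2n` vectors `w₀, …, w₂ₙ₋₁`, namely
`(n!)⁻² ∑_σ sgn σ Ω(w_σ(0), …, w_σ(n-1)) conj (Ω(w_σ(n), …, w_σ(2n-1)))`. -/
def wedgeConj {T : Type*} {n : ℕ} (Ω : (Fin n → T) → ℂ) (w : Fin (2 * n) → T) : ℂ :=
  ((n.factorial : ℂ) ^ 2)⁻¹ * ∑ σ : Equiv.Perm (Fin (2 * n)), ((Equiv.Perm.sign σ : ℤ) : ℂ) *
    (Ω (fun i => w (σ ⟨i, by omega⟩)) *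
      (starRingEnd ℂ) (Ω (fun i => w (σ ⟨n + i, by omega⟩))))

variable (E M) in
/-- A Calabi–Yau structure `(ω, Ω)` on a complex manifold `M` of complex dimension `n`: a Kähler
form `ω` and a holomorphic volume form `Ω` with
`ωⁿ / n! = (-1)^{n(n-1)/2} (i/2)ⁿ Ω ∧ conj Ω`.
The Kähler metric is `g(u, v) = ω(u, I v)`. -/
structure CalabiYau (n : ℕ) where
  /-- the Kähler form -/
  kahler : (p : M) → TangentSpace 𝓘(ℝ, E) p [⋀^Fin 2]→L[ℝ] ℝ
  /-- the holomorphic volume form; complex multilinear, i.e. of type `(n, 0)` -/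
  Ω : (p : M) → TangentSpace 𝓘(ℂ, E) p [⋀^Fin n]→L[ℂ] ℂ
  smooth_kahler : ∀ x₀ : M, ContDiffOn ℝ ∞ (realFormInChart kahler x₀) (chartAt E x₀).target
  closed_kahler : ∀ x₀ : M, ∀ y ∈ (chartAt E x₀).target, extDeriv (realFormInChart kahler x₀) y = 0
  compatible_kahler : ∀ (p : M) (u v : TangentSpace 𝓘(ℝ, E) p),
    kahler p ![complexStructure p u, complexStructure p v] = kahler p ![u, v]
  positive_kahler : ∀ (p : M) (u : TangentSpace 𝓘(ℝ, E) p), u ≠ 0 →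
    0 < kahler p ![u, complexStructure p u]
  holomorphic_Ω : ∀ x₀ : M, DifferentiableOn ℂ (complexFormInChart Ω x₀) (chartAt E x₀).target
  nonvanishing_Ω : ∀ p : M, Ω p ≠ 0
  normalized : ∀ (p : M) (w : Fin (2 * n) → TangentSpace 𝓘(ℝ, E) p),
    ((wedgePower (fun u v => kahler p ![u, v]) n w / (n.factorial : ℝ) : ℝ) : ℂ) =
      (-1) ^ (n * (n - 1) / 2) * (Complex.I / 2) ^ n *
        wedgeConj (T := TangentSpace 𝓘(ℝ, E) p) (fun u => Ω p u) w

namespace CalabiYau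

variable {n : ℕ} (X : CalabiYau E M n)

/-- The Kähler metric `g(u, v) = ω(u, I v)`. -/
def metric (p : M) (u v : TangentSpace 𝓘(ℝ, E) p) : ℝ :=
  X.kahler p ![u, complexStructure p v]

section Immersions

variable {E₁ : Type*} [NormedAddCommGroup E₁] [NormedSpace ℝ E₁]
  {H₁ : Type*} [TopologicalSpace H₁] (I₁ : ModelWithCorners ℝ E₁ H₁)
  {N : Type*} [TopologicalSpace N] [ChartedSpace H₁ N]

/-- A Lagrangian immersion `f : N → M`: an immersion with `f^*ω = 0` of a manifold of half the
(real) dimension of `M`. -/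
structure IsLagrangianImmersion (f : N → M) : Prop where
  immersion : IsSmoothImmersion I₁ 𝓘(ℝ, E) f
  isotropic : ∀ (x : N) (u v : TangentSpace I₁ x),
    X.kahler (f x) ![mfderiv I₁ 𝓘(ℝ, E) f x u, mfderiv I₁ 𝓘(ℝ, E) f x v] = 0
  half_dim : finrank ℝ E₁ = n

/-- The alternating form `vol` on `T_x N` is the volume form of `f^*g`, for one of the
two orientations of `T_x N` (here `dim N = n`):
`vol(w₁, …, wₙ)² = det (f^*g (wᵢ, wⱼ))`. -/
def IsVolumeFormAt (f : N → M) (x : N) (vol : TangentSpace I₁ x [⋀^Fin n]→L[ℝ] ℝ) : Prop :=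
  ∀ w : Fin n → TangentSpace I₁ x, (vol w) ^ 2 =
    (Matrix.of fun i j => X.metric (f x) (mfderiv I₁ 𝓘(ℝ, E) f x (w i))
      (mfderiv I₁ 𝓘(ℝ, E) f x (w j))).det

/-- `(f^*Ω)_x = e^{it} vol_{f^*g}` for one of the two orientations of `T_x N`; in other words
`(f^*Ω)_x = ± e^{it} vol_{f^*g}` for a given orientation. -/
def IsAngleAt (f : N → M) (x : N) (t : ℝ) : Prop :=
  ∃ vol : TangentSpace I₁ x [⋀^Fin n]→L[ℝ] ℝ, X.IsVolumeFormAt I₁ f x vol ∧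
    ∀ w : Fin n → TangentSpace I₁ x,
      X.Ω (f x) (fun i => mfderiv I₁ 𝓘(ℝ, E) f x (w i)) =
        Complex.exp (t * Complex.I) * (vol w : ℂ)

/-- `θ` is a local Lagrangian angle of `f`, on the open set `U`: it is continuous and
`f^*Ω = e^{iθ} vol_{f^*g}` on `U` for an orientation of `U`. The orientation is not a separate
datum: at each `x ∈ U` it is the one for which `Re (e^{-iθ(x)} f^*Ω)` is positive, hence depends
continuously on `x`. -/
structure IsLocalLagrangianAngle (f : N → M) (U : Set N) (θ : N → ℝ) : Prop where
  isOpen : IsOpen U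
  continuousOn : ContinuousOn θ U
  angle : ∀ x ∈ U, X.IsAngleAt I₁ f x (θ x)

/-- A special Lagrangian immersion: a Lagrangian immersion whose Lagrangian angle is a constant
`θ₀`, i.e. `f^*Ω = e^{iθ₀} vol_{f^*g}` on all of `N`, for the orientation of `N` defined by
`Re (e^{-iθ₀} f^*Ω)`. -/
structure IsSpecialLagrangianImmersion (f : N → M) : Prop where
  lagrangian : X.IsLagrangianImmersion I₁ f
  constant_angle : ∃ θ₀ : ℝ, ∀ x : N, X.IsAngleAt I₁ f x θ₀

end Immersions

end CalabiYau

end CalabiYau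

/-! ### Lie groups -/

section LieGroups

variable {F : Type*} [NormedAddCommGroup F] [NormedSpace ℝ F]
  {H : Type*} [TopologicalSpace H] [ChartedSpace F H] [Group H]

/-- `h = exp η` in the Lie group `H`: there is a one-parameter subgroup `γ` of `H` with initial
velocity `η` and `γ(1) = h`. -/
def IsExp (η : GroupLieAlgebra 𝓘(ℝ, F) H) (h : H) : Prop :=
  ∃ γ : ℝ → H, ContMDiff 𝓘(ℝ, ℝ) 𝓘(ℝ, F) ∞ γ ∧ (∀ s t, γ (s + t) = γ s * γ t) ∧
    (mfderiv 𝓘(ℝ, ℝ) 𝓘(ℝ, F) γ 0 (1 : ℝ) : F) = η ∧ γ 1 = h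

/-- The adjoint action `Ad_h`, i.e. the differential at `1` of `x ↦ h x h⁻¹`. -/
def adj (h : H) (ξ : GroupLieAlgebra 𝓘(ℝ, F) H) : GroupLieAlgebra 𝓘(ℝ, F) H :=
  (mfderiv 𝓘(ℝ, F) 𝓘(ℝ, F) (fun x : H => h * x * h⁻¹) 1 ξ : F)

/-- The center `Z(𝔥^*)` of the dual of the Lie algebra: the fixed points of the coadjoint
action. -/
def coadjointCenter : Set (GroupLieAlgebra 𝓘(ℝ, F) H →L[ℝ] ℝ) :=
  {c | ∀ (h : H) (ξ : GroupLieAlgebra 𝓘(ℝ, F) H), c (adj h ξ) = c ξ}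

/-- A charted space structure of dimension `m` on `H ⧸ K` (with the quotient topology) is the
homogeneous space structure: it is a smooth manifold and `H → H ⧸ K` is a smooth submersion.
These properties characterize the smooth structure of `H ⧸ K`. -/
structure IsHomogeneousSpace (F : Type*) [NormedAddCommGroup F] [NormedSpace ℝ F]
    {H : Type*} [TopologicalSpace H] [ChartedSpace F H] [Group H]
    (K : Subgroup H) (m : ℕ) [ChartedSpace (EuclideanSpace ℝ (Fin m)) (H ⧸ K)] : Prop where
  isManifold : IsManifold (𝓡 m) ∞ (H ⧸ K)
  submersion : IsSmoothSubmersion 𝓘(ℝ, F) (𝓡 m) (fun h : H => (h : H ⧸ K))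

end LieGroups

/-! ### Group actions on a Calabi–Yau manifold -/

section Actions

variable {F : Type*} [NormedAddCommGroup F] [NormedSpace ℝ F]
  {H : Type*} [TopologicalSpace H] [ChartedSpace F H] [Group H]
  {E : Type*} [NormedAddCommGroup E] [NormedSpace ℂ E]
  {M : Type*} [TopologicalSpace M] [ChartedSpace E M] [MulAction H M]

/-- The fundamental vector field `ξ^#_p = d/dt|_{t=0} exp(tξ) p`, i.e. the image of `ξ` under the
differential at `1` of `h ↦ h p`. -/
def fundamentalVF (ξ : GroupLieAlgebra 𝓘(ℝ, F) H) (p : M) : TangentSpace 𝓘(ℝ, E) p :=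
  (mfderiv 𝓘(ℝ, F) 𝓘(ℝ, E) (fun h : H => h • p) 1 ξ : E)

variable (H E M) in
/-- The action preserves the complex structure: `(L_h)_* ∘ I = I ∘ (L_h)_*`. -/
def PreservesComplexStructure : Prop :=
  ∀ (h : H) (p : M) (u : TangentSpace 𝓘(ℝ, E) p),
    mfderiv 𝓘(ℝ, E) 𝓘(ℝ, E) (fun q : M => h • q) p (complexStructure p u) =
      complexStructure (h • p) (mfderiv 𝓘(ℝ, E) 𝓘(ℝ, E) (fun q : M => h • q) p u)

/-- `μ : M → 𝔥^*` is a moment map: it is smooth, `H`-equivariant, i.e.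
`⟨μ(hp), ξ⟩ = ⟨μ(p), Ad_{h⁻¹} ξ⟩`, and `d⟨μ, ξ⟩ = - i(ξ^#) ω` for all `ξ ∈ 𝔥`. -/
structure IsMomentMap {n : ℕ} (X : CalabiYau E M n)
    (μ : M → GroupLieAlgebra 𝓘(ℝ, F) H →L[ℝ] ℝ) : Prop where
  smooth : ∀ ξ, ContMDiff 𝓘(ℝ, E) 𝓘(ℝ, ℝ) ∞ (fun p => μ p ξ)
  equivariant : ∀ (h : H) (p : M) (ξ : GroupLieAlgebra 𝓘(ℝ, F) H),
    μ (h • p) ξ = μ p (adj h⁻¹ ξ)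
  differential : ∀ (p : M) (ξ : GroupLieAlgebra 𝓘(ℝ, F) H) (v : TangentSpace 𝓘(ℝ, E) p),
    (mfderiv 𝓘(ℝ, E) 𝓘(ℝ, ℝ) (fun q => μ q ξ) p v : ℝ) =
      - X.kahler p ![fundamentalVF ξ p, v]

/-- `L_h^*Ω = χ Ω` for the translation `L_h` by `h` and a constant `χ`. -/
def ScalesVolumeForm {n : ℕ} (X : CalabiYau E M n) (h : H) (χ : ℂ) : Prop :=
  ∀ (p : M) (w : Fin n → TangentSpace 𝓘(ℝ, E) p),
    X.Ω (h • p) (fun i => mfderiv 𝓘(ℝ, E) 𝓘(ℝ, E) (fun q : M => h • q) p (w i)) =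
      χ * X.Ω p w

/-- `a` is the covector `a_H ∈ 𝔥^*` of the action: `L_h^*Ω = χ(h) Ω` for a function `χ` on `H`
with `dχ = i a` at the identity. -/
def IsPhaseCovector {n : ℕ} (X : CalabiYau E M n) (a : GroupLieAlgebra 𝓘(ℝ, F) H →L[ℝ] ℝ) :
    Prop :=
  ∃ χ : H → ℂ, (∀ h, ScalesVolumeForm X h (χ h)) ∧
    MDifferentiableAt 𝓘(ℝ, F) 𝓘(ℝ, ℂ) χ 1 ∧
    ∀ ξ : GroupLieAlgebra 𝓘(ℝ, F) H,
      (mfderiv 𝓘(ℝ, F) 𝓘(ℝ, ℂ) χ 1 ξ : ℂ) = Complex.I * (a ξ : ℂ)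

/-- The map `φ : (H / K) × V → M`, `(hK, v) ↦ h v`, for a family of points `j : V → M` whose
isotropy subgroups are all equal to `K`. -/
def orbitMap {V : Type*} (j : V → M) (K : Subgroup H)
    (hK : ∀ v, MulAction.stabilizer H (j v) = K) : (H ⧸ K) × V → M := fun x =>
  Quotient.liftOn' x.1 (fun h => h • j x.2) (by
    intro g h hgh
    have hmem : g⁻¹ * h ∈ MulAction.stabilizer H (j x.2) := by
      rw [hK]; exact QuotientGroup.leftRel_apply.mp hgh
    have := MulAction.mem_stabilizer_iff.mp hmem
    rw [mul_smul, inv_smul_eq_iff] at this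
    exact this.symm)

end Actions

end PerpSLag

end

set_option linter.unusedSectionVars false

noncomputable section

namespace PerpSLag

open Set Filter Topology

/-! ### Functions with vanishing differential -/

section Constancy

variable {F : Type*} [NormedAddCommGroup F] [NormedSpace ℝ F]
  {H : Type*} [TopologicalSpace H] [ChartedSpace F H]
  {W : Type*} [NormedAddCommGroup W] [NormedSpace ℝ W]

/-! At a point `p` of `V_c` the claim is linear algebra. Since `L` is Lagrangian, `T_pM = T_pL ⊕ I
T_pL`, and `I T_pL` is the orthogonal complement of `T_pL` (`exists_add_I_smul`,
`exists_eq_I_smul_of_perp`), so every `ξ^#_p` lies in `I T_pL`. In particular the orbit directions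
are isotropic, `⟨μ, ξ⟩` is constant along the orbit of `p`, and equivariance turns this constancy
into centrality of `c` (`mem_coadjointCenter`).

The differential of `φ_c` at `(eK, p)` has as image the sum of the orbit directions in `I T_pL` and
of `T_pV_c ⊂ T_pL`. Since `μ` is constant on `V_c`, `ω(ξ^#, T_pV_c) = 0`, which says that `I⁻¹ ξ^#`
is orthogonal to `T_pV_c` inside `T_pL`. Because the dimensions add up to `n`, the image is `T_pL`
with a subspace of dimension `dim (H/K)` rotated by `I` and its orthogonal complement kept. It is
therefore again Lagrangian, and `Ω` picks up the factor `i ^ dim (H/K)` (`exists_lagrangian_frame`,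
`exists_rotatedFrame`).

Translations carry this to all of `(H/K) × V_c`. They preserve `ω`: the fundamental fields are
Hamiltonian and `ω` is closed, so Cartan's formula makes the Lie derivatives vanish, and `H` is
connected (`kahler_translation`). They preserve `I`, hence also `g`. By the normalization, the ratio
of `L_h^*Ω` and `Ω` is a holomorphic function of modulus one, hence constant on the connected `M` by
the maximum modulus principle (`exists_scalesVolumeForm`). These constants form a unitary character
`χ` with `dχ_e = i a_H`, and along one-parameter subgroups `χ` is an exponential
(`scalesVolumeForm_prod`).

The smooth structure of `H/K` comes from the fact that `K` is the isotropy group of a point. By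
equivariance the orbit map has constant rank, so the constant rank theorem gives a slice at `1`
whose left translates are charts (`exists_cosetSlice`, `CosetSlice.isHomogeneousSpace`). The same
slice shows that `T(H/K)` injects into the orbit directions. -/

theorem apply_eq_of_hasMFDerivAt_zero [IsManifold 𝓘(ℝ, F) 1 H] [PreconnectedSpace H] {f : H → W}
    (hf : ∀ x, HasMFDerivAt 𝓘(ℝ, F) 𝓘(ℝ, W) f x 0) (x y : H) : f x = f y := by
  refine IsLocallyConstant.apply_eq_of_preconnectedSpace ?_ x y
  rw [IsLocallyConstant.iff_eventually_eq]
  intro x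
  set e := chartAt F x
  have hd : ∀ z ∈ e.target, HasFDerivAt (f ∘ e.symm) (0 : F →L[ℝ] W) z := by
    intro z hz
    have h1 := (mdifferentiableAt_atlas_symm (I := 𝓘(ℝ, F)) (chart_mem_atlas F x) hz).hasMFDerivAt
    have h2 := (hf (e.symm z)).comp z h1
    rw [hasMFDerivAt_iff_hasFDerivAt] at h2
    exact HasFDerivAt.congr_fderiv (f' := _) h2 (by ext; rfl)
  obtain ⟨r, hr, hball⟩ := Metric.isOpen_iff.1 e.open_target (e x) (mem_chart_target F x)
  have hc : ∀ z ∈ Metric.ball (e x) r, (f ∘ e.symm) z = (f ∘ e.symm) (e x) := by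
    intro z hz
    refine Metric.isOpen_ball.is_const_of_fderiv_eq_zero (𝕜 := ℝ) (convex_ball _ _).isPreconnected
      (fun w hw => (hd w (hball hw)).differentiableAt.differentiableWithinAt)
      (fun w hw => (hd w (hball hw)).fderiv) hz (Metric.mem_ball_self hr)
  have hx : x ∈ e.source := mem_chart_source F x
  filter_upwards [e.open_source.mem_nhds hx,
    (e.continuousAt hx).preimage_mem_nhds (Metric.ball_mem_nhds _ hr)] with y hy hyb
  have := hc _ hyb
  simpa [e.left_inv hy, e.left_inv hx] using this

variable [Group H] [LieGroup 𝓘(ℝ, F) ∞ H]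

theorem isManifold_one : IsManifold 𝓘(ℝ, F) 1 H :=
  have : IsManifold 𝓘(ℝ, F) ∞ H := inferInstance
  IsManifold.of_le (n := ∞) (by simp)

/-- A left translation is a diffeomorphism, so the differential at `g` vanishes as soon as that of
`h ↦ f (g * h)` does at `1`. Differentials thus need computing only at the identity; the
right-handed version serves quantities that transform well under `h ↦ h * g`. -/
theorem apply_eq_of_hasMFDerivAt_mul_left [PreconnectedSpace H] {f : H → W}
    (hf : ∀ g, HasMFDerivAt 𝓘(ℝ, F) 𝓘(ℝ, W) (fun h => f (g * h)) 1 0) (x y : H) : f x = f y := by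
  have : IsManifold 𝓘(ℝ, F) 1 H := isManifold_one
  refine apply_eq_of_hasMFDerivAt_zero (F := F) (fun g => ?_) x y
  have h1 : MDifferentiableAt 𝓘(ℝ, F) 𝓘(ℝ, F) (fun h : H => g⁻¹ * h) g :=
    (contMDiff_mul_left (I := 𝓘(ℝ, F)) (n := ∞) (a := g⁻¹)).contMDiffAt.mdifferentiableAt (by simp)
  have h2 : HasMFDerivAt 𝓘(ℝ, F) 𝓘(ℝ, W) (fun h => f (g * h)) (g⁻¹ * g) 0 := by
    rw [inv_mul_cancel]; exact hf g
  have h3 := h2.comp g h1.hasMFDerivAt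
  have h4 : (fun h => f (g * h)) ∘ (fun h : H => g⁻¹ * h) = f := by ext; simp
  rw [h4] at h3
  exact h3.congr_mfderiv (by ext; rfl)

theorem apply_eq_of_hasMFDerivAt_mul_right [PreconnectedSpace H] {f : H → W}
    (hf : ∀ g, HasMFDerivAt 𝓘(ℝ, F) 𝓘(ℝ, W) (fun h => f (h * g)) 1 0) (x y : H) : f x = f y := by
  have : IsManifold 𝓘(ℝ, F) 1 H := isManifold_one
  refine apply_eq_of_hasMFDerivAt_zero (F := F) (fun g => ?_) x y
  have h1 : MDifferentiableAt 𝓘(ℝ, F) 𝓘(ℝ, F) (fun h : H => h * g⁻¹) g :=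
    (contMDiff_mul_right (I := 𝓘(ℝ, F)) (n := ∞) (a := g⁻¹)).contMDiffAt.mdifferentiableAt (by simp)
  have h2 : HasMFDerivAt 𝓘(ℝ, F) 𝓘(ℝ, W) (fun h => f (h * g)) (g * g⁻¹) 0 := by
    rw [mul_inv_cancel]; exact hf g
  have h3 := h2.comp g h1.hasMFDerivAt
  have h4 : (fun h => f (h * g)) ∘ (fun h : H => h * g⁻¹) = f := by ext; simp
  rw [h4] at h3
  exact h3.congr_mfderiv (by ext; rfl)

end Constancy

/-! ### Exterior algebra -/

section Exterior

/-- A complex alternating form, as a real one. -/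
def realAlternating {T : Type*} [AddCommGroup T] [Module ℂ T] [Module ℝ T] [IsScalarTower ℝ ℂ T]
    {ι : Type*} (α : T [⋀^ι]→ₗ[ℂ] ℂ) : T [⋀^ι]→ₗ[ℝ] ℂ :=
  { α.toMultilinearMap.restrictScalars ℝ with
    map_eq_zero_of_eq' := α.map_eq_zero_of_eq' }

@[simp]
theorem realAlternating_apply {T : Type*} [AddCommGroup T] [Module ℂ T] [Module ℝ T]
    [IsScalarTower ℝ ℂ T] {ι : Type*} (α : T [⋀^ι]→ₗ[ℂ] ℂ) (w : ι → T) :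
    realAlternating α w = α w := rfl

/-- Scaling the first summand by `z` scales a complex top form on a real vector space `A × B` by
`z ^ dim A`. -/
theorem alternating_scale {A B T : Type*} [AddCommGroup A] [Module ℝ A] [AddCommGroup B]
    [Module ℝ B] [AddCommGroup T] [Module ℂ T] [Module ℝ T] [IsScalarTower ℝ ℂ T]
    [FiniteDimensional ℝ A] [FiniteDimensional ℝ B] {n : ℕ} (α : T [⋀^Fin n]→ₗ[ℂ] ℂ)
    (S : A →ₗ[ℝ] T) (R : B →ₗ[ℝ] T) (z : ℂ) (hdim : finrank ℝ A + finrank ℝ B = n)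
    (w : Fin n → A × B) :
    α (fun i => z • S (w i).1 + R (w i).2) =
      z ^ finrank ℝ A * α (fun i => S (w i).1 + R (w i).2) := by
  let P : (A × B) →ₗ[ℝ] T := z • S ∘ₗ LinearMap.fst ℝ A B + R ∘ₗ LinearMap.snd ℝ A B
  let Q : (A × B) →ₗ[ℝ] T := S ∘ₗ LinearMap.fst ℝ A B + R ∘ₗ LinearMap.snd ℝ A B
  let β : (A × B) [⋀^Fin n]→ₗ[ℝ] ℂ := (realAlternating α).compLinearMap P
  let γ : (A × B) [⋀^Fin n]→ₗ[ℝ] ℂ := (realAlternating α).compLinearMap Q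
  suffices h : β = (z ^ finrank ℝ A) • γ by
    simpa [β, γ, P, Q] using congrArg (fun δ => δ w) h
  subst hdim
  let b := ((finBasis ℝ A).prod (finBasis ℝ B)).reindex finSumFinEquiv
  -- The basis vectors from `A` are scaled by `z`, those from `B` by `1`. An injective choice of `n`
  -- among the `n` basis vectors is a permutation, so the total factor is always `z ^ finrank ℝ A`.
  let c : Fin (finrank ℝ A + finrank ℝ B) → ℂ := Fin.addCases (fun _ => z) (fun _ => 1)
  refine Basis.ext_alternating b fun v hv => ?_
  have hA : ∀ i, P (b i) = c i • Q (b i) := by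
    intro i
    refine Fin.addCases (fun i => ?_) (fun i => ?_) i <;> simp [P, Q, b, c]
  have hc : ∏ i, c (v i) = z ^ finrank ℝ A := by
    rw [(Finite.injective_iff_bijective.1 hv).prod_comp c, Fin.prod_univ_add]
    simp [c]
  simp only [β, γ, AlternatingMap.compLinearMap_apply, AlternatingMap.smul_apply,
    realAlternating_apply, hA]
  rw [← hc]
  exact α.toMultilinearMap.map_smul_univ (fun i => c (v i)) _

/-- The value at `(x, y)` of the extension of `Ω ∧ conj Ω` to pairs of vectors. -/
def wedgeConjPair {T : Type*} {n : ℕ} (Ω : (Fin n → T) → ℂ) (x y : Fin (2 * n) → T) : ℂ :=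
  ∑ σ : Equiv.Perm (Fin (2 * n)), ((Equiv.Perm.sign σ : ℤ) : ℂ) *
    (Ω (fun i => x (σ ⟨i, by omega⟩)) *
      (starRingEnd ℂ) (Ω (fun i => y (σ ⟨n + i, by omega⟩))))

section

variable {T : Type*} [AddCommGroup T] [Module ℂ T] {n : ℕ} (Ω : T [⋀^Fin n]→ₗ[ℂ] ℂ)

/-- Polarization in one index. For each `σ` the slot `k` sits either in the factor `Ω`, which is
complex linear in it, or in the conjugate factor, which is antilinear. The averages over `u, I u`
and `v, I v` with weights `∓ i` project onto these two types, so the linear terms see only `u` and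
the antilinear terms only `v`. -/
theorem wedgeConjPair_update (x y : Fin (2 * n) → T) (k : Fin (2 * n)) (u v : T) :
    wedgeConjPair Ω (Function.update x k u) (Function.update y k v) =
      2⁻¹ * (wedgeConjPair Ω (Function.update x k u) (Function.update y k u) -
        Complex.I * wedgeConjPair Ω (Function.update x k (Complex.I • u))
          (Function.update y k (Complex.I • u)) +
        (wedgeConjPair Ω (Function.update x k v) (Function.update y k v) +
        Complex.I * wedgeConjPair Ω (Function.update x k (Complex.I • v))
          (Function.update y k (Complex.I • v)))) := by
  have key : ∀ σ : Equiv.Perm (Fin (2 * n)),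
      (∃ φ ψ : T → ℂ, (∀ u, φ (Complex.I • u) = Complex.I * φ u) ∧ (∀ u, ψ u = ψ 0) ∧
        (∀ u, Ω (fun i => Function.update x k u (σ ⟨i, by omega⟩)) = φ u) ∧
        ∀ u, Ω (fun i => Function.update y k u (σ ⟨n + i, by omega⟩)) = ψ u) ∨
      (∃ φ ψ : T → ℂ, (∀ u, ψ (Complex.I • u) = Complex.I * ψ u) ∧ (∀ u, φ u = φ 0) ∧
        (∀ u, Ω (fun i => Function.update x k u (σ ⟨i, by omega⟩)) = φ u) ∧
        ∀ u, Ω (fun i => Function.update y k u (σ ⟨n + i, by omega⟩)) = ψ u) := by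
    intro σ
    obtain ⟨l, rfl⟩ := σ.surjective k
    by_cases hl : (l : ℕ) < n
    · refine Or.inl ⟨fun u => Ω (Function.update (fun i => x (σ ⟨i, by omega⟩)) ⟨l, hl⟩ u),
        fun _ => Ω (fun i => y (σ ⟨n + i, by omega⟩)), fun u => ?_, fun u => rfl, fun u => ?_,
        fun u => ?_⟩
      · simp only [AlternatingMap.map_update_smul, smul_eq_mul]
      · congr 1; ext i
        by_cases hi : i = ⟨l, hl⟩
        · subst hi; simp
        · have : (⟨i, by omega⟩ : Fin (2 * n)) ≠ l := fun h =>
            hi (Fin.ext (by simpa using congrArg Fin.val h))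
          simp [hi, this]
      · congr 1; ext i
        have : (⟨n + i, by omega⟩ : Fin (2 * n)) ≠ l := fun h => by
          have := congrArg Fin.val h; simp only at this; omega
        simp [this]
    · obtain ⟨l', hl'⟩ : ∃ l' : Fin n, n + (l' : ℕ) = l :=
        ⟨⟨l - n, by omega⟩, by simp only; omega⟩
      refine Or.inr ⟨fun _ => Ω (fun i => x (σ ⟨i, by omega⟩)),
        fun u => Ω (Function.update (fun i => y (σ ⟨n + i, by omega⟩)) l' u), fun u => ?_,
        fun u => rfl, fun u => ?_, fun u => ?_⟩
      · simp only [AlternatingMap.map_update_smul, smul_eq_mul]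
      · congr 1; ext i
        have : (⟨i, by omega⟩ : Fin (2 * n)) ≠ l := fun h => by
          have := congrArg Fin.val h; simp only at this; omega
        simp [this]
      · congr 1; ext i
        by_cases hi : i = l'
        · subst hi
          have : (⟨n + i, by omega⟩ : Fin (2 * n)) = l := Fin.ext hl'
          simp [this]
        · have : (⟨n + i, by omega⟩ : Fin (2 * n)) ≠ l := fun h =>
            hi (Fin.ext (by have := congrArg Fin.val h; simp only at this; omega))
          simp [hi, this]
  simp only [wedgeConjPair, Finset.mul_sum, ← Finset.sum_add_distrib, ← Finset.sum_sub_distrib]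
  refine Finset.sum_congr rfl fun σ _ => ?_
  rcases key σ with ⟨φ, ψ, h1, h2, h3, h4⟩ | ⟨φ, ψ, h1, h2, h3, h4⟩
  · simp only [h3, h4, h1, h2 u, h2 v, h2 (Complex.I • _)]
    linear_combination (2⁻¹ * ((Equiv.Perm.sign σ : ℤ) : ℂ) * (φ u - φ v) *
      (starRingEnd ℂ) (ψ 0)) * (Complex.I_mul_I)
  · simp only [h3, h4, h1, h2 u, h2 v, h2 (Complex.I • _), map_mul, Complex.conj_I]
    linear_combination (-2⁻¹ * ((Equiv.Perm.sign σ : ℤ) : ℂ) * φ 0 *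
      ((starRingEnd ℂ) (ψ u) - (starRingEnd ℂ) (ψ v))) * (Complex.I_mul_I)

/-- Induction on a set of indices outside which `x` and `y` agree: polarization at one index writes
the value through pairs that agree there too. -/
theorem wedgeConjPair_eq_zero (h : ∀ w, wedgeConjPair Ω w w = 0) (x y : Fin (2 * n) → T) :
    wedgeConjPair Ω x y = 0 := by
  have key : ∀ s : Finset (Fin (2 * n)), ∀ x y : Fin (2 * n) → T, (∀ k ∉ s, x k = y k) →
      wedgeConjPair Ω x y = 0 := by
    intro s
    induction s using Finset.induction_on with
    | empty =>
      intro x y hxy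
      rw [show x = y from funext fun k => hxy k (by simp)]
      exact h y
    | insert k s hk ih =>
      intro x y hxy
      have h0 : ∀ u, wedgeConjPair Ω (Function.update x k u) (Function.update y k u) = 0 := by
        intro u
        refine ih _ _ fun l hl => ?_
        by_cases hlk : l = k
        · subst hlk; simp
        · simp [hlk, hxy l (by simp [hlk, hl])]
      have := wedgeConjPair_update Ω x y k (x k) (y k)
      simp only [h0] at this
      simpa using this
  exact key Finset.univ x y (by simp)

/-- The normalization of `Ω` can determine a scaling factor only if `Ω ∧ conj Ω` does not vanish. By
polarization it suffices to find a nonzero value on a pair `(x, y)`, and with `x = (e, 0)`, `y = (0,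
e)` all terms of the sum are nonnegative. -/
theorem exists_wedgeConj_ne_zero (hΩ : Ω ≠ 0) : ∃ w, wedgeConj Ω w ≠ 0 := by
  by_contra! hw
  have hpair : ∀ x y, wedgeConjPair Ω x y = 0 := by
    refine wedgeConjPair_eq_zero Ω fun w => ?_
    have := hw w
    rw [wedgeConj, mul_eq_zero] at this
    exact this.resolve_left (by simp [Nat.factorial_ne_zero])
  obtain ⟨e, he⟩ : ∃ e, Ω e ≠ 0 := by
    by_contra! h
    exact hΩ (AlternatingMap.ext h)
  let x : Fin (2 * n) → T := fun k => if h : (k : ℕ) < n then e ⟨k, h⟩ else 0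
  let y : Fin (2 * n) → T := fun k => if h : (k : ℕ) < n then 0 else e ⟨k - n, by omega⟩
  have hterm : ∀ σ : Equiv.Perm (Fin (2 * n)), ∃ r : ℝ, 0 ≤ r ∧ (σ = 1 → 0 < r) ∧
      ((Equiv.Perm.sign σ : ℤ) : ℂ) * (Ω (fun i => x (σ ⟨i, by omega⟩)) *
      (starRingEnd ℂ) (Ω (fun i => y (σ ⟨n + i, by omega⟩)))) = r := by
    intro σ
    -- If `σ` preserves the first block, it is a pair of permutations `σ₁, σ₂` of the blocks; the
    -- signs from reordering both copies of `e` cancel `sign σ`, leaving `|Ω e|²`. Otherwise a zero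
    -- vector enters `Ω` and the term vanishes.
    by_cases hσ : ∀ i : Fin n, (σ ⟨i, by omega⟩ : ℕ) < n
    · let ε : Fin n ⊕ Fin n ≃ Fin (2 * n) := finSumFinEquiv.trans (finCongr (two_mul n).symm)
      have hl : ∀ i, ε (Sum.inl i) = ⟨i, by omega⟩ := fun i => by ext; simp [ε]
      have hr : ∀ i, ε (Sum.inr i) = ⟨n + i, by omega⟩ := fun i => by
        ext; simp [ε, add_comm]
      obtain ⟨⟨σ₁, σ₂⟩, hσ₁₂⟩ := Equiv.Perm.mem_sumCongrHom_range_of_perm_mapsTo_inl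
        (σ := ε.symm.permCongr σ) (by
          rintro _ ⟨i, rfl⟩
          refine ⟨⟨_, hσ i⟩, ?_⟩
          rw [Equiv.permCongr_apply, Equiv.eq_symm_apply, hl, Equiv.symm_symm, hl])
      have hσε : ∀ s, σ (ε s) = ε (Equiv.sumCongr σ₁ σ₂ s) := by
        intro s
        have := congrArg (fun τ : Equiv.Perm (Fin n ⊕ Fin n) => ε (τ s)) hσ₁₂
        simpa using this.symm
      have hsign : Equiv.Perm.sign σ = Equiv.Perm.sign σ₁ * Equiv.Perm.sign σ₂ := by
        rw [← Equiv.Perm.sign_permCongr ε.symm σ, ← hσ₁₂, Equiv.Perm.sumCongrHom_apply,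
          Equiv.Perm.sign_sumCongr]
      have h1 : (fun i : Fin n => x (σ ⟨i, by omega⟩)) = e ∘ σ₁ := by
        ext i
        rw [← hl, hσε, Equiv.sumCongr_apply, Sum.map_inl, hl]
        simp [x]
      have h2 : (fun i : Fin n => y (σ ⟨n + i, by omega⟩)) = e ∘ σ₂ := by
        ext i
        rw [← hr, hσε, Equiv.sumCongr_apply, Sum.map_inr, hr]
        simp [y]
      refine ⟨‖Ω e‖ ^ 2, by positivity, fun _ => by positivity, ?_⟩
      rw [h1, h2, AlternatingMap.map_perm, AlternatingMap.map_perm, hsign]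
      have h3 : (Ω e) * (starRingEnd ℂ) (Ω e) = ((‖Ω e‖ ^ 2 : ℝ) : ℂ) := by
        rw [Complex.mul_conj, Complex.normSq_eq_norm_sq]
      rw [← h3]
      rcases Int.units_eq_one_or (Equiv.Perm.sign σ₁) with h | h <;>
        rcases Int.units_eq_one_or (Equiv.Perm.sign σ₂) with h' | h' <;> simp [h, h']
    · push Not at hσ
      obtain ⟨i, hi⟩ := hσ
      refine ⟨0, le_rfl, fun h => ?_, ?_⟩
      · subst h
        exact absurd hi (by simp)
      · rw [Ω.map_coord_zero i (by simp [x, hi])]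
        simp
  choose r hr hr1 hr2 using hterm
  have := hpair x y
  simp only [wedgeConjPair, hr2] at this
  rw [← Complex.ofReal_sum, Complex.ofReal_eq_zero] at this
  have h1 := (Finset.sum_eq_zero_iff_of_nonneg fun σ _ => hr σ).1 this 1 (Finset.mem_univ _)
  exact (hr1 1 rfl).ne' h1

end

end Exterior

/-! ### Calculus in normed spaces -/

section Calculus

theorem two_le_smooth : (2 : WithTop ℕ∞) ≤ ∞ := ENat.LEInfty.out

/-- Infinitesimal invariance of a closed `2`-form `B` under an action `A` whose fundamental vector
fields are Hamiltonian. -/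
theorem fderiv_pullback_twoForm_eq_zero {E F : Type*} [NormedAddCommGroup E] [NormedSpace ℝ E]
    [NormedAddCommGroup F] [NormedSpace ℝ F] {A : F × E → E} {x₀ : F} {y₀ : E}
    (hA : ContDiffAt ℝ ∞ A (x₀, y₀)) (hA₀ : ∀ᶠ y in 𝓝 y₀, A (x₀, y) = y)
    {B : E → E →L[ℝ] E →L[ℝ] ℝ} (hB : DifferentiableAt ℝ B y₀)
    (hanti : ∀ y u v, B y u v = - B y v u)
    (hclosed : ∀ u v w, fderiv ℝ B y₀ u v w - fderiv ℝ B y₀ v u w + fderiv ℝ B y₀ w u v = 0)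
    {m : E → ℝ} {ξ : F} (hm : ContDiffAt ℝ ∞ m y₀)
    (hmB : ∀ᶠ y in 𝓝 y₀, ∀ v, fderiv ℝ m y v = - B y (fderiv ℝ A (x₀, y) (ξ, 0)) v) (u v : E) :
    DifferentiableAt ℝ (fun x => B (A (x, y₀)) (fderiv ℝ A (x, y₀) (0, u))
      (fderiv ℝ A (x, y₀) (0, v))) x₀ ∧
    fderiv ℝ (fun x => B (A (x, y₀)) (fderiv ℝ A (x, y₀) (0, u))
      (fderiv ℝ A (x, y₀) (0, v))) x₀ ξ = 0 := by
  have hA00 : A (x₀, y₀) = y₀ := hA₀.self_of_nhds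
  have hAd : HasFDerivAt A (fderiv ℝ A (x₀, y₀)) (x₀, y₀) :=
    (hA.differentiableAt (by simp)).hasFDerivAt
  have hA' : ContDiffAt ℝ ∞ (fderiv ℝ A) (x₀, y₀) := hA.fderiv_right (by simp)
  have hS : HasFDerivAt (fderiv ℝ A) (fderiv ℝ (fderiv ℝ A) (x₀, y₀)) (x₀, y₀) :=
    (hA'.differentiableAt (by simp)).hasFDerivAt
  have hsymA : IsSymmSndFDerivAt ℝ A (x₀, y₀) := hA.isSymmSndFDerivAt (by simpa using two_le_smooth)
  have hsymm : IsSymmSndFDerivAt ℝ m y₀ := hm.isSymmSndFDerivAt (by simpa using two_le_smooth)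
  have hm' : DifferentiableAt ℝ (fderiv ℝ m) y₀ :=
    (hm.fderiv_right (m := ∞) (by simp)).differentiableAt (by simp)
  set S := fderiv ℝ (fderiv ℝ A) (x₀, y₀)
  set D := fderiv ℝ A (x₀, y₀)
  -- `A (x₀, ·)` is the identity near `y₀`, so its differential there is the identity.
  have hD0 : ∀ w, D (0, w) = w := by
    intro w
    have h1 : HasFDerivAt (fun y => A (x₀, y)) (D ∘L ContinuousLinearMap.inr ℝ F E) y₀ :=
      hAd.comp y₀ (hasFDerivAt_prodMk_right x₀ y₀)
    have h2 : HasFDerivAt (fun y => A (x₀, y)) (ContinuousLinearMap.id ℝ E) y₀ :=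
      (hasFDerivAt_id y₀).congr_of_eventuallyEq hA₀
    simpa using congrArg (fun f => f w) (h1.unique h2)
  have hDc : ∀ w, HasFDerivAt (fun x => fderiv ℝ A (x, y₀) (0, w))
      ((S ∘L ContinuousLinearMap.inl ℝ F E).flip (0, w)) x₀ := by
    intro w
    have h1 : HasFDerivAt (fun x => fderiv ℝ A (x, y₀)) (S ∘L ContinuousLinearMap.inl ℝ F E) x₀ :=
      hS.comp x₀ (hasFDerivAt_prodMk_left x₀ y₀)
    have := h1.clm_apply (hasFDerivAt_const ((0 : F), w) x₀)
    simpa using this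
  have hAc : HasFDerivAt (fun x => A (x, y₀)) (D ∘L ContinuousLinearMap.inl ℝ F E) x₀ :=
    hAd.comp x₀ (hasFDerivAt_prodMk_left x₀ y₀)
  have hBA : HasFDerivAt (fun x => B (A (x, y₀)))
      (fderiv ℝ B y₀ ∘L (D ∘L ContinuousLinearMap.inl ℝ F E)) x₀ := by
    have hB' := hB.hasFDerivAt
    exact HasFDerivAt.comp (g := B) x₀ (hA00.symm ▸ hB') hAc
  have hmain := (hBA.clm_apply (hDc u)).clm_apply (hDc v)
  refine ⟨hmain.differentiableAt, ?_⟩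
  rw [hmain.fderiv]
  -- The vector field generated by `ξ` is `X(y) = D A(x₀, y)(ξ, 0)`; its derivative is a mixed
  -- second derivative of `A`.
  have hX : HasFDerivAt (fun y => fderiv ℝ A (x₀, y) (ξ, 0))
      ((S ∘L ContinuousLinearMap.inr ℝ F E).flip (ξ, 0)) y₀ := by
    have h1 : HasFDerivAt (fun y => fderiv ℝ A (x₀, y)) (S ∘L ContinuousLinearMap.inr ℝ F E) y₀ :=
      hS.comp y₀ (hasFDerivAt_prodMk_right x₀ y₀)
    have := h1.clm_apply (hasFDerivAt_const (ξ, (0 : E)) y₀)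
    simpa using this
  have hmm : ∀ a b, fderiv ℝ (fderiv ℝ m) y₀ a b =
      - (fderiv ℝ B y₀ a (D (ξ, 0)) b + B y₀ (S (0, a) (ξ, 0)) b) := by
    intro a b
    have h1 : HasFDerivAt (fun y => fderiv ℝ m y b) ((fderiv ℝ (fderiv ℝ m) y₀).flip b) y₀ := by
      simpa using hm'.hasFDerivAt.clm_apply (hasFDerivAt_const b y₀)
    have h2 := ((hB.hasFDerivAt.clm_apply hX).clm_apply (hasFDerivAt_const b y₀)).fun_neg
    have h3 := h2.congr_of_eventuallyEq (hmB.mono fun y hy => hy b)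
    have h4 := congrArg (fun f => f a) (h1.unique h3)
    simp only [ContinuousLinearMap.flip_apply] at h4
    rw [h4]
    simp [D]
    ring
  -- Cartan's formula by hand: symmetry of `D²m` says that `i_X B` is closed, `h6` is `dB = 0` with
  -- `X` inserted, and symmetry of `D²A` (`h7`) identifies the derivative along `ξ` of the
  -- differential of `A (x, ·)` with the derivative of `X`.
  have h5 := hsymm u v
  rw [hmm, hmm] at h5
  have h6 := hclosed (D (ξ, 0)) u v
  have h7 : ∀ w, S (ξ, 0) (0, w) = S (0, w) (ξ, 0) := fun w => hsymA _ _
  have e1 := hanti y₀ u (S (0, v) (ξ, 0))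
  simp [hD0, hA00, h7, D] at h5 h6 e1 ⊢
  linarith

/-- A real smooth map between complex spaces whose differential commutes with `i` is holomorphic,
and so are the components of its differential. -/
theorem differentiableAt_complex_of_commute {E E' : Type*} [NormedAddCommGroup E] [NormedSpace ℂ E]
    [NormedAddCommGroup E'] [NormedSpace ℂ E'] {f : E → E'} {y₀ : E} (hf : ContDiffAt ℝ ∞ f y₀)
    (hI : ∀ᶠ y in 𝓝 y₀, ∀ v, fderiv ℝ f y (Complex.I • v) = Complex.I • fderiv ℝ f y v) :
    DifferentiableAt ℂ f y₀ ∧ ∀ v, DifferentiableAt ℂ (fun y => fderiv ℝ f y v) y₀ := by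
  have key : ∀ g : E →L[ℝ] E', (∀ v, g (Complex.I • v) = Complex.I • g v) →
      ∃ g' : E →L[ℂ] E', g'.restrictScalars ℝ = g := by
    intro g hg
    refine ⟨⟨{ toFun := g, map_add' := g.map_add, map_smul' := ?_ }, g.continuous⟩, rfl⟩
    intro c v
    have h1 : c • v = c.re • v + c.im • (Complex.I • v) := by
      conv_lhs => rw [← Complex.re_add_im c]
      rw [add_smul, mul_smul, Complex.coe_smul, Complex.coe_smul]
    have h2 : c • g v = c.re • g v + c.im • (Complex.I • g v) := by
      conv_lhs => rw [← Complex.re_add_im c]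
      rw [add_smul, mul_smul, Complex.coe_smul, Complex.coe_smul]
    simp [h1, h2, hg]
  have hd : DifferentiableAt ℝ f y₀ := hf.differentiableAt (by simp)
  have hd' : DifferentiableAt ℝ (fderiv ℝ f) y₀ :=
    (hf.fderiv_right (m := ∞) (by simp)).differentiableAt (by simp)
  have hsymm : IsSymmSndFDerivAt ℝ f y₀ := hf.isSymmSndFDerivAt (by simpa using two_le_smooth)
  refine ⟨(differentiableAt_iff_restrictScalars ℝ hd).2 (key _ hI.self_of_nhds), fun v => ?_⟩
  have hdv : HasFDerivAt (fun y => fderiv ℝ f y v) ((fderiv ℝ (fderiv ℝ f) y₀).flip v) y₀ := by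
    simpa using hd'.hasFDerivAt.clm_apply (hasFDerivAt_const v y₀)
  refine (differentiableAt_iff_restrictScalars ℝ hdv.differentiableAt).2 (key _ fun w => ?_)
  rw [hdv.fderiv]
  simp only [ContinuousLinearMap.flip_apply]
  -- Symmetry of `D²f` moves the factor `i` into the slot of the first derivative, where the
  -- commutation hypothesis, valid near `y₀`, can be differentiated in the direction `v`.
  rw [hsymm, hsymm w v]
  have h1 : HasFDerivAt (fun y => fderiv ℝ f y (Complex.I • w))
      ((fderiv ℝ (fderiv ℝ f) y₀).flip (Complex.I • w)) y₀ := by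
    simpa using hd'.hasFDerivAt.clm_apply (hasFDerivAt_const (Complex.I • w) y₀)
  have h2 : HasFDerivAt (fun y => fderiv ℝ f y w) ((fderiv ℝ (fderiv ℝ f) y₀).flip w) y₀ := by
    simpa using hd'.hasFDerivAt.clm_apply (hasFDerivAt_const w y₀)
  have h3 := (h2.const_smul Complex.I).congr_of_eventuallyEq (hI.mono fun y hy => hy w)
  exact congrArg (fun f => f v) (h1.unique h3)

/-- The constant rank theorem: near `x₀` the map `f` factors through a submersion `r` with a smooth
section `σ`. -/
theorem exists_constant_rank_factorization {E F : Type*} [NormedAddCommGroup E] [NormedSpace ℝ E]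
    [NormedAddCommGroup F] [NormedSpace ℝ F] [FiniteDimensional ℝ E] [FiniteDimensional ℝ F]
    {f : F → E} {O : Set F} {x₀ : F} {m : ℕ} (hO : IsOpen O) (hx₀ : x₀ ∈ O)
    (hf : ContDiffOn ℝ ∞ f O) (hrank : ∀ x ∈ O, finrank ℝ (fderiv ℝ f x).range = m) :
    ∃ (U : Set F) (B : Set (EuclideanSpace ℝ (Fin m))) (r : F → EuclideanSpace ℝ (Fin m))
      (σ : EuclideanSpace ℝ (Fin m) → F), IsOpen U ∧ x₀ ∈ U ∧ U ⊆ O ∧ IsOpen B ∧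
      ContDiffOn ℝ ∞ r U ∧ ContDiffOn ℝ ∞ σ B ∧ MapsTo r U B ∧ MapsTo σ B U ∧
      (∀ w ∈ B, r (σ w) = w) ∧ σ (r x₀) = x₀ ∧ (∀ x ∈ U, ∀ y ∈ U, f x = f y ↔ r x = r y) ∧
      ∀ ξ, fderiv ℝ f x₀ ξ = 0 → fderiv ℝ r x₀ ξ = 0 := by
  have hfx : ∀ x ∈ O, ContDiffAt ℝ ∞ f x := fun x hx => hf.contDiffAt (hO.mem_nhds hx)
  set f' := fderiv ℝ f x₀ with hf'
  have hfd : ∀ x ∈ O, HasFDerivAt f (fderiv ℝ f x) x := fun x hx =>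
    ((hfx x hx).differentiableAt (by simp)).hasFDerivAt
  -- `p` maps the range of `f'` isomorphically onto `ℝᵐ` and `q` below is a projection onto `ker
  -- f'`, so `Q = (p ∘ f, q)` is a local diffeomorphism at `x₀`.
  obtain ⟨p₀, hp₀⟩ := LinearMap.exists_extend
    (LinearEquiv.ofFinrankEq f'.range (EuclideanSpace ℝ (Fin m)) (by simp [f', hrank x₀ hx₀])).toLinearMap
  let p : E →L[ℝ] EuclideanSpace ℝ (Fin m) := p₀.toContinuousLinearMap
  have hp : ∀ v, p (f' v) = 0 → f' v = 0 := by
    intro v hv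
    have h1 := congrArg (fun g => g ⟨f' v, v, rfl⟩) hp₀
    have h2 := ((LinearEquiv.map_eq_zero_iff _).1 (h1.symm.trans hv))
    exact congrArg Subtype.val h2
  let N : Submodule ℝ F := LinearMap.ker f'.toLinearMap
  obtain ⟨q₀, hq₀⟩ := LinearMap.exists_extend (LinearMap.id : N →ₗ[ℝ] N)
  let q : F →L[ℝ] N := q₀.toContinuousLinearMap
  have hq : ∀ v, f' v = 0 → q v = 0 → v = 0 := by
    intro v hv hv'
    have h1 := congrArg (fun g => g ⟨v, hv⟩) hq₀
    have h2 : (⟨v, hv⟩ : N) = 0 := h1.symm.trans hv'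
    exact congrArg Subtype.val h2
  let Q : F → EuclideanSpace ℝ (Fin m) × N := fun x => (p (f x), q x)
  have hQ : ∀ x ∈ O, ContDiffAt ℝ ∞ Q x := fun x hx =>
    (p.contDiff.contDiffAt.comp x (hfx x hx)).prodMk q.contDiff.contDiffAt
  have hQd : ∀ x ∈ O, HasFDerivAt Q ((p ∘L fderiv ℝ f x).prod q) x := fun x hx =>
    (p.hasFDerivAt.comp x (hfd x hx)).prodMk q.hasFDerivAt
  have hdim : finrank ℝ F = finrank ℝ (EuclideanSpace ℝ (Fin m) × N) := by
    have h1 := LinearMap.finrank_range_add_finrank_ker f'.toLinearMap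
    have h2 : finrank ℝ (LinearMap.range f'.toLinearMap) = m := hrank x₀ hx₀
    rw [h2] at h1
    rw [finrank_prod, finrank_euclideanSpace_fin]
    exact h1.symm
  have hinj : Function.Injective ((p ∘L f').prod q).toLinearMap := by
    rw [injective_iff_map_eq_zero]
    intro v hv
    have hv1 : p (f' v) = 0 := congrArg Prod.fst hv
    have hv2 : q v = 0 := congrArg Prod.snd hv
    exact hq v (hp v hv1) hv2
  let e₀ : F ≃L[ℝ] (EuclideanSpace ℝ (Fin m) × N) :=
    (LinearEquiv.ofInjectiveOfFinrankEq _ hinj hdim).toContinuousLinearEquiv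
  have he₀ : (e₀ : F →L[ℝ] EuclideanSpace ℝ (Fin m) × N) = (p ∘L f').prod q := by
    ext v <;> rfl
  have hQ₀ : HasFDerivAt Q (e₀ : F →L[ℝ] EuclideanSpace ℝ (Fin m) × N) x₀ := by
    rw [he₀]; exact hQd x₀ hx₀
  let Ψ := (hQ x₀ hx₀).toOpenPartialHomeomorph Q hQ₀ (by simp)
  have hΨ : ∀ x, Ψ x = Q x := fun x => rfl
  have hΨs : x₀ ∈ Ψ.source := (hQ x₀ hx₀).mem_toOpenPartialHomeomorph_source hQ₀ (by simp)
  have hinv : ∀ᶠ x in 𝓝 x₀, x ∈ O ∧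
      ∃ e : F ≃L[ℝ] (EuclideanSpace ℝ (Fin m) × N), HasFDerivAt Q e.toContinuousLinearMap x := by
    have h1 : ContinuousAt (fderiv ℝ Q) x₀ :=
      ((hQ x₀ hx₀).fderiv_right (m := ∞) (by simp)).continuousAt
    -- Invertibility of the differential is an open condition. It is needed at nearby points too, to
    -- differentiate the inverse of `Q` on a whole ball.
    have h2 := h1.eventually (p := fun g => g ∈ range ContinuousLinearEquiv.toContinuousLinearMap)
      (by rw [hQ₀.fderiv]; exact e₀.nhds)
    filter_upwards [h2, hO.mem_nhds hx₀] with x hx hxO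
    obtain ⟨e, he⟩ := hx
    refine ⟨hxO, e, ?_⟩
    rw [he]
    exact (hQd x hxO).differentiableAt.hasFDerivAt
  have hT : ∀ᶠ z in 𝓝 (Q x₀), z ∈ Ψ.target ∧ Ψ.symm z ∈ O ∧
      ∃ e : F ≃L[ℝ] (EuclideanSpace ℝ (Fin m) × N),
        HasFDerivAt Q e.toContinuousLinearMap (Ψ.symm z) := by
    have h1 : ContinuousAt Ψ.symm (Q x₀) := Ψ.continuousAt_symm (Ψ.map_source hΨs)
    have h2 : Ψ.symm (Q x₀) = x₀ := Ψ.left_inv hΨs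
    filter_upwards [Ψ.open_target.mem_nhds (Ψ.map_source hΨs),
      h1.eventually (h2.symm ▸ hinv)] with z hz hz'
    exact ⟨hz, hz'⟩
  obtain ⟨ε, hε, hball⟩ := Metric.eventually_nhds_iff_ball.1 hT
  set w₀ := p (f x₀)
  set k₀ := q x₀
  have hmem : ∀ w ∈ Metric.ball w₀ ε, ∀ k ∈ Metric.ball k₀ ε, (w, k) ∈ Metric.ball (Q x₀) ε := by
    intro w hw k hk
    rw [← ball_prod_same]
    exact ⟨hw, hk⟩
  -- In the coordinates `(w, k)` given by `Q`, `f` does not depend on `k`. Moving along `k` fixes `p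
  -- ∘ f = w`; and at nearby points `p` is still injective on the range of the differential, since
  -- it maps this range, of dimension `m` by hypothesis, onto `ℝᵐ`.
  have hconst : ∀ w ∈ Metric.ball w₀ ε, ∀ k ∈ Metric.ball k₀ ε,
      f (Ψ.symm (w, k)) = f (Ψ.symm (w, k₀)) := by
    intro w hw k hk
    have hd : ∀ k ∈ Metric.ball k₀ ε,
        HasFDerivAt (fun k => f (Ψ.symm (w, k))) (0 : N →L[ℝ] E) k := by
      intro k hk
      obtain ⟨hzt, hzO, e, he⟩ := hball _ (hmem w hw k hk)
      have h1 := (hfd _ hzO).comp (w, k) (Ψ.hasFDerivAt_symm hzt he)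
      have h2 := h1.comp k (hasFDerivAt_prodMk_right w k)
      refine h2.congr_fderiv ?_
      ext k'
      have h3 : ∀ v, e v = (p (fderiv ℝ f (Ψ.symm (w, k)) v), q v) := fun v =>
        congrArg (fun g => g v) (he.unique (hQd _ hzO))
      set x := Ψ.symm (w, k)
      set v := e.symm (0, k')
      have h4 : p (fderiv ℝ f x v) = 0 := by
        have := h3 v
        rw [e.apply_symm_apply] at this
        exact (congrArg Prod.fst this).symm
      have h5 : Function.Surjective (p₀ ∘ₗ (LinearMap.range (fderiv ℝ f x).toLinearMap).subtype) := by
        intro w'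
        obtain ⟨v', hv'⟩ := e.surjective (w', 0)
        refine ⟨⟨fderiv ℝ f x v', v', rfl⟩, ?_⟩
        rw [h3] at hv'
        exact congrArg Prod.fst hv'
      have h6 := (LinearMap.injective_iff_surjective_of_finrank_eq_finrank
        (by rw [finrank_euclideanSpace_fin]; exact hrank x hzO)).2 h5
      have h7 := @h6 ⟨fderiv ℝ f x v, v, rfl⟩ 0 (by rw [map_zero]; exact h4)
      exact congrArg Subtype.val h7
    exact Metric.isOpen_ball.is_const_of_fderiv_eq_zero (𝕜 := ℝ) (convex_ball _ _).isPreconnected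
      (fun k hk => (hd k hk).differentiableAt.differentiableWithinAt)
      (fun k hk => (hd k hk).fderiv) hk (Metric.mem_ball_self hε)
  have hback : ∀ x ∈ Ψ.source ∩ Ψ ⁻¹' Metric.ball (Q x₀) ε, p (f x) ∈ Metric.ball w₀ ε ∧
      f x = f (Ψ.symm (p (f x), k₀)) := by
    rintro x ⟨hx1, hx2⟩
    rw [mem_preimage, hΨ, ← ball_prod_same] at hx2
    refine ⟨hx2.1, ?_⟩
    rw [← hconst _ hx2.1 _ hx2.2]
    exact congrArg f (Ψ.left_inv hx1).symm
  have hright : ∀ w ∈ Metric.ball w₀ ε, p (f (Ψ.symm (w, k₀))) = w := by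
    intro w hw
    exact congrArg Prod.fst (Ψ.right_inv (hball _ (hmem w hw k₀ (Metric.mem_ball_self hε))).1)
  have hUO : Ψ.source ∩ Ψ ⁻¹' Metric.ball (Q x₀) ε ⊆ O := by
    rintro x ⟨hx1, hx2⟩
    have := (hball _ hx2).2.1
    rwa [Ψ.left_inv hx1] at this
  -- The submersion is `p ∘ f`, and the section sends `w` to the point with coordinates `(w, k₀)`;
  -- taking `k₀ = q x₀` makes the section pass through `x₀`.
  refine ⟨Ψ.source ∩ Ψ ⁻¹' Metric.ball (Q x₀) ε, Metric.ball w₀ ε, fun x => p (f x),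
    fun w => Ψ.symm (w, k₀), Ψ.isOpen_inter_preimage Metric.isOpen_ball,
    ⟨hΨs, Metric.mem_ball_self hε⟩, hUO, Metric.isOpen_ball, ?_, ?_, fun x hx => (hback x hx).1,
    ?_, hright, Ψ.left_inv hΨs, ?_, ?_⟩
  · exact fun x hx => (p.contDiff.contDiffAt.comp x (hfx x (hUO hx))).contDiffWithinAt
  · intro w hw
    obtain ⟨hzt, hzO, e, he⟩ := hball _ (hmem w hw k₀ (Metric.mem_ball_self hε))
    have h1 : ContDiffAt ℝ ∞ Ψ.symm (w, k₀) := Ψ.contDiffAt_symm hzt he (hQ _ hzO)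
    exact (h1.comp w (contDiffAt_id.prodMk contDiffAt_const)).contDiffWithinAt
  · intro w hw
    have hz := hmem w hw k₀ (Metric.mem_ball_self hε)
    refine ⟨Ψ.map_target (hball _ hz).1, ?_⟩
    rwa [mem_preimage, Ψ.right_inv (hball _ hz).1]
  · intro x hx y hy
    refine ⟨fun h => congrArg p h, fun h => ?_⟩
    rw [(hback x hx).2, (hback y hy).2]
    exact congrArg (fun w => f (Ψ.symm (w, k₀))) h
  · intro ξ hξ
    have h : HasFDerivAt (fun x => p (f x)) (p ∘L fderiv ℝ f x₀) x₀ :=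
      p.hasFDerivAt.comp x₀ (hfd x₀ hx₀)
    rw [h.fderiv]
    simp only [ContinuousLinearMap.comp_apply]
    rw [← hf', hξ, map_zero]

/-- A smooth map with surjective differential has a smooth local section. -/
theorem exists_local_section {E F : Type*} [NormedAddCommGroup E] [NormedSpace ℝ E]
    [NormedAddCommGroup F] [NormedSpace ℝ F] [FiniteDimensional ℝ E] [FiniteDimensional ℝ F]
    {f : F → E} {x₀ : F} (hf : ContDiffAt ℝ ∞ f x₀)
    (hsurj : Function.Surjective (fderiv ℝ f x₀)) :
    ∃ s : E → F, ContDiffAt ℝ ∞ s (f x₀) ∧ s (f x₀) = x₀ ∧ ∀ᶠ y in 𝓝 (f x₀), f (s y) = y := by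
  obtain ⟨T₀, hT₀⟩ := (fderiv ℝ f x₀).toLinearMap.exists_rightInverse_of_surjective
    (LinearMap.range_eq_top.2 hsurj)
  let T : E →L[ℝ] F := T₀.toContinuousLinearMap
  have hT : ∀ v, fderiv ℝ f x₀ (T v) = v := fun v => congrArg (fun g => g v) hT₀
  -- With `T` a linear right inverse of the differential, `f ∘ j` has the identity as differential
  -- at `0`; the section is `j` after the local inverse of `f ∘ j`.
  let j : E → F := fun y => x₀ + T y
  have hj0 : j 0 = x₀ := by simp [j]
  have hj : ContDiff ℝ ∞ j := contDiff_const.add T.contDiff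
  have hg : ContDiffAt ℝ ∞ (f ∘ j) 0 := ContDiffAt.comp 0 (hj0.symm ▸ hf) hj.contDiffAt
  have hgd : HasFDerivAt (f ∘ j) ((ContinuousLinearEquiv.refl ℝ E : E ≃L[ℝ] E) : E →L[ℝ] E) 0 := by
    have h1 : HasFDerivAt j T 0 := T.hasFDerivAt.const_add x₀
    have h2 : HasFDerivAt f (fderiv ℝ f x₀) (j 0) :=
      hj0.symm ▸ (hf.differentiableAt (by simp)).hasFDerivAt
    refine (h2.comp 0 h1).congr_fderiv ?_
    ext v; exact hT v
  let Ψ := hg.toOpenPartialHomeomorph (f ∘ j) hgd (by simp)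
  have hs : (0 : E) ∈ Ψ.source := hg.mem_toOpenPartialHomeomorph_source hgd (by simp)
  have h0 : Ψ 0 = f x₀ := congrArg f hj0
  have ht : f x₀ ∈ Ψ.target := h0 ▸ Ψ.map_source hs
  have hsymm : Ψ.symm (f x₀) = 0 := h0 ▸ Ψ.left_inv hs
  refine ⟨fun y => j (Ψ.symm y), ?_, by simp only [hsymm, hj0], ?_⟩
  · exact hj.contDiffAt.comp _ (Ψ.contDiffAt_symm ht (hsymm.symm ▸ hgd) (hsymm.symm ▸ hg))
  · filter_upwards [Ψ.open_target.mem_nhds ht] with y hy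
    exact Ψ.right_inv hy

end Calculus

/-! ### Differentials of maps with local inverses -/

section LocalInverse

variable {E₁ : Type*} [NormedAddCommGroup E₁] [NormedSpace ℝ E₁]
  {H₁ : Type*} [TopologicalSpace H₁] {I₁ : ModelWithCorners ℝ E₁ H₁}
  {E₂ : Type*} [NormedAddCommGroup E₂] [NormedSpace ℝ E₂]
  {H₂ : Type*} [TopologicalSpace H₂] {I₂ : ModelWithCorners ℝ E₂ H₂}
  {N : Type*} [TopologicalSpace N] [ChartedSpace H₁ N]
  {P : Type*} [TopologicalSpace P] [ChartedSpace H₂ P]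

theorem mfderiv_leftInverse {f : N → P} {g : P → N} {x : N} {y : P} (hy : f x = y)
    (hf : MDifferentiableAt I₁ I₂ f x) (hg : MDifferentiableAt I₂ I₁ g y)
    (hgf : ∀ᶠ z in 𝓝 x, g (f z) = z) (v : TangentSpace I₁ x) :
    (mfderiv I₂ I₁ g y (mfderiv I₁ I₂ f x v : E₂) : E₁) = v := by
  subst hy
  have h1 : HasMFDerivAt I₁ I₁ (g ∘ f) x (ContinuousLinearMap.id ℝ (TangentSpace I₁ x)) :=
    (hasMFDerivAt_id x).congr_of_eventuallyEq hgf
  exact congrArg (fun A => A v) (hasMFDerivAt_unique (hg.hasMFDerivAt.comp x hf.hasMFDerivAt) h1)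

theorem hasFDerivAt_of_hasMFDerivAt {f : E₁ → E₂} {x : E₁} {f' : E₁ →L[ℝ] E₂}
    (h : HasMFDerivAt 𝓘(ℝ, E₁) 𝓘(ℝ, E₂) f x f') : HasFDerivAt f f' x :=
  h.hasFDerivAt

theorem finrank_range_comp {A B C D : Type*} [AddCommGroup A] [Module ℝ A] [AddCommGroup B]
    [Module ℝ B] [AddCommGroup C] [Module ℝ C] [AddCommGroup D] [Module ℝ D]
    (a : A →ₗ[ℝ] B) (b : B →ₗ[ℝ] C) (c : C →ₗ[ℝ] D) (ha : Function.Surjective a)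
    (hc : Function.Injective c) (g : A →ₗ[ℝ] D) (hg : ∀ v, g v = c (b (a v))) :
    finrank ℝ (LinearMap.range g) = finrank ℝ (LinearMap.range b) := by
  obtain rfl : g = c ∘ₗ b ∘ₗ a := LinearMap.ext hg
  rw [LinearMap.range_comp, LinearMap.range_comp_of_range_eq_top _ (LinearMap.range_eq_top.2 ha)]
  exact (Submodule.equivMapOfInjective c hc _).finrank_eq.symm

end LocalInverse

/-! ### The homogeneous space of a stabilizer -/

section Slices

variable {F : Type*} [NormedAddCommGroup F] [NormedSpace ℝ F]
  {H : Type*} [TopologicalSpace H] [ChartedSpace F H] [Group H]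

variable (F) in
/-- A local slice at `1` for the right translations by a subgroup `K`: a submersion `r`, defined
near `1`, whose fibres are contained in the cosets of `K`, with a smooth section `σ`. -/
structure CosetSlice (K : Subgroup H) (m : ℕ) where
  /-- the domain of the submersion -/
  U : Set H
  /-- the image of the submersion -/
  B : Set (EuclideanSpace ℝ (Fin m))
  /-- the submersion -/
  r : H → EuclideanSpace ℝ (Fin m)
  /-- the section -/
  σ : EuclideanSpace ℝ (Fin m) → H
  isOpen_U : IsOpen U
  one_mem : 1 ∈ U
  isOpen_B : IsOpen B
  smooth_r : ContMDiffOn 𝓘(ℝ, F) (𝓡 m) ∞ r U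
  smooth_σ : ContMDiffOn (𝓡 m) 𝓘(ℝ, F) ∞ σ B
  mapsTo_r : MapsTo r U B
  mapsTo_σ : MapsTo σ B U
  r_σ : ∀ w ∈ B, r (σ w) = w
  σ_r_one : σ (r 1) = 1
  mem_iff : ∀ x ∈ U, ∀ y ∈ U, x⁻¹ * y ∈ K ↔ r x = r y

/-- The orbit map `f` satisfies `f = L_h ∘ f ∘ (h⁻¹ * ·)`, so its rank is constant, and its fibres
are exactly the left cosets of the stabilizer. The constant rank theorem in charts therefore gives
the slice directly. The clause on differentials says that `r` is infinitesimally constant along the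
kernel of the infinitesimal action; it later yields the injectivity of `T(H/K) → T M`. -/
theorem exists_cosetSlice [FiniteDimensional ℝ F] [LieGroup 𝓘(ℝ, F) ∞ H]
    {E : Type*} [NormedAddCommGroup E] [NormedSpace ℝ E] [FiniteDimensional ℝ E]
    {M : Type*} [TopologicalSpace M] [ChartedSpace E M] [IsManifold 𝓘(ℝ, E) ∞ M]
    [MulAction H M] [ContMDiffSMul 𝓘(ℝ, F) 𝓘(ℝ, E) ∞ H M] (p : M) :
    ∃ (m : ℕ) (S : CosetSlice F (MulAction.stabilizer H p) m),
      ∀ ξ : GroupLieAlgebra 𝓘(ℝ, F) H,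
        (mfderiv 𝓘(ℝ, F) 𝓘(ℝ, E) (fun h : H => h • p) 1 ξ : E) = 0 →
          (mfderiv 𝓘(ℝ, F) (𝓡 m) S.r 1 ξ : EuclideanSpace ℝ (Fin m)) = 0 := by
  have : IsManifold 𝓘(ℝ, F) ∞ H := inferInstance
  have : IsManifold 𝓘(ℝ, F) 1 H := isManifold_one
  have : IsManifold 𝓘(ℝ, E) 1 M := IsManifold.of_le (n := ∞) (by simp)
  let f : H → M := fun h => h • p
  have hf : ContMDiff 𝓘(ℝ, F) 𝓘(ℝ, E) ∞ f :=
    (contMDiff_smul (I := 𝓘(ℝ, F)) (I' := 𝓘(ℝ, E)) (n := ∞) (G := H) (M := M)).comp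
      (contMDiff_id.prodMk contMDiff_const)
  have hfd : ∀ h, MDifferentiableAt 𝓘(ℝ, F) 𝓘(ℝ, E) f h := fun h =>
    hf.contMDiffAt.mdifferentiableAt (by simp)
  let ψ := chartAt F (1 : H)
  let φ := chartAt E p
  let O : Set F := ψ.target ∩ ψ.symm ⁻¹' (f ⁻¹' φ.source)
  have hO : IsOpen O := ψ.symm.isOpen_inter_preimage (φ.open_source.preimage hf.continuous)
  have h1s : (1 : H) ∈ ψ.source := mem_chart_source F 1
  have hψ1 : ψ.symm (ψ 1) = 1 := ψ.left_inv h1s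
  have hps : p ∈ φ.source := mem_chart_source E p
  have hx₀ : ψ 1 ∈ O := by
    refine ⟨ψ.map_source h1s, ?_⟩
    simpa [hψ1, f] using hps
  let fc : F → E := fun x => φ (f (ψ.symm x))
  have hfc : ContDiffOn ℝ ∞ fc O := by
    rw [← contMDiffOn_iff_contDiffOn]
    refine (contMDiffOn_chart (I := 𝓘(ℝ, E)) (x := p)).comp (hf.comp_contMDiffOn
      ((contMDiffOn_chart_symm (I := 𝓘(ℝ, F)) (x := (1 : H))).mono inter_subset_left)) ?_
    exact fun x hx => hx.2
  have hfcd : ∀ x ∈ O, ∀ v, fderiv ℝ fc x v = mfderiv 𝓘(ℝ, E) 𝓘(ℝ, E) φ (f (ψ.symm x))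
      (mfderiv 𝓘(ℝ, F) 𝓘(ℝ, E) f (ψ.symm x) (mfderiv 𝓘(ℝ, F) 𝓘(ℝ, F) ψ.symm x v)) := by
    intro x hx v
    have h1 := (mdifferentiableAt_atlas_symm (I := 𝓘(ℝ, F)) (chart_mem_atlas F (1 : H))
      hx.1).hasMFDerivAt
    have h2 := (mdifferentiableAt_atlas (I := 𝓘(ℝ, E)) (chart_mem_atlas E p) hx.2).hasMFDerivAt
    have h3 := h2.comp x ((hfd (ψ.symm x)).hasMFDerivAt.comp x h1)
    exact congrArg (fun A : F →L[ℝ] E => A v) (hasFDerivAt_of_hasMFDerivAt h3).fderiv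
  have hrank : ∀ h, finrank ℝ (LinearMap.range
      (mfderiv 𝓘(ℝ, F) 𝓘(ℝ, E) f h : F →L[ℝ] E).toLinearMap) =
      finrank ℝ (LinearMap.range (mfderiv 𝓘(ℝ, F) 𝓘(ℝ, E) f 1 : F →L[ℝ] E).toLinearMap) := by
    intro h
    have hl : ∀ g h : H, MDifferentiableAt 𝓘(ℝ, F) 𝓘(ℝ, F) (fun x : H => g * x) h := fun g h =>
      (contMDiff_mul_left (I := 𝓘(ℝ, F)) (n := ∞) (a := g)).contMDiffAt.mdifferentiableAt (by simp)
    have hL : ∀ (g : H) (q : M), MDifferentiableAt 𝓘(ℝ, E) 𝓘(ℝ, E) (fun x : M => g • x) q :=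
      fun g q => ((contMDiff_smul (I := 𝓘(ℝ, F)) (I' := 𝓘(ℝ, E)) (n := ∞) (G := H) (M := M)).comp
        (contMDiff_const.prodMk contMDiff_id)).contMDiffAt.mdifferentiableAt (by simp)
    have hf1 : f 1 = p := one_smul H p
    refine finrank_range_comp (mfderiv 𝓘(ℝ, F) 𝓘(ℝ, F) (fun x : H => h⁻¹ * x) h : F →L[ℝ] F).toLinearMap
      _ (mfderiv 𝓘(ℝ, E) 𝓘(ℝ, E) (fun x : M => h • x) p : E →L[ℝ] E).toLinearMap ?_ ?_ _ ?_
    · intro v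
      exact ⟨_, mfderiv_leftInverse (by simp) (hl h 1) (hl h⁻¹ h) (by simp) v⟩
    · intro u v huv
      have key := mfderiv_leftInverse (I₁ := 𝓘(ℝ, E)) (I₂ := 𝓘(ℝ, E)) rfl (hL h p) (hL h⁻¹ (h • p))
        (by simp)
      rw [← key u, ← key v]
      exact congrArg _ huv
    · intro v
      have h1 : f = (fun x : M => h • x) ∘ f ∘ fun x : H => h⁻¹ * x := by
        ext x; simp [f, ← mul_smul]
      conv_lhs => rw [h1]
      have h2 : MDifferentiableAt 𝓘(ℝ, F) 𝓘(ℝ, E) (f ∘ fun x : H => h⁻¹ * x) h :=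
        (hfd _).comp h (hl h⁻¹ h)
      exact (mfderiv_comp_apply_of_eq h (hL h p) h2 (by simp [f]) v).trans
        (congrArg _ (mfderiv_comp_apply_of_eq h (hfd 1) (hl h⁻¹ h) (by simp) v))
  have hrankc : ∀ x ∈ O, finrank ℝ (fderiv ℝ fc x).range = finrank ℝ (LinearMap.range
      (mfderiv 𝓘(ℝ, F) 𝓘(ℝ, E) f 1 : F →L[ℝ] E).toLinearMap) := by
    intro x hx
    rw [← hrank (ψ.symm x)]
    refine finrank_range_comp (mfderiv 𝓘(ℝ, F) 𝓘(ℝ, F) ψ.symm x : F →L[ℝ] F).toLinearMap _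
      (mfderiv 𝓘(ℝ, E) 𝓘(ℝ, E) φ (f (ψ.symm x)) : E →L[ℝ] E).toLinearMap ?_ ?_ _ (hfcd x hx)
    · exact (mdifferentiable_chart (I := 𝓘(ℝ, F)) (1 : H)).symm.mfderiv_surjective hx.1
    · exact (mdifferentiable_chart (I := 𝓘(ℝ, E)) p).mfderiv_injective hx.2
  obtain ⟨U, B, r, σ, hU, h1U, hUO, hB, hr, hσ, hrU, hσB, hrσ, hσr, hiff, hker⟩ :=
    exists_constant_rank_factorization hO hx₀ hfc hrankc
  have hUt : U ⊆ ψ.target := hUO.trans inter_subset_left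
  refine ⟨_, { 
    U := ψ.source ∩ ψ ⁻¹' U
    B := B
    r := fun h => r (ψ h)
    σ := fun w => ψ.symm (σ w)
    isOpen_U := ψ.isOpen_inter_preimage hU
    one_mem := ⟨h1s, h1U⟩
    isOpen_B := hB
    smooth_r := ?_
    smooth_σ := ?_
    mapsTo_r := fun h hh => hrU hh.2
    mapsTo_σ := fun w hw => ⟨ψ.map_target (hUt (hσB hw)), by
      rw [mem_preimage, ψ.right_inv (hUt (hσB hw))]; exact hσB hw⟩
    r_σ := fun w hw => by rw [ψ.right_inv (hUt (hσB hw))]; exact hrσ w hw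
    σ_r_one := by rw [hσr, hψ1]
    mem_iff := ?_ }, ?_⟩
  · exact (contMDiffOn_iff_contDiffOn.2 hr).comp
      ((contMDiffOn_chart (I := 𝓘(ℝ, F)) (x := (1 : H))).mono inter_subset_left) fun h hh => hh.2
  · exact (contMDiffOn_chart_symm (I := 𝓘(ℝ, F)) (x := (1 : H))).comp
      (contMDiffOn_iff_contDiffOn.2 hσ) fun w hw => hUt (hσB hw)
  · intro x hx y hy
    rw [← hiff _ hx.2 _ hy.2, MulAction.mem_stabilizer_iff, mul_smul, inv_smul_eq_iff]
    have hxφ := (hUO hx.2).2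
    have hyφ := (hUO hy.2).2
    simp only [fc, mem_preimage, ψ.left_inv hx.1, ψ.left_inv hy.1, f] at hxφ hyφ ⊢
    exact ⟨fun h => by rw [h], fun h => (φ.injOn hxφ hyφ h).symm⟩
  · intro ξ hξ
    let η : F := mfderiv 𝓘(ℝ, F) 𝓘(ℝ, F) ψ 1 ξ
    have hψd := mdifferentiableAt_atlas (I := 𝓘(ℝ, F)) (chart_mem_atlas F (1 : H)) h1s
    have hη : fderiv ℝ fc (ψ 1) η = 0 := by
      rw [hfcd _ hx₀]
      have h1 : (mfderiv 𝓘(ℝ, F) 𝓘(ℝ, F) ψ.symm (ψ 1) η : F) = ξ :=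
        mfderiv_leftInverse (I₁ := 𝓘(ℝ, F)) (I₂ := 𝓘(ℝ, F)) rfl hψd
          (mdifferentiableAt_atlas_symm (chart_mem_atlas F (1 : H)) (ψ.map_source h1s))
          (by filter_upwards [ψ.open_source.mem_nhds h1s] with z hz using ψ.left_inv hz) ξ
      erw [h1, hψ1, hξ]
      exact map_zero _
    have hrd : HasFDerivAt r (fderiv ℝ r (ψ 1)) (ψ 1) :=
      ((hr.contDiffAt (hU.mem_nhds h1U)).differentiableAt (by simp)).hasFDerivAt
    have h2 := hrd.hasMFDerivAt.comp (1 : H) hψd.hasMFDerivAt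
    exact (congrArg (fun A : F →L[ℝ] EuclideanSpace ℝ (Fin _) => A ξ) h2.mfderiv).trans (hker η hη)

end Slices

/-! ### The smooth structure on `H ⧸ K` defined by a slice -/

namespace CosetSlice

variable {F : Type*} [NormedAddCommGroup F] [NormedSpace ℝ F]
  {H : Type*} [TopologicalSpace H] [ChartedSpace F H] [Group H]
  {K : Subgroup H} {m : ℕ} (S : CosetSlice F K m)

/-- The union of the cosets of `K` that meet the slice domain. -/
def saturation : Set H := {h | ∃ u ∈ S.U, u⁻¹ * h ∈ K}

open Classical in
/-- The extension of `r` to the saturation that is invariant under right translations by `K`. -/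
def ρ (h : H) : EuclideanSpace ℝ (Fin m) :=
  if hh : ∃ u ∈ S.U, u⁻¹ * h ∈ K then S.r hh.choose else 0

/-- Two points of the slice domain in the same coset have the same `r`, so the chosen representative
does not matter. -/
theorem ρ_eq {u h : H} (hu : u ∈ S.U) (huh : u⁻¹ * h ∈ K) : S.ρ h = S.r u := by
  have hh : ∃ u ∈ S.U, u⁻¹ * h ∈ K := ⟨u, hu, huh⟩
  rw [ρ, dif_pos hh, ← S.mem_iff _ hh.choose_spec.1 _ hu]
  have := K.mul_mem hh.choose_spec.2 (K.inv_mem huh)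
  simpa [mul_assoc] using this

theorem saturation_mul_iff (h : H) {k : H} (hk : k ∈ K) :
    h * k ∈ S.saturation ↔ h ∈ S.saturation := by
  simp only [saturation, mem_ofPred_eq, ← mul_assoc, K.mul_mem_cancel_right hk]

theorem ρ_mul (h : H) {k : H} (hk : k ∈ K) : S.ρ (h * k) = S.ρ h := by
  by_cases hh : ∃ u ∈ S.U, u⁻¹ * h ∈ K
  · obtain ⟨u, hu, huh⟩ := hh
    rw [S.ρ_eq hu huh, S.ρ_eq hu (by rw [← mul_assoc]; exact K.mul_mem huh hk)]
  · rw [ρ, ρ, dif_neg hh, dif_neg]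
    rintro ⟨u, hu, huh⟩
    exact hh ⟨u, hu, by rwa [← mul_assoc, K.mul_mem_cancel_right hk] at huh⟩

theorem ρ_mem {h : H} (hh : h ∈ S.saturation) : S.ρ h ∈ S.B := by
  obtain ⟨u, hu, huh⟩ := hh
  rw [S.ρ_eq hu huh]
  exact S.mapsTo_r hu

theorem σ_mem_saturation {w : EuclideanSpace ℝ (Fin m)} (hw : w ∈ S.B) : S.σ w ∈ S.saturation :=
  ⟨S.σ w, S.mapsTo_σ hw, by simp [K.one_mem]⟩

theorem ρ_σ {w : EuclideanSpace ℝ (Fin m)} (hw : w ∈ S.B) : S.ρ (S.σ w) = w := by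
  rw [S.ρ_eq (S.mapsTo_σ hw) (by simp [K.one_mem]), S.r_σ w hw]

theorem inv_σ_ρ_mul_mem {h : H} (hh : h ∈ S.saturation) : (S.σ (S.ρ h))⁻¹ * h ∈ K := by
  obtain ⟨u, hu, huh⟩ := hh
  have h1 : (S.σ (S.r u))⁻¹ * u ∈ K := by
    rw [S.mem_iff _ (S.mapsTo_σ (S.mapsTo_r hu)) _ hu, S.r_σ _ (S.mapsTo_r hu)]
  rw [S.ρ_eq hu huh]
  simpa [mul_assoc] using K.mul_mem h1 huh

/-- Right translation by the element of `K` that moves `h` to `u` brings a neighbourhood of `h` into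
the slice domain, where `ρ` is the smooth map `r`. -/
theorem contMDiffAt_ρ [LieGroup 𝓘(ℝ, F) ∞ H] {h : H} (hh : h ∈ S.saturation) :
    ContMDiffAt 𝓘(ℝ, F) (𝓡 m) ∞ S.ρ h := by
  obtain ⟨u, hu, huh⟩ := hh
  have h1 : ContMDiff 𝓘(ℝ, F) 𝓘(ℝ, F) ∞ (fun x : H => x * (u⁻¹ * h)⁻¹) := contMDiff_mul_right
  have h2 : h * (u⁻¹ * h)⁻¹ = u := by simp
  have h3 : ContMDiffAt 𝓘(ℝ, F) (𝓡 m) ∞ S.r (h * (u⁻¹ * h)⁻¹) := by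
    rw [h2]
    exact S.smooth_r.contMDiffAt (S.isOpen_U.mem_nhds hu)
  refine (h3.comp h h1.contMDiffAt).congr_of_eventuallyEq ?_
  have h4 : ∀ᶠ x in 𝓝 h, x * (u⁻¹ * h)⁻¹ ∈ S.U :=
    h1.continuous.continuousAt.eventually (by
      simp only [h2]
      exact S.isOpen_U.mem_nhds hu)
  filter_upwards [h4] with x hx
  exact S.ρ_eq hx (by simpa [mul_assoc] using huh)

theorem isOpen_saturation [LieGroup 𝓘(ℝ, F) ∞ H] : IsOpen S.saturation := by
  have := topologicalGroup_of_lieGroup 𝓘(ℝ, F) (n := ∞) (G := H)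
  have h1 : S.saturation = ((↑) : H → H ⧸ K) ⁻¹' (((↑) : H → H ⧸ K) '' S.U) := by
    ext h
    simp only [saturation, mem_ofPred_eq, mem_preimage, mem_image, QuotientGroup.eq]
  rw [h1]
  exact (QuotientGroup.isOpenMap_coe _ S.isOpen_U).preimage continuous_quot_mk

theorem out_mem_iff (g h : H) :
    g⁻¹ * (h : H ⧸ K).out ∈ S.saturation ↔ g⁻¹ * h ∈ S.saturation := by
  obtain ⟨k, hk⟩ := QuotientGroup.mk_out_eq_mul K h
  rw [hk, ← mul_assoc, S.saturation_mul_iff _ k.2]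

theorem ρ_out (g h : H) : S.ρ (g⁻¹ * (h : H ⧸ K).out) = S.ρ (g⁻¹ * h) := by
  obtain ⟨k, hk⟩ := QuotientGroup.mk_out_eq_mul K h
  rw [hk, ← mul_assoc, S.ρ_mul _ k.2]

variable [LieGroup 𝓘(ℝ, F) ∞ H]

/-- The chart of `H ⧸ K` at `gK` given by a slice. -/
def chart (g : H) : OpenPartialHomeomorph (H ⧸ K) (EuclideanSpace ℝ (Fin m)) where
  toFun x := S.ρ (g⁻¹ * x.out)
  invFun w := ((g * S.σ w : H) : H ⧸ K)
  source := {x | g⁻¹ * x.out ∈ S.saturation}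
  target := S.B
  map_source' x hx := S.ρ_mem hx
  map_target' w hw := by
    rw [mem_ofPred_eq, S.out_mem_iff, inv_mul_cancel_left]
    exact S.σ_mem_saturation hw
  left_inv' x hx := by
    induction x using QuotientGroup.induction_on with
    | H h =>
      rw [mem_ofPred_eq, S.out_mem_iff] at hx
      rw [S.ρ_out, QuotientGroup.eq]
      simpa [mul_assoc] using S.inv_σ_ρ_mul_mem hx
  right_inv' w hw := by
    rw [S.ρ_out, inv_mul_cancel_left, S.ρ_σ hw]
  open_source := by
    have := topologicalGroup_of_lieGroup 𝓘(ℝ, F) (n := ∞) (G := H)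
    rw [← (QuotientGroup.isQuotientMap_mk K).isOpen_preimage]
    simp only [preimage_ofPred_eq, S.out_mem_iff]
    exact S.isOpen_saturation.preimage (continuous_const_mul g⁻¹)
  open_target := S.isOpen_B
  continuousOn_toFun x hx := by
    have := topologicalGroup_of_lieGroup 𝓘(ℝ, F) (n := ∞) (G := H)
    induction x using QuotientGroup.induction_on with
    | H h =>
      refine ContinuousAt.continuousWithinAt ?_
      rw [mem_ofPred_eq, S.out_mem_iff] at hx
      rw [← QuotientGroup.isOpenQuotientMap_mk.continuousAt_comp_iff]
      have : (fun x : H ⧸ K => S.ρ (g⁻¹ * x.out)) ∘ QuotientGroup.mk = fun h => S.ρ (g⁻¹ * h) :=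
        funext fun h => S.ρ_out g h
      rw [this]
      exact ContinuousAt.comp (g := S.ρ) (S.contMDiffAt_ρ hx).continuousAt
        (continuous_const_mul g⁻¹).continuousAt
  continuousOn_invFun := by
    have := topologicalGroup_of_lieGroup 𝓘(ℝ, F) (n := ∞) (G := H)
    exact QuotientGroup.continuous_mk.comp_continuousOn
      ((continuous_const_mul g).comp_continuousOn S.smooth_σ.continuousOn)

theorem mem_chart_source_iff (g h : H) :
    (h : H ⧸ K) ∈ (S.chart g).source ↔ g⁻¹ * h ∈ S.saturation :=
  S.out_mem_iff g h

/-- The charted space structure on `H ⧸ K` given by a slice. -/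
abbrev chartedSpace : ChartedSpace (EuclideanSpace ℝ (Fin m)) (H ⧸ K) where
  atlas := range S.chart
  chartAt x := S.chart x.out
  mem_chart_source x := by
    change x.out⁻¹ * x.out ∈ S.saturation
    rw [inv_mul_cancel]
    exact ⟨1, S.one_mem, by simp [K.one_mem]⟩
  chart_mem_atlas x := mem_range_self _

theorem contMDiffOn_translate (g : H) :
    ContMDiffOn (𝓡 m) 𝓘(ℝ, F) ∞ (fun w => g * S.σ w) S.B :=
  (contMDiff_mul_left (I := 𝓘(ℝ, F)) (n := ∞) (a := g)).comp_contMDiffOn S.smooth_σ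

/-- A change of charts is `w ↦ ρ (g'⁻¹ * (g * σ w))`, a composition of maps smooth on `H`. -/
theorem isManifold : letI := S.chartedSpace; IsManifold (𝓡 m) ∞ (H ⧸ K) := by
  let _ := S.chartedSpace
  refine isManifold_of_contDiffOn _ _ _ ?_
  rintro _ _ ⟨g, rfl⟩ ⟨g', rfl⟩
  rw [← contMDiffOn_iff_contDiffOn]
  intro w hw
  have hw1 : w ∈ S.B := hw.1.1
  have hw2 : g'⁻¹ * (g * S.σ w) ∈ S.saturation := by
    have : ((g * S.σ w : H) : H ⧸ K) ∈ (S.chart g').source := hw.1.2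
    rwa [S.mem_chart_source_iff] at this
  have h1 : ContMDiffAt (𝓡 m) 𝓘(ℝ, F) ∞ (fun w => g'⁻¹ * (g * S.σ w)) w :=
    ((contMDiff_mul_left (I := 𝓘(ℝ, F)) (n := ∞) (a := g'⁻¹)).comp_contMDiffOn
      (S.contMDiffOn_translate g)).contMDiffAt (S.isOpen_B.mem_nhds hw1)
  have h2 := ContMDiffAt.comp w (g := S.ρ) (S.contMDiffAt_ρ hw2) h1
  refine ContMDiffAt.contMDiffWithinAt (h2.congr_of_eventuallyEq ?_)
  exact Eventually.of_forall fun w => S.ρ_out _ _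

theorem isHomogeneousSpace :
    letI := S.chartedSpace; IsHomogeneousSpace F K m := by
  let _ := S.chartedSpace
  have hman : IsManifold (𝓡 m) ∞ (H ⧸ K) := S.isManifold
  have hman1 : IsManifold (𝓡 m) 1 (H ⧸ K) := IsManifold.of_le (n := ∞) (by simp)
  have := topologicalGroup_of_lieGroup 𝓘(ℝ, F) (n := ∞) (G := H)
  have hsmooth : ContMDiff 𝓘(ℝ, F) (𝓡 m) ∞ (fun h : H => (h : H ⧸ K)) := by
    intro h
    rw [contMDiffAt_iff_target]
    refine ⟨continuous_quot_mk.continuousAt, ?_⟩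
    have hmem : (h : H ⧸ K).out⁻¹ * h ∈ S.saturation :=
      (S.mem_chart_source_iff _ _).1 (mem_chart_source (EuclideanSpace ℝ (Fin m)) (h : H ⧸ K))
    have h1 := ContMDiffAt.comp (g := S.ρ) h (S.contMDiffAt_ρ hmem)
      (contMDiff_mul_left (I := 𝓘(ℝ, F)) (n := ∞) (a := (h : H ⧸ K).out⁻¹)).contMDiffAt
    refine h1.congr_of_eventuallyEq (Eventually.of_forall fun x => ?_)
    exact S.ρ_out _ _
  refine ⟨hman, hsmooth, fun h => ?_⟩
  let x : H ⧸ K := (h : H ⧸ K)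
  let e := chartAt (EuclideanSpace ℝ (Fin m)) x
  have hxs : x ∈ e.source := mem_chart_source _ x
  have hB : e x ∈ S.B := e.map_source hxs
  -- The section `y ↦ x.out * σ (e y)` need not pass through `h`. It meets the same coset, so right
  -- translation by this `k ∈ K` makes it pass through `h` and keeps it a section; its differential
  -- gives the preimages needed for surjectivity.
  let k : H := (x.out * S.σ (e x))⁻¹ * h
  have hs : ContMDiffAt (𝓡 m) 𝓘(ℝ, F) ∞ (fun y => x.out * S.σ (e y) * k) x :=
    (contMDiff_mul_right (I := 𝓘(ℝ, F)) (n := ∞) (a := k)).contMDiffAt.comp x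
      (((S.contMDiffOn_translate x.out).contMDiffAt (S.isOpen_B.mem_nhds hB)).comp x
        (contMDiffOn_chart.contMDiffAt (e.open_source.mem_nhds hxs)))
  have hk : k ∈ K := by
    have h1 : e.symm (e x) = x := e.left_inv hxs
    exact QuotientGroup.eq.1 h1
  intro v
  refine ⟨_, mfderiv_leftInverse (I₁ := 𝓡 m) (I₂ := 𝓘(ℝ, F))
    (f := fun y => x.out * S.σ (e y) * k) (x := x) (y := h) (by simp only [k, mul_inv_cancel_left])
    (hs.mdifferentiableAt (by simp)) (hsmooth.contMDiffAt.mdifferentiableAt (by simp)) ?_ v⟩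
  filter_upwards [e.open_source.mem_nhds hxs] with y hy
  rw [QuotientGroup.mk_mul_of_mem _ hk]
  exact e.left_inv hy

end CosetSlice

/-! ### Forms in charts -/

section RealStructure

variable {E : Type*} [NormedAddCommGroup E] [NormedSpace ℂ E]
  {M : Type*} [TopologicalSpace M] [ChartedSpace E M]

theorem isManifold_real [IsManifold 𝓘(ℂ, E) ω M] : IsManifold 𝓘(ℝ, E) ∞ M := by
  refine isManifold_of_contDiffOn _ _ _ fun e e' he he' => ?_
  have h1 : e.symm ≫ₕ e' ∈ contDiffGroupoid ω 𝓘(ℂ, E) := HasGroupoid.compatible he he'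
  have h2 : ContDiffOn ℂ ω (𝓘(ℂ, E) ∘ (e.symm ≫ₕ e') ∘ 𝓘(ℂ, E).symm)
      (𝓘(ℂ, E).symm ⁻¹' (e.symm ≫ₕ e').source ∩ range 𝓘(ℂ, E)) :=
    (mem_groupoid_of_pregroupoid.1 h1).1
  exact (h2.restrict_scalars ℝ).of_le le_top

theorem hasMFDerivAt_restrictReal {E' : Type*} [NormedAddCommGroup E'] [NormedSpace ℂ E']
    {M' : Type*} [TopologicalSpace M'] [ChartedSpace E' M'] {f : M → M'} {x : M} {f' : E →L[ℂ] E'}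
    (hf : HasMFDerivAt 𝓘(ℂ, E) 𝓘(ℂ, E') f x f') :
    HasMFDerivAt 𝓘(ℝ, E) 𝓘(ℝ, E') f x (f'.restrictScalars ℝ) :=
  ⟨hf.1, HasFDerivWithinAt.restrictScalars ℝ hf.2⟩

theorem mfderiv_real_eq {E' : Type*} [NormedAddCommGroup E'] [NormedSpace ℂ E']
    {M' : Type*} [TopologicalSpace M'] [ChartedSpace E' M'] {f : M → M'} {x : M}
    (hf : MDifferentiableAt 𝓘(ℂ, E) 𝓘(ℂ, E') f x) (v : E) :
    (mfderiv 𝓘(ℂ, E) 𝓘(ℂ, E') f x v : E') = mfderiv 𝓘(ℝ, E) 𝓘(ℝ, E') f x v :=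
  congrArg (fun A : E →L[ℝ] E' => A v) (hasMFDerivAt_restrictReal hf.hasMFDerivAt).mfderiv.symm

variable [IsManifold 𝓘(ℂ, E) ω M]

theorem chart_symm_mfderiv (x₀ : M) {q : M} (hq : q ∈ (chartAt E x₀).source) (v : E) :
    (mfderiv 𝓘(ℝ, E) 𝓘(ℝ, E) (chartAt E x₀).symm (chartAt E x₀ q)
      (mfderiv 𝓘(ℝ, E) 𝓘(ℝ, E) (chartAt E x₀) q v : E) : E) = v := by
  have : IsManifold 𝓘(ℝ, E) ∞ M := isManifold_real
  have : IsManifold 𝓘(ℝ, E) 1 M := IsManifold.of_le (n := ∞) (by simp)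
  refine mfderiv_leftInverse (I₁ := 𝓘(ℝ, E)) (I₂ := 𝓘(ℝ, E)) (f := chartAt E x₀) rfl
    (mdifferentiableAt_atlas (chart_mem_atlas E x₀) hq)
    (mdifferentiableAt_atlas_symm (chart_mem_atlas E x₀) ((chartAt E x₀).map_source hq)) ?_ v
  filter_upwards [(chartAt E x₀).open_source.mem_nhds hq] with z hz
  exact (chartAt E x₀).left_inv hz

theorem chart_mfderiv_symm (x₀ : M) {y : E} (hy : y ∈ (chartAt E x₀).target) (v : E) :
    (mfderiv 𝓘(ℝ, E) 𝓘(ℝ, E) (chartAt E x₀) ((chartAt E x₀).symm y)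
      (mfderiv 𝓘(ℝ, E) 𝓘(ℝ, E) (chartAt E x₀).symm y v : E) : E) = v := by
  have : IsManifold 𝓘(ℝ, E) ∞ M := isManifold_real
  have : IsManifold 𝓘(ℝ, E) 1 M := IsManifold.of_le (n := ∞) (by simp)
  refine mfderiv_leftInverse (I₁ := 𝓘(ℝ, E)) (I₂ := 𝓘(ℝ, E)) (f := (chartAt E x₀).symm) rfl
    (mdifferentiableAt_atlas_symm (chart_mem_atlas E x₀) hy)
    (mdifferentiableAt_atlas (chart_mem_atlas E x₀) ((chartAt E x₀).map_target hy)) ?_ v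
  filter_upwards [(chartAt E x₀).open_target.mem_nhds hy] with z hz
  exact (chartAt E x₀).right_inv hz

/-- The differentials of a chart and of its inverse are mutually inverse, so pulling back and
pushing forward cancel. This links pointwise values of a form with its chart expression, where
smoothness and closedness are stated. -/
theorem realForm_eq_chart {k : ℕ} (α : (p : M) → TangentSpace 𝓘(ℝ, E) p [⋀^Fin k]→L[ℝ] ℝ)
    (x₀ : M) {q : M} (hq : q ∈ (chartAt E x₀).source) (w : Fin k → E) :
    α q w = realFormInChart α x₀ (chartAt E x₀ q)
      (fun i => mfderiv 𝓘(ℝ, E) 𝓘(ℝ, E) (chartAt E x₀) q (w i)) := by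
  have h1 : realFormInChart α x₀ (chartAt E x₀ q)
      (fun i => mfderiv 𝓘(ℝ, E) 𝓘(ℝ, E) (chartAt E x₀) q (w i)) =
      α ((chartAt E x₀).symm (chartAt E x₀ q)) (fun i =>
        mfderiv 𝓘(ℝ, E) 𝓘(ℝ, E) (chartAt E x₀).symm (chartAt E x₀ q)
        (mfderiv 𝓘(ℝ, E) 𝓘(ℝ, E) (chartAt E x₀) q (w i) : E)) := rfl
  rw [h1, funext fun i => chart_symm_mfderiv x₀ hq (w i)]
  have h2 : ∀ q', q' = q → α q w = α q' w := by rintro _ rfl; rfl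
  exact h2 _ ((chartAt E x₀).left_inv hq)

theorem complexForm_eq_chart {k : ℕ} (α : (p : M) → TangentSpace 𝓘(ℂ, E) p [⋀^Fin k]→L[ℂ] ℂ)
    (x₀ : M) {q : M} (hq : q ∈ (chartAt E x₀).source) (w : Fin k → E) :
    α q w = complexFormInChart α x₀ (chartAt E x₀ q)
      (fun i => (mfderiv 𝓘(ℝ, E) 𝓘(ℝ, E) (chartAt E x₀) q (w i) : E)) := by
  have : IsManifold 𝓘(ℂ, E) 1 M := IsManifold.of_le (n := ω) le_top
  have h1 : complexFormInChart α x₀ (chartAt E x₀ q)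
      (fun i => (mfderiv 𝓘(ℝ, E) 𝓘(ℝ, E) (chartAt E x₀) q (w i) : E)) =
      α ((chartAt E x₀).symm (chartAt E x₀ q)) (fun i =>
        mfderiv 𝓘(ℂ, E) 𝓘(ℂ, E) (chartAt E x₀).symm (chartAt E x₀ q)
        (mfderiv 𝓘(ℝ, E) 𝓘(ℝ, E) (chartAt E x₀) q (w i) : E)) := rfl
  rw [h1, funext fun i => (mfderiv_real_eq (mdifferentiableAt_atlas_symm (chart_mem_atlas E x₀)
    ((chartAt E x₀).map_source hq)) _).trans (chart_symm_mfderiv x₀ hq (w i))]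
  have h2 : ∀ q', q' = q → α q w = α q' w := by rintro _ rfl; rfl
  exact h2 _ ((chartAt E x₀).left_inv hq)

end RealStructure

/-! ### Differentiating the values of alternating forms -/

section Evaluation

variable {𝕜 : Type*} [NontriviallyNormedField 𝕜] {G E W : Type*}
  [NormedAddCommGroup G] [NormedSpace 𝕜 G] [NormedAddCommGroup E] [NormedSpace 𝕜 E]
  [NormedAddCommGroup W] [NormedSpace 𝕜 W] {n : ℕ}

theorem differentiableAt_alternating_apply {α : G → E [⋀^Fin n]→L[𝕜] W} {w : Fin n → G → E} {x : G}
    (hα : DifferentiableAt 𝕜 α x) (hw : ∀ i, DifferentiableAt 𝕜 (w i) x) :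
    DifferentiableAt 𝕜 (fun y => α y (fun i => w i y)) x := by
  have h1 := ((ContinuousAlternatingMap.toContinuousMultilinearMapCLM 𝕜).hasFDerivAt.comp x
    hα.hasFDerivAt)
  exact (HasFDerivAt.continuousMultilinearMap_apply h1
    fun i => (hw i).hasFDerivAt).differentiableAt

/-- A `2`-form as a bilinear map. -/
def twoFormBilin : (E [⋀^Fin 2]→L[𝕜] W) →L[𝕜] E →L[𝕜] E →L[𝕜] W :=
  (ContinuousLinearMap.compL 𝕜 E (E [⋀^Fin 1]→L[𝕜] W) (E →L[𝕜] W)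
    ((ContinuousLinearMap.compL 𝕜 E (E [⋀^Fin 0]→L[𝕜] W) W
      (ContinuousAlternatingMap.constOfIsEmptyLIE 𝕜 E W
        (Fin 0)).symm.toContinuousLinearEquiv.toContinuousLinearMap).comp
      (ContinuousAlternatingMap.curryLeftLI (𝕜 := 𝕜) (E := E) (F := W)
        (n := 0)).toContinuousLinearMap)).comp
    (ContinuousAlternatingMap.curryLeftLI (𝕜 := 𝕜) (E := E) (F := W)
      (n := 1)).toContinuousLinearMap

theorem twoFormBilin_apply (α : E [⋀^Fin 2]→L[𝕜] W) (u v : E) :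
    twoFormBilin α u v = α ![u, v] := by
  simp [twoFormBilin]

theorem hasFDerivAt_twoFormBilin {β : G → E [⋀^Fin 2]→L[𝕜] W} {x : G}
    (hβ : DifferentiableAt 𝕜 β x) :
    HasFDerivAt (fun y => twoFormBilin (β y)) ((twoFormBilin (𝕜 := 𝕜)).comp (fderiv 𝕜 β x)) x := by
  have h1 := (twoFormBilin (𝕜 := 𝕜) (E := E) (W := W)).hasFDerivAt (x := β x)
  exact HasFDerivAt.comp (F := E [⋀^Fin 2]→L[𝕜] W) (G := E →L[𝕜] E →L[𝕜] W)
    (g := fun α => twoFormBilin (𝕜 := 𝕜) α) x h1 hβ.hasFDerivAt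

end Evaluation

/-! ### Actions in charts -/

section ActionInChart

variable {F : Type*} [NormedAddCommGroup F] [NormedSpace ℝ F]
  {H : Type*} [TopologicalSpace H] [ChartedSpace F H] [Group H]
  {E : Type*} [NormedAddCommGroup E] [NormedSpace ℝ E]
  {M : Type*} [TopologicalSpace M] [ChartedSpace E M] [MulAction H M]

variable (F E) in
theorem contMDiff_smul_pair [ContMDiffSMul 𝓘(ℝ, F) 𝓘(ℝ, E) ∞ H M] :
    ContMDiff (𝓘(ℝ, F).prod 𝓘(ℝ, E)) 𝓘(ℝ, E) ∞
    (fun x : H × M => x.1 • x.2) :=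
  contMDiff_smul

variable (F E) in
theorem contMDiff_translation [ContMDiffSMul 𝓘(ℝ, F) 𝓘(ℝ, E) ∞ H M]
    (h : H) : ContMDiff 𝓘(ℝ, E) 𝓘(ℝ, E) ∞ (fun q : M => h • q) :=
  (contMDiff_smul_pair F E (H := H) (M := M)).comp (contMDiff_const.prodMk contMDiff_id)

variable (F E) in
theorem contMDiff_orbit [ContMDiffSMul 𝓘(ℝ, F) 𝓘(ℝ, E) ∞ H M]
    (p : M) : ContMDiff 𝓘(ℝ, F) 𝓘(ℝ, E) ∞ (fun h : H => h • p) :=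
  (contMDiff_smul_pair F E (H := H) (M := M)).comp (contMDiff_id.prodMk contMDiff_const)

variable (F E) in
theorem mdifferentiableAt_translation [ContMDiffSMul 𝓘(ℝ, F) 𝓘(ℝ, E) ∞ H M]
    (h : H) (q : M) :
    MDifferentiableAt 𝓘(ℝ, E) 𝓘(ℝ, E) (fun q : M => h • q) q :=
  (contMDiff_translation F E h).contMDiffAt.mdifferentiableAt (by simp)

variable (F E) in
theorem mdifferentiableAt_orbit [ContMDiffSMul 𝓘(ℝ, F) 𝓘(ℝ, E) ∞ H M]
    (p : M) (h : H) :
    MDifferentiableAt 𝓘(ℝ, F) 𝓘(ℝ, E) (fun h : H => h • p) h :=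
  (contMDiff_orbit F E p).contMDiffAt.mdifferentiableAt (by simp)

variable (F E) in
theorem mfderiv_translation_mul [ContMDiffSMul 𝓘(ℝ, F) 𝓘(ℝ, E) ∞ H M]
    (g h : H) (q : M) (u : E) :
    (mfderiv 𝓘(ℝ, E) 𝓘(ℝ, E) (fun q : M => (g * h) • q) q u : E) =
      mfderiv 𝓘(ℝ, E) 𝓘(ℝ, E) (fun q : M => g • q) (h • q)
        (mfderiv 𝓘(ℝ, E) 𝓘(ℝ, E) (fun q : M => h • q) q u : E) := by
  have h1 : (fun q : M => (g * h) • q) = (fun q : M => g • q) ∘ fun q : M => h • q :=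
    funext fun q => mul_smul g h q
  rw [h1]
  exact mfderiv_comp_apply q (mdifferentiableAt_translation F E g (h • q))
    (mdifferentiableAt_translation F E h q) u

variable (E) in
theorem mfderiv_translation_one (q : M) (u : E) :
    (mfderiv 𝓘(ℝ, E) 𝓘(ℝ, E) (fun q : M => (1 : H) • q) q u : E) = u := by
  have h1 : (fun q : M => (1 : H) • q) = id := funext fun q => one_smul H q
  rw [h1, mfderiv_id]
  rfl

variable (F E) in
/-- The action near `(h₀, p)`, in the charts at `h₀`, `p` and `p'`. -/
def actionInChart (h₀ : H) (p p' : M) : F × E → E := fun z =>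
  chartAt E p' ((chartAt F h₀).symm z.1 • (chartAt E p).symm z.2)

variable {h₀ : H} {p p' : M}

theorem contDiffAt_actionInChart [LieGroup 𝓘(ℝ, F) ∞ H] [IsManifold 𝓘(ℝ, E) ∞ M]
    [ContMDiffSMul 𝓘(ℝ, F) 𝓘(ℝ, E) ∞ H M]
    {h : H} {q : M} (hh : h ∈ (chartAt F h₀).source)
    (hq : q ∈ (chartAt E p).source) (hhq : h • q ∈ (chartAt E p').source) :
    ContDiffAt ℝ ∞ (actionInChart F E h₀ p p') (chartAt F h₀ h, chartAt E p q) := by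
  have h1 : ContMDiffAt 𝓘(ℝ, F × E) 𝓘(ℝ, F) ∞ (fun z : F × E => (chartAt F h₀).symm z.1)
      (chartAt F h₀ h, chartAt E p q) :=
    ContMDiffAt.comp (g := (chartAt F h₀).symm) (f := Prod.fst) (I' := 𝓘(ℝ, F)) _
      (contMDiffOn_chart_symm.contMDiffAt
      ((chartAt F h₀).open_target.mem_nhds ((chartAt F h₀).map_source hh)))
      contDiffAt_fst.contMDiffAt
  have h2 : ContMDiffAt 𝓘(ℝ, F × E) 𝓘(ℝ, E) ∞ (fun z : F × E => (chartAt E p).symm z.2)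
      (chartAt F h₀ h, chartAt E p q) :=
    ContMDiffAt.comp (g := (chartAt E p).symm) (f := Prod.snd) (I' := 𝓘(ℝ, E)) _
      (contMDiffOn_chart_symm.contMDiffAt
      ((chartAt E p).open_target.mem_nhds ((chartAt E p).map_source hq)))
      contDiffAt_snd.contMDiffAt
  have h3 := ContMDiffAt.comp (chartAt F h₀ h, chartAt E p q)
    (contMDiff_smul_pair F E (H := H) (M := M)).contMDiffAt (h1.prodMk h2)
  have h4 : ContMDiffAt 𝓘(ℝ, E) 𝓘(ℝ, E) ∞ (chartAt E p') (h • q) :=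
    contMDiffOn_chart.contMDiffAt ((chartAt E p').open_source.mem_nhds hhq)
  rw [← contMDiffAt_iff_contDiffAt]
  refine ContMDiffAt.comp (g := chartAt E p') _ ?_ h3
  simpa [(chartAt F h₀).left_inv hh, (chartAt E p).left_inv hq] using h4

theorem actionInChart_apply {h : H} {q : M} (hh : h ∈ (chartAt F h₀).source)
    (hq : q ∈ (chartAt E p).source) :
    actionInChart F E h₀ p p' (chartAt F h₀ h, chartAt E p q) = chartAt E p' (h • q) := by
  rw [actionInChart, (chartAt F h₀).left_inv hh, (chartAt E p).left_inv hq]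

/-- Together with the left version, this turns the differentials of translations and of orbit maps
into partial derivatives of one smooth function on `F × E`, to which symmetry of second derivatives
applies. -/
theorem fderiv_actionInChart_right [LieGroup 𝓘(ℝ, F) ∞ H] [IsManifold 𝓘(ℝ, E) ∞ M]
    [ContMDiffSMul 𝓘(ℝ, F) 𝓘(ℝ, E) ∞ H M]
    {h : H} {q : M} (hh : h ∈ (chartAt F h₀).source)
    (hq : q ∈ (chartAt E p).source) (hhq : h • q ∈ (chartAt E p').source) (u : E) :
    (mfderiv 𝓘(ℝ, E) 𝓘(ℝ, E) (chartAt E p') (h • q)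
      (mfderiv 𝓘(ℝ, E) 𝓘(ℝ, E) (fun q : M => h • q) q u : E) : E) =
    fderiv ℝ (actionInChart F E h₀ p p') (chartAt F h₀ h, chartAt E p q)
      (0, mfderiv 𝓘(ℝ, E) 𝓘(ℝ, E) (chartAt E p) q u) := by
  have : IsManifold 𝓘(ℝ, E) 1 M := IsManifold.of_le (n := ∞) (by simp)
  have h1 := (mdifferentiableAt_atlas (I := 𝓘(ℝ, E)) (chart_mem_atlas E p') hhq).hasMFDerivAt.comp q
    (mdifferentiableAt_translation F E h q).hasMFDerivAt
  have h2 : HasFDerivAt (fun y => actionInChart F E h₀ p p' (chartAt F h₀ h, y))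
      (fderiv ℝ (actionInChart F E h₀ p p') (chartAt F h₀ h, chartAt E p q) ∘L
        ContinuousLinearMap.inr ℝ F E) (chartAt E p q) :=
    ((contDiffAt_actionInChart hh hq hhq).differentiableAt (by simp)).hasFDerivAt.comp _
      (hasFDerivAt_prodMk_right _ _)
  have h3 := h2.hasMFDerivAt.comp q
    (mdifferentiableAt_atlas (I := 𝓘(ℝ, E)) (chart_mem_atlas E p) hq).hasMFDerivAt
  have h4 := h3.congr_of_eventuallyEq (f₁ := chartAt E p' ∘ fun q : M => h • q) (by
    filter_upwards [(chartAt E p).open_source.mem_nhds hq] with z hz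
    exact (actionInChart_apply hh hz).symm)
  exact congrArg (fun A : E →L[ℝ] E => A u) (hasMFDerivAt_unique h1 h4)

theorem fderiv_actionInChart_left [LieGroup 𝓘(ℝ, F) ∞ H] [IsManifold 𝓘(ℝ, E) ∞ M]
    [ContMDiffSMul 𝓘(ℝ, F) 𝓘(ℝ, E) ∞ H M]
    {h : H} {q : M} (hh : h ∈ (chartAt F h₀).source)
    (hq : q ∈ (chartAt E p).source) (hhq : h • q ∈ (chartAt E p').source) (ξ : F) :
    (mfderiv 𝓘(ℝ, E) 𝓘(ℝ, E) (chartAt E p') (h • q)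
      (mfderiv 𝓘(ℝ, F) 𝓘(ℝ, E) (fun h : H => h • q) h ξ : E) : E) =
    fderiv ℝ (actionInChart F E h₀ p p') (chartAt F h₀ h, chartAt E p q)
      (mfderiv 𝓘(ℝ, F) 𝓘(ℝ, F) (chartAt F h₀) h ξ, 0) := by
  have : IsManifold 𝓘(ℝ, E) 1 M := IsManifold.of_le (n := ∞) (by simp)
  have : IsManifold 𝓘(ℝ, F) 1 H := isManifold_one
  have h1 := (mdifferentiableAt_atlas (I := 𝓘(ℝ, E)) (chart_mem_atlas E p') hhq).hasMFDerivAt.comp h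
    (mdifferentiableAt_orbit F E q h).hasMFDerivAt
  have h2 : HasFDerivAt (fun x => actionInChart F E h₀ p p' (x, chartAt E p q))
      (fderiv ℝ (actionInChart F E h₀ p p') (chartAt F h₀ h, chartAt E p q) ∘L
        ContinuousLinearMap.inl ℝ F E) (chartAt F h₀ h) :=
    HasFDerivAt.comp (g := actionInChart F E h₀ p p') (chartAt F h₀ h)
      ((contDiffAt_actionInChart hh hq hhq).differentiableAt (by simp)).hasFDerivAt
      (hasFDerivAt_prodMk_left (chartAt F h₀ h) (chartAt E p q))
  have h3 := h2.hasMFDerivAt.comp h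
    (mdifferentiableAt_atlas (I := 𝓘(ℝ, F)) (chart_mem_atlas F h₀) hh).hasMFDerivAt
  have h4 := h3.congr_of_eventuallyEq (f₁ := chartAt E p' ∘ fun h : H => h • q) (by
    filter_upwards [(chartAt F h₀).open_source.mem_nhds hh] with z hz
    exact (actionInChart_apply hz hq).symm)
  exact congrArg (fun A : F →L[ℝ] E => A ξ) (hasMFDerivAt_unique h1 h4)

end ActionInChart

/-! ### Invariance of the Kähler form -/

section Invariance

variable {F : Type*} [NormedAddCommGroup F] [NormedSpace ℝ F]
  {H : Type*} [TopologicalSpace H] [ChartedSpace F H] [Group H] [LieGroup 𝓘(ℝ, F) ∞ H]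
  {E : Type*} [NormedAddCommGroup E] [NormedSpace ℂ E]
  {M : Type*} [TopologicalSpace M] [ChartedSpace E M] [IsManifold 𝓘(ℂ, E) ω M]
  [MulAction H M] [ContMDiffSMul 𝓘(ℝ, F) 𝓘(ℝ, E) ∞ H M]
  {n : ℕ} (X : CalabiYau E M n)

theorem alternating_two_swap {W : Type*} [NormedAddCommGroup W] [NormedSpace ℝ W]
    (α : W [⋀^Fin 2]→L[ℝ] ℝ) (u v : W) : α ![u, v] = - α ![v, u] := by
  have h := α.map_swap ![v, u] (show (0 : Fin 2) ≠ 1 by decide)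
  have h1 : ![v, u] ∘ Equiv.swap (0 : Fin 2) 1 = ![u, v] := by ext i; fin_cases i <;> rfl
  rw [h1] at h
  exact h

/-- The orbit in the chart is a neighbourhood of the identity. -/
theorem eventually_mem_charts (p : M) : ∀ᶠ h in 𝓝 (1 : H), h ∈ (chartAt F (1 : H)).source ∧
    h • p ∈ (chartAt E p).source := by
  have h1 : ContinuousAt (fun h : H => h • p) 1 := (contMDiff_orbit F E p).continuous.continuousAt
  have h2 : ∀ᶠ q in 𝓝 ((1 : H) • p), q ∈ (chartAt E p).source := by
    rw [one_smul]
    exact (chartAt E p).open_source.mem_nhds (mem_chart_source E p)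
  filter_upwards [(chartAt F (1 : H)).open_source.mem_nhds (mem_chart_source F 1),
    h1.eventually h2] with h hh hh'
  exact ⟨hh, hh'⟩

theorem realForm_pair_eq_chart (α : (p : M) → TangentSpace 𝓘(ℝ, E) p [⋀^Fin 2]→L[ℝ] ℝ)
    (x₀ : M) {q : M} (hq : q ∈ (chartAt E x₀).source) (u v : E) :
    α q ![u, v] = realFormInChart α x₀ (chartAt E x₀ q)
      ![(mfderiv 𝓘(ℝ, E) 𝓘(ℝ, E) (chartAt E x₀) q u : E),
        (mfderiv 𝓘(ℝ, E) 𝓘(ℝ, E) (chartAt E x₀) q v : E)] := by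
  refine (realForm_eq_chart α x₀ hq ![u, v]).trans (congrArg _ ?_)
  ext i
  fin_cases i <;> rfl

/-- The infinitesimal invariance of `ω` at the identity: in the charts at `1` and `p` this is
`fderiv_pullback_twoForm_eq_zero`, with the components of `μ` as Hamiltonians. -/
theorem hasMFDerivAt_kahler_translation (μ : M → GroupLieAlgebra 𝓘(ℝ, F) H →L[ℝ] ℝ)
    (hμ : IsMomentMap X μ) (p : M) (u v : E) :
    HasMFDerivAt 𝓘(ℝ, F) 𝓘(ℝ, ℝ) (fun h : H => X.kahler (h • p)
      ![mfderiv 𝓘(ℝ, E) 𝓘(ℝ, E) (fun q : M => h • q) p u,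
        mfderiv 𝓘(ℝ, E) 𝓘(ℝ, E) (fun q : M => h • q) p v]) 1 0 := by
  have : IsManifold 𝓘(ℝ, E) ∞ M := isManifold_real
  have : IsManifold 𝓘(ℝ, E) 1 M := IsManifold.of_le (n := ∞) (by simp)
  have : IsManifold 𝓘(ℝ, F) 1 H := isManifold_one
  let A := actionInChart F E (1 : H) p p
  let ψ := chartAt F (1 : H)
  let φ := chartAt E p
  have h1s : (1 : H) ∈ ψ.source := mem_chart_source F 1
  have hps : p ∈ φ.source := mem_chart_source E p
  let β : E → E [⋀^Fin 2]→L[ℝ] ℝ := realFormInChart X.kahler p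
  let B : E → E →L[ℝ] E →L[ℝ] ℝ := fun y => twoFormBilin (β y)
  let u' : E := mfderiv 𝓘(ℝ, E) 𝓘(ℝ, E) φ p u
  let v' : E := mfderiv 𝓘(ℝ, E) 𝓘(ℝ, E) φ p v
  have hpt : φ p ∈ φ.target := φ.map_source hps
  have hβ : DifferentiableAt ℝ β (φ p) :=
    ((X.smooth_kahler p).contDiffAt (φ.open_target.mem_nhds hpt)).differentiableAt (by simp)
  have hBd : HasFDerivAt B (twoFormBilin ∘L fderiv ℝ β (φ p)) (φ p) :=
    hasFDerivAt_twoFormBilin hβ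
  have hclosed : ∀ u v w, fderiv ℝ B (φ p) u v w - fderiv ℝ B (φ p) v u w +
      fderiv ℝ B (φ p) w u v = 0 := by
    intro u v w
    have h := congrArg (fun α => α ![u, v, w]) (X.closed_kahler p (φ p) hpt)
    rw [hBd.fderiv]
    simp only [ContinuousLinearMap.comp_apply, twoFormBilin_apply]
    simp only [extDeriv, ContinuousAlternatingMap.alternatizeUncurryFin_apply] at h
    replace h := (Fin.sum_univ_three _).symm.trans h
    have e0 : Fin.removeNth 0 ![u, v, w] = ![v, w] := by ext i; fin_cases i <;> rfl
    have e1 : Fin.removeNth 1 ![u, v, w] = ![u, w] := by ext i; fin_cases i <;> rfl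
    have e2 : Fin.removeNth 2 ![u, v, w] = ![u, v] := by ext i; fin_cases i <;> rfl
    simp [e0, e1, e2] at h
    simp only [β, φ]
    linarith
  have hq : ∀ᶠ y in 𝓝 (φ p), y ∈ φ.target := φ.open_target.mem_nhds hpt
  have key : ∀ ξ : F, DifferentiableAt ℝ (fun x => B (A (x, φ p)) (fderiv ℝ A (x, φ p) (0, u'))
      (fderiv ℝ A (x, φ p) (0, v'))) (ψ 1) ∧
      fderiv ℝ (fun x => B (A (x, φ p)) (fderiv ℝ A (x, φ p) (0, u'))
      (fderiv ℝ A (x, φ p) (0, v'))) (ψ 1) (mfderiv 𝓘(ℝ, F) 𝓘(ℝ, F) ψ 1 ξ) = 0 := by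
    intro ξ
    have hm : ContDiffAt ℝ ∞ (fun y => μ (φ.symm y) ξ) (φ p) := by
      rw [← contMDiffAt_iff_contDiffAt]
      exact (hμ.smooth ξ).contMDiffAt.comp (φ p) ((contMDiffOn_chart_symm (I := 𝓘(ℝ, E))).contMDiffAt
        (φ.open_target.mem_nhds hpt))
    refine fderiv_pullback_twoForm_eq_zero
      (contDiffAt_actionInChart h1s hps (by rwa [one_smul])) ?_ hBd.differentiableAt ?_ hclosed
      hm ?_ u' v'
    · filter_upwards [hq] with y hy
      simp only [actionInChart]
      rw [(chartAt F (1 : H)).left_inv h1s, one_smul, (chartAt E p).right_inv hy]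
    · intro y u v
      simp only [B, twoFormBilin_apply]
      exact alternating_two_swap _ u v
    · filter_upwards [hq] with y hy w
      have hys : φ.symm y ∈ φ.source := φ.map_target hy
      have hys' : (1 : H) • φ.symm y ∈ φ.source := by rwa [one_smul]
      have h2 := fderiv_actionInChart_left (p' := p) h1s hys hys' ξ
      have h3 := (((hμ.smooth ξ).contMDiffAt (x := φ.symm y)).mdifferentiableAt
        (by simp)).hasMFDerivAt.comp y (mdifferentiableAt_atlas_symm (I := 𝓘(ℝ, E))
          (chart_mem_atlas E p) hy).hasMFDerivAt
      have h4 := congrArg (fun A : E →L[ℝ] ℝ => A w) (hasFDerivAt_of_hasMFDerivAt h3).fderiv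
      refine h4.trans ((hμ.differential (φ.symm y) ξ _).trans ?_)
      have h5 := realForm_pair_eq_chart X.kahler p hys (fundamentalVF (H := H) ξ (φ.symm y))
        (mfderiv 𝓘(ℝ, E) 𝓘(ℝ, E) φ.symm y w)
      have h6 : ∀ q', q' = φ.symm y → (mfderiv 𝓘(ℝ, E) 𝓘(ℝ, E) φ q'
          (fundamentalVF (H := H) ξ (φ.symm y)) : E) =
          mfderiv 𝓘(ℝ, E) 𝓘(ℝ, E) φ (φ.symm y) (fundamentalVF (H := H) ξ (φ.symm y)) := by
        rintro _ rfl; rfl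
      have h7 := (h6 ((1 : H) • φ.symm y) (one_smul H (φ.symm y))).symm.trans h2
      have h8 := chart_mfderiv_symm p hy w
      have h9 : φ (φ.symm y) = y := φ.right_inv hy
      rw [show (chartAt E p) = φ from rfl] at h5 h7 h8
      rw [h7, h8, h9] at h5
      simp only [B, twoFormBilin_apply]
      exact congrArg Neg.neg h5
  -- Differentiability does not involve the direction, so any `ξ` will do here; the vanishing of the
  -- derivative is taken from `key ξ` for each `ξ` at the end.
  have hg := (key 0).1.hasFDerivAt.hasMFDerivAt.comp (1 : H)
    (mdifferentiableAt_atlas (I := 𝓘(ℝ, F)) (chart_mem_atlas F (1 : H)) h1s).hasMFDerivAt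
  refine (hg.congr_of_eventuallyEq ?_).congr_mfderiv ?_
  · filter_upwards [eventually_mem_charts (F := F) (E := E) (H := H) p] with h hh
    have e1 := realForm_pair_eq_chart X.kahler p hh.2
      (mfderiv 𝓘(ℝ, E) 𝓘(ℝ, E) (fun q : M => h • q) p u)
      (mfderiv 𝓘(ℝ, E) 𝓘(ℝ, E) (fun q : M => h • q) p v)
    have e2 := fderiv_actionInChart_right (F := F) hh.1 hps hh.2 u
    have e3 := fderiv_actionInChart_right (F := F) hh.1 hps hh.2 v
    have e4 := actionInChart_apply (F := F) (p' := p) hh.1 hps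
    rw [e2, e3, ← e4] at e1
    refine e1.trans ?_
    simp only [Function.comp_apply, B, twoFormBilin_apply]
    rfl
  · ext ξ
    exact (key ξ).2

end Invariance

/-! ### Lagrangian subspaces -/

section LagrangianSubspaces

variable {E : Type*} [NormedAddCommGroup E] [NormedSpace ℂ E] [FiniteDimensional ℂ E]
  {A : Type*} [AddCommGroup A] [Module ℝ A] [FiniteDimensional ℝ A]
  {B : E →L[ℝ] E →L[ℝ] ℝ} {D : A →ₗ[ℝ] E}

/-- `T = D(A) ⊕ I D(A)` for a Lagrangian subspace `D(A)`. -/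
theorem exists_add_I_smul (hpos : ∀ u, u ≠ 0 → 0 < B u (Complex.I • u))
    (hdim : finrank ℝ A = finrank ℂ E) (hD : Function.Injective D)
    (hiso : ∀ a b, B (D a) (D b) = 0) (u : E) : ∃ a b, u = D a + Complex.I • D b := by
  have : FiniteDimensional ℝ E := FiniteDimensional.complexToReal E
  let f : A × A →ₗ[ℝ] E := D.coprod ((Complex.I • (LinearMap.id : E →ₗ[ℝ] E)) ∘ₗ D)
  have hf : ∀ x, f x = D x.1 + Complex.I • D x.2 := fun x => rfl
  have hinj : Function.Injective f := by
    rw [injective_iff_map_eq_zero]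
    rintro ⟨a, b⟩ h
    rw [hf] at h
    have h1 : Complex.I • D b = D (-a) := by
      rw [map_neg]; exact eq_neg_of_add_eq_zero_right h
    have hb : D b = 0 := by
      by_contra hne
      have := hpos _ hne
      rw [h1, hiso] at this
      exact lt_irrefl _ this
    have ha : D a = 0 := by simpa [hb] using h
    rw [← map_zero D] at ha hb
    exact Prod.ext (hD ha) (hD hb)
  have hfin : finrank ℝ (A × A) = finrank ℝ E := by
    rw [finrank_prod, finrank_real_of_complex, hdim, two_mul]
  obtain ⟨x, hx⟩ := (LinearMap.injective_iff_surjective_of_finrank_eq_finrank hfin).1 hinj u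
  exact ⟨x.1, x.2, by rw [← hf, hx]⟩

/-- The orthogonal complement of a Lagrangian subspace is its image under `I`. -/
theorem exists_eq_I_smul_of_perp (hcomp : ∀ u v, B (Complex.I • u) (Complex.I • v) = B u v)
    (hpos : ∀ u, u ≠ 0 → 0 < B u (Complex.I • u))
    (hdim : finrank ℝ A = finrank ℂ E) (hD : Function.Injective D)
    (hiso : ∀ a b, B (D a) (D b) = 0) {u : E} (hu : ∀ a, B u (Complex.I • D a) = 0) :
    ∃ b, u = Complex.I • D b := by
  obtain ⟨a, b, rfl⟩ := exists_add_I_smul hpos hdim hD hiso u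
  -- Testing orthogonality of `u = D a + I D b` against its own component `D a` leaves `g(D a, D a)
  -- = 0`.
  have h := hu a
  rw [map_add, add_apply, hcomp, hiso, add_zero] at h
  refine ⟨b, ?_⟩
  by_cases ha : D a = 0
  · rw [ha, zero_add]
  · exact absurd h (hpos _ ha).ne'

end LagrangianSubspaces

/-! ### Invariance of the Kähler form and centrality of the moment value -/

section KahlerBilin

variable {E : Type*} [NormedAddCommGroup E] [NormedSpace ℂ E]
  {M : Type*} [TopologicalSpace M] [ChartedSpace E M] {n : ℕ} (X : CalabiYau E M n)

/-- The Kähler form at `p` as a bilinear form on the model space. -/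
def CalabiYau.kahlerBilin (p : M) : E →L[ℝ] E →L[ℝ] ℝ :=
  twoFormBilin (𝕜 := ℝ) (E := E) (W := ℝ) (X.kahler p)

theorem kahlerBilin_apply (p : M) (u v : E) : X.kahlerBilin p u v = X.kahler p ![u, v] :=
  twoFormBilin_apply (𝕜 := ℝ) (E := E) (W := ℝ) (X.kahler p) u v

theorem kahlerBilin_I_I (p : M) (u v : E) :
    X.kahlerBilin p (Complex.I • u) (Complex.I • v) = X.kahlerBilin p u v := by
  rw [kahlerBilin_apply, kahlerBilin_apply]
  exact X.compatible_kahler p u v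

theorem kahlerBilin_pos (p : M) (u : E) (hu : u ≠ 0) :
    0 < X.kahlerBilin p u (Complex.I • u) := by
  rw [kahlerBilin_apply]
  exact X.positive_kahler p u hu

theorem kahlerBilin_swap (p : M) (u v : E) : X.kahlerBilin p u v = - X.kahlerBilin p v u := by
  rw [kahlerBilin_apply, kahlerBilin_apply]
  exact alternating_two_swap (W := E) (X.kahler p) u v

theorem metric_eq (p : M) (u v : E) : X.metric p u v = X.kahlerBilin p u (Complex.I • v) :=
  (kahlerBilin_apply X p u (Complex.I • v)).symm

end KahlerBilin

section Invariance

variable {F : Type*} [NormedAddCommGroup F] [NormedSpace ℝ F]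
  {H : Type*} [TopologicalSpace H] [ChartedSpace F H] [Group H] [LieGroup 𝓘(ℝ, F) ∞ H]
  [ConnectedSpace H]
  {E : Type*} [NormedAddCommGroup E] [NormedSpace ℂ E]
  {M : Type*} [TopologicalSpace M] [ChartedSpace E M] [IsManifold 𝓘(ℂ, E) ω M]
  [MulAction H M] [ContMDiffSMul 𝓘(ℝ, F) 𝓘(ℝ, E) ∞ H M]
  {n : ℕ} {X : CalabiYau E M n} {μ : M → GroupLieAlgebra 𝓘(ℝ, F) H →L[ℝ] ℝ}

/-- The pullback under `h * g` at `p` is the pullback under `h` at `g • p`, evaluated on translated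
vectors. So invariance at the identity, known at every point of `M`, gives vanishing derivative at
every `g`, and connectedness of `H` concludes. -/
theorem kahler_translation (hμ : IsMomentMap X μ) (h : H) (p : M) (u v : E) :
    X.kahler (h • p) ![mfderiv 𝓘(ℝ, E) 𝓘(ℝ, E) (fun q : M => h • q) p u,
        mfderiv 𝓘(ℝ, E) 𝓘(ℝ, E) (fun q : M => h • q) p v] = X.kahler p ![u, v] := by
  let G : H → M → E → E → ℝ := fun h p u v =>
    X.kahler (h • p) ![mfderiv 𝓘(ℝ, E) 𝓘(ℝ, E) (fun q : M => h • q) p u,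
        mfderiv 𝓘(ℝ, E) 𝓘(ℝ, E) (fun q : M => h • q) p v]
  have hmul : ∀ h g, G (h * g) p u v = G h (g • p)
      (mfderiv 𝓘(ℝ, E) 𝓘(ℝ, E) (fun q : M => g • q) p u)
      (mfderiv 𝓘(ℝ, E) 𝓘(ℝ, E) (fun q : M => g • q) p v) := by
    intro h g
    have h1 := mfderiv_translation_mul F E h g p u
    have h2 := mfderiv_translation_mul F E h g p v
    simp only [G]
    rw [h1, h2]
    have h3 : ∀ q, q = h • g • p → ∀ a b : E, X.kahler q ![a, b] = X.kahler (h • g • p) ![a, b] := by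
      rintro _ rfl _ _; rfl
    exact h3 _ (mul_smul h g p) _ _
  have hconst : G h p u v = G 1 p u v := by
    refine apply_eq_of_hasMFDerivAt_mul_right (F := F) (f := fun h => G h p u v) (fun g => ?_) h 1
    exact (hasMFDerivAt_kahler_translation X μ hμ (g • p) _ _).congr_of_eventuallyEq
      (Eventually.of_forall fun h => hmul h g)
  refine hconst.trans ?_
  have h1 := mfderiv_translation_one (H := H) E p u
  have h2 := mfderiv_translation_one (H := H) E p v
  simp only [G]
  rw [h1, h2]
  have h3 : ∀ q, q = p → ∀ a b : E, X.kahler q ![a, b] = X.kahler p ![a, b] := by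
    rintro _ rfl _ _; rfl
  exact h3 _ (one_smul H p) _ _

/-- The value of the moment map along an isotropic orbit is central. -/
theorem mem_coadjointCenter (hμ : IsMomentMap X μ) (p : M)
    (hiso : ∀ ξ η : F, X.kahlerBilin p (fundamentalVF (H := H) ξ p)
      (fundamentalVF (H := H) η p) = 0) :
    μ p ∈ coadjointCenter (F := F) (H := H) := by
  have hconst : ∀ (ξ : GroupLieAlgebra 𝓘(ℝ, F) H) (h : H), μ (h • p) ξ = μ p ξ := by
    intro ξ h
    have h0 := apply_eq_of_hasMFDerivAt_mul_left (F := F) (f := fun h : H => μ (h • p) ξ)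
      (fun g => ?_) h 1
    · simpa using h0
    · have h1 : (fun h : H => μ ((g * h) • p) ξ) =
          (fun q => μ q (adj g⁻¹ ξ)) ∘ fun h : H => h • p := by
        funext h
        simp only [Function.comp_apply, mul_smul, hμ.equivariant g]
      have h2 := (((hμ.smooth (adj g⁻¹ ξ)).contMDiffAt (x := (1 : H) • p)).mdifferentiableAt
        (by simp)).hasMFDerivAt.comp (1 : H) (mdifferentiableAt_orbit F E p 1).hasMFDerivAt
      rw [h1]
      refine h2.congr_mfderiv ?_
      ext η
      refine (hμ.differential ((1 : H) • p) (adj g⁻¹ ξ) _).trans ?_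
      have h3 : ∀ q, q = p → ∀ b : E,
          X.kahler q ![(fundamentalVF (adj g⁻¹ ξ) q : E), b] =
          X.kahler p ![(fundamentalVF (adj g⁻¹ ξ) p : E), b] := by
        rintro _ rfl _; rfl
      have h4 := (kahlerBilin_apply X p _ _).symm.trans (hiso (adj g⁻¹ ξ) η)
      exact (congrArg Neg.neg ((h3 _ (one_smul H p) _).trans h4)).trans neg_zero
  intro h ξ
  -- By equivariance, constancy at `h⁻¹` reads `⟨μ(p), Ad_h ξ⟩ = ⟨μ(p), ξ⟩`.
  have h1 := hconst ξ h⁻¹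
  rw [hμ.equivariant, inv_inv] at h1
  exact h1

end Invariance

/-! ### The holomorphic volume form under translations -/

section VolumeForm

variable {F : Type*} [NormedAddCommGroup F] [NormedSpace ℝ F]
  {H : Type*} [TopologicalSpace H] [ChartedSpace F H] [Group H]
  {E : Type*} [NormedAddCommGroup E] [NormedSpace ℂ E] [FiniteDimensional ℂ E]
  {M : Type*} [TopologicalSpace M] [ChartedSpace E M] [IsManifold 𝓘(ℂ, E) ω M]
  [MulAction H M] {n : ℕ} {X : CalabiYau E M n} {μ : M → GroupLieAlgebra 𝓘(ℝ, F) H →L[ℝ] ℝ}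

theorem exists_complexLinear {T T' : Type*} [AddCommGroup T] [Module ℂ T]
    [AddCommGroup T'] [Module ℂ T'] (g : T →ₗ[ℝ] T')
    (hg : ∀ v, g (Complex.I • v) = Complex.I • g v) : ∃ g' : T →ₗ[ℂ] T', ∀ v, g' v = g v := by
  refine ⟨{ toFun := g, map_add' := g.map_add, map_smul' := fun c v => ?_ }, fun _ => rfl⟩
  have h1 : c • v = c.re • v + c.im • (Complex.I • v) := by
    conv_lhs => rw [← Complex.re_add_im c]
    rw [add_smul, mul_smul]
    rfl
  have h2 : c • g v = c.re • g v + c.im • (Complex.I • g v) := by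
    conv_lhs => rw [← Complex.re_add_im c]
    rw [add_smul, mul_smul]
    rfl
  rw [RingHom.id_apply, h1, h2, map_add, map_smul, map_smul, hg]

/-- Two top-degree complex forms are proportional. -/
theorem topForm_proportional (hn : finrank ℂ E = n) {α β : E [⋀^Fin n]→ₗ[ℂ] ℂ} (hα : α ≠ 0) :
    ∃ c : ℂ, ∀ w, β w = c * α w := by
  let e : Basis (Fin n) ℂ E := finBasisOfFinrankEq ℂ E hn
  have h1 := α.eq_smul_basis_det e
  have h2 := β.eq_smul_basis_det e
  have h3 : α e ≠ 0 := by
    intro h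
    rw [h, zero_smul] at h1
    exact hα h1
  refine ⟨β e / α e, fun w => ?_⟩
  rw [h1, h2]
  simp only [AlternatingMap.smul_apply, Basis.det_self, smul_eq_mul, mul_one]
  field_simp

variable (E) in
/-- The differential of the translation by `h`, on the model space. -/
def translationDeriv (h : H) (q : M) : E →L[ℝ] E :=
  mfderiv 𝓘(ℝ, E) 𝓘(ℝ, E) (fun q : M => h • q) q

/-- The differential of the chart at `x₀`, on the model space. -/
def chartDeriv (x₀ q : M) : E →L[ℝ] E := mfderiv 𝓘(ℝ, E) 𝓘(ℝ, E) (chartAt E x₀) q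

/-- The differential of the inverse of the chart at `x₀`, on the model space. -/
def chartSymmDeriv (x₀ : M) (y : E) : E →L[ℝ] E :=
  mfderiv 𝓘(ℝ, E) 𝓘(ℝ, E) (chartAt E x₀).symm y

theorem chartDeriv_I {x₀ q : M} (hq : q ∈ (chartAt E x₀).source) (u : E) :
    chartDeriv x₀ q (Complex.I • u) = Complex.I • chartDeriv x₀ q u := by
  have : IsManifold 𝓘(ℂ, E) 1 M := IsManifold.of_le (n := ω) le_top
  have h1 := mdifferentiableAt_atlas (I := 𝓘(ℂ, E)) (chart_mem_atlas E x₀) hq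
  have h2 := mfderiv_real_eq h1 u
  have h3 := mfderiv_real_eq h1 (Complex.I • u)
  refine h3.symm.trans (Eq.trans ?_ (congrArg (Complex.I • ·) h2))
  exact map_smul (mfderiv 𝓘(ℂ, E) 𝓘(ℂ, E) (chartAt E x₀) q) Complex.I u

theorem chartDeriv_symm {x₀ q : M} (hq : q ∈ (chartAt E x₀).source) (v : E) :
    chartDeriv x₀ q (chartSymmDeriv x₀ (chartAt E x₀ q) v) = v := by
  have h1 := chart_mfderiv_symm x₀ ((chartAt E x₀).map_source hq) v
  have h2 : ∀ q', q' = q → (chartDeriv x₀ q' (chartSymmDeriv x₀ (chartAt E x₀ q) v)) = v →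
    chartDeriv x₀ q (chartSymmDeriv x₀ (chartAt E x₀ q) v) = v := by
    rintro _ rfl h; exact h
  exact h2 _ ((chartAt E x₀).left_inv hq) h1

/-- The holomorphic volume form at `q` as a form on the model space. -/
def CalabiYau.volumeForm (X : CalabiYau E M n) (q : M) : E [⋀^Fin n]→ₗ[ℂ] ℂ :=
  ContinuousAlternatingMap.toAlternatingMap (R := ℂ) (M := E) (N := ℂ) (X.Ω q)

theorem volumeForm_ne_zero (X : CalabiYau E M n) (q : M) : X.volumeForm q ≠ 0 := fun h0 =>
  X.nonvanishing_Ω q (ContinuousAlternatingMap.toAlternatingMap_injective (R := ℂ) (M := E)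
    (N := ℂ) h0)

/-- The differential of a translation is complex linear, so the pullback of `Ω` is again a complex
top-degree form at `q`, and these form a complex line. The factor may still depend on `q`. -/
theorem exists_translation_scale (hn : finrank ℂ E = n) (hI : PreservesComplexStructure H E M)
    (X : CalabiYau E M n) (h : H) (q : M) : ∃ c : ℂ, ∀ w : Fin n → E,
    X.volumeForm (h • q) (fun i => translationDeriv E h q (w i)) = c * X.volumeForm q w := by
  obtain ⟨D, hD⟩ := exists_complexLinear (T := E) (T' := E)
    (translationDeriv E h q : E →ₗ[ℝ] E) (fun v => hI h q v)
  obtain ⟨c, hc⟩ := topForm_proportional hn (β := (X.volumeForm (h • q)).compLinearMap D)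
    (volumeForm_ne_zero X q)
  refine ⟨c, fun w => ?_⟩
  rw [← hc w]
  exact congrArg _ (funext fun i => (hD (w i)).symm)

theorem wedgeConj_mul {T : Type*} (α : (Fin n → T) → ℂ) (c : ℂ) (w : Fin (2 * n) → T) :
    wedgeConj (fun u => c * α u) w = (‖c‖ ^ 2 : ℝ) * wedgeConj α w := by
  simp only [wedgeConj, map_mul]
  rw [← Complex.normSq_eq_norm_sq, Complex.normSq_eq_conj_mul_self]
  rw [mul_left_comm]
  congr 1
  rw [Finset.mul_sum]
  refine Finset.sum_congr rfl fun σ _ => ?_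
  ring

/-- The power `ωⁿ` is preserved while `Ω ∧ conj Ω` is multiplied by `|c|²`; the normalization,
evaluated where `Ω ∧ conj Ω ≠ 0`, forces `|c| = 1`. -/
theorem norm_translation_scale [LieGroup 𝓘(ℝ, F) ∞ H] [ConnectedSpace H]
    [ContMDiffSMul 𝓘(ℝ, F) 𝓘(ℝ, E) ∞ H M] (hμ : IsMomentMap X μ) {h : H} {q : M} {c : ℂ}
    (hc : ∀ w : Fin n → E,
    X.volumeForm (h • q) (fun i => translationDeriv E h q (w i)) = c * X.volumeForm q w) :
    ‖c‖ = 1 := by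
  obtain ⟨w, hw⟩ := exists_wedgeConj_ne_zero _ (volumeForm_ne_zero X q)
  have e1 := X.normalized q w
  have e2 := X.normalized (h • q) (fun i => translationDeriv E h q (w i))
  have e3 : wedgePower (T := E) (fun u v => X.kahler (h • q) ![u, v]) n
      (fun i => translationDeriv E h q (w i)) =
      wedgePower (T := E) (fun u v => X.kahler q ![u, v]) n w := by
    simp only [wedgePower]
    congr 1
    refine Finset.sum_congr rfl fun σ _ => ?_
    congr 1
    exact Finset.prod_congr rfl fun i _ => kahler_translation hμ h q _ _
  have e4 : wedgeConj (X.volumeForm (h • q)) (fun i => translationDeriv E h q (w i)) =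
      (‖c‖ ^ 2 : ℝ) * wedgeConj (X.volumeForm q) w := by
    rw [← wedgeConj_mul]
    simp only [wedgeConj]
    congr 1
    refine Finset.sum_congr rfl fun σ _ => ?_
    rw [hc fun i => w (σ ⟨i, by omega⟩), hc fun i => w (σ ⟨n + i, by omega⟩)]
  have e7 := (congrArg (fun t : ℝ => ((t / (n.factorial : ℝ) : ℝ) : ℂ)) e3)
  have e8 : (-1) ^ (n * (n - 1) / 2) * (Complex.I / 2) ^ n *
      wedgeConj (X.volumeForm (h • q)) (fun i => translationDeriv E h q (w i)) =
      (-1) ^ (n * (n - 1) / 2) * (Complex.I / 2) ^ n * wedgeConj (X.volumeForm q) w :=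
    (e2.symm.trans e7).trans e1
  have hk : ((-1) ^ (n * (n - 1) / 2) * (Complex.I / 2) ^ n : ℂ) ≠ 0 := by simp
  have e10 := e4.symm.trans (mul_left_cancel₀ hk e8)
  have e11 : ((‖c‖ ^ 2 : ℝ) : ℂ) = 1 := mul_right_cancel₀ hw (e10.trans (one_mul _).symm)
  have e12 : ‖c‖ ^ 2 = 1 := by exact_mod_cast e11
  exact (pow_eq_one_iff_of_nonneg (norm_nonneg c) two_ne_zero).1 e12

variable (F) in
/-- The components of the translate of the volume form are holomorphic in a chart. -/
theorem differentiableAt_translation_volumeForm [LieGroup 𝓘(ℝ, F) ∞ H]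
    [ContMDiffSMul 𝓘(ℝ, F) 𝓘(ℝ, E) ∞ H M] (hI : PreservesComplexStructure H E M)
    (X : CalabiYau E M n) (h : H) (q₀ : M) (e : Fin n → E) :
    ∃ N : E → ℂ, DifferentiableAt ℂ N (chartAt E q₀ q₀) ∧
      ∀ᶠ q in 𝓝 q₀, N (chartAt E q₀ q) = X.volumeForm (h • q) (fun i => translationDeriv E h q
        (chartSymmDeriv q₀ (chartAt E q₀ q) (e i))) := by
  have : IsManifold 𝓘(ℝ, E) ∞ M := isManifold_real
  have : IsManifold 𝓘(ℂ, E) 1 M := IsManifold.of_le (n := ω) le_top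
  let p' := h • q₀
  let φ := chartAt E q₀
  let φ' := chartAt E p'
  let ψ := chartAt F h
  have hh : h ∈ ψ.source := mem_chart_source F h
  have hq₀ : q₀ ∈ φ.source := mem_chart_source E q₀
  have hp' : h • q₀ ∈ φ'.source := mem_chart_source E p'
  let A := actionInChart F E h q₀ p'
  let l : E → E := fun y => A (ψ h, y)
  have hA : ContDiffAt ℝ ∞ A (ψ h, φ q₀) := contDiffAt_actionInChart hh hq₀ hp'
  have hl : ContDiffAt ℝ ∞ l (φ q₀) :=
    ContDiffAt.comp (g := A) (φ q₀) hA (contDiffAt_const.prodMk contDiffAt_id)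
  have hev : ∀ᶠ q in 𝓝 q₀, q ∈ φ.source ∧ h • q ∈ φ'.source := by
    refine Filter.Eventually.and (φ.open_source.mem_nhds hq₀) ?_
    exact (contMDiff_translation F E h).continuous.continuousAt.eventually
      (φ'.open_source.mem_nhds hp')
  have hev' : ∀ᶠ y in 𝓝 (φ q₀), y ∈ φ.target ∧ h • φ.symm y ∈ φ'.source := by
    refine Filter.Eventually.and (φ.open_target.mem_nhds (φ.map_source hq₀)) ?_
    have h1 : ContinuousAt φ.symm (φ q₀) := φ.continuousAt_symm (φ.map_source hq₀)
    have h2 := h1.eventually (p := fun q => q ∈ φ.source ∧ h • q ∈ φ'.source)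
      (by rw [φ.left_inv hq₀]; exact hev)
    exact h2.mono fun y hy => hy.2
  have hl' : ∀ q ∈ φ.source, h • q ∈ φ'.source → ∀ u : E,
      fderiv ℝ l (φ q) (chartDeriv q₀ q u) =
      chartDeriv p' (h • q) (translationDeriv E h q u) := by
    intro q hq hhq u
    have h1 := fderiv_actionInChart_right (p' := p') hh hq hhq u
    refine Eq.trans ?_ h1.symm
    have h2 : HasFDerivAt l (fderiv ℝ A (ψ h, φ q) ∘L ContinuousLinearMap.inr ℝ F E) (φ q) :=
      HasFDerivAt.comp (g := A) (φ q)
        ((contDiffAt_actionInChart hh hq hhq).differentiableAt (by simp)).hasFDerivAt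
        (hasFDerivAt_prodMk_right (ψ h) (φ q))
    rw [h2.fderiv]
    rfl
  -- The translation commutes with `I` and the charts are holomorphic, so the chart expression `l`
  -- commutes with `i`. Hence `l` and the components of its differential are holomorphic.
  have hcomm : ∀ᶠ y in 𝓝 (φ q₀), ∀ v, fderiv ℝ l y (Complex.I • v) =
      Complex.I • fderiv ℝ l y v := by
    filter_upwards [hev'] with y hy v
    have hys := φ.map_target hy.1
    have h0 := chartDeriv_symm hys v
    have h1 := hl' _ hys hy.2 (chartSymmDeriv q₀ (φ (φ.symm y)) v)
    have h2 := hl' _ hys hy.2 (Complex.I • chartSymmDeriv q₀ (φ (φ.symm y)) v)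
    have h4 : ∀ u, translationDeriv E h (φ.symm y) (Complex.I • u) =
      Complex.I • translationDeriv E h (φ.symm y) u := hI h _
    rw [h0] at h1
    rw [chartDeriv_I hys, h0, h4, chartDeriv_I hy.2, ← h1] at h2
    rwa [φ.right_inv hy.1] at h2
  obtain ⟨d1, d2⟩ := differentiableAt_complex_of_commute hl hcomm
  have hlq : l (φ q₀) = φ' (h • q₀) := actionInChart_apply hh hq₀
  refine ⟨fun y => complexFormInChart X.Ω p' (l y) (fun i => fderiv ℝ l y (e i)), ?_, ?_⟩
  · refine differentiableAt_alternating_apply ?_ fun i => d2 (e i)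
    refine DifferentiableAt.comp (g := complexFormInChart X.Ω p') _ ?_ d1
    rw [hlq]
    exact (X.holomorphic_Ω p').differentiableAt (φ'.open_target.mem_nhds (φ'.map_source hp'))
  · filter_upwards [hev] with q hq
    have h1 : l (φ q) = φ' (h • q) := actionInChart_apply hh hq.1
    have h2 := complexForm_eq_chart X.Ω p' hq.2 (fun i => translationDeriv E h q
        (chartSymmDeriv q₀ (chartAt E q₀ q) (e i)))
    refine Eq.trans ?_ h2.symm
    have h3 : ∀ i, chartDeriv p' (h • q) (translationDeriv E h q
        (chartSymmDeriv q₀ (chartAt E q₀ q) (e i))) = fderiv ℝ l (φ q) (e i) := by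
      intro i
      rw [← hl' q hq.1 hq.2, chartDeriv_symm hq.1]
    rw [h1]
    exact congrArg _ (funext fun i => (h3 i).symm)

end VolumeForm

/-! ### The character of the action on the holomorphic volume form -/

section Character

variable {F : Type*} [NormedAddCommGroup F] [NormedSpace ℝ F]
  {H : Type*} [TopologicalSpace H] [ChartedSpace F H] [Group H]
  {E : Type*} [NormedAddCommGroup E] [NormedSpace ℂ E] [FiniteDimensional ℂ E]
  {M : Type*} [TopologicalSpace M] [ChartedSpace E M] [IsManifold 𝓘(ℂ, E) ω M]
  [MulAction H M] {n : ℕ} {X : CalabiYau E M n} {μ : M → GroupLieAlgebra 𝓘(ℝ, F) H →L[ℝ] ℝ}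

theorem scalesVolumeForm_iff {h : H} {c : ℂ} : ScalesVolumeForm X h c ↔ ∀ p (w : Fin n → E),
    X.volumeForm (h • p) (fun i => translationDeriv E h p (w i)) = c * X.volumeForm p w :=
  Iff.rfl

theorem volumeForm_eq_chart (X : CalabiYau E M n) (x₀ : M) {q : M}
    (hq : q ∈ (chartAt E x₀).source) (w : Fin n → E) :
    X.volumeForm q w = complexFormInChart X.Ω x₀ (chartAt E x₀ q) (fun i => chartDeriv x₀ q (w i)) :=
  complexForm_eq_chart X.Ω x₀ hq w

/-- Near `q₀`, `f` is the quotient of one component of the pulled-back form by the same component of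
`Ω`. Both are holomorphic in the chart, and the component is chosen nonzero at `q₀`. -/
theorem mdifferentiable_translation_scale [LieGroup 𝓘(ℝ, F) ∞ H]
    [ContMDiffSMul 𝓘(ℝ, F) 𝓘(ℝ, E) ∞ H M] (hI : PreservesComplexStructure H E M) (h : H)
    (f : M → ℂ) (hf : ∀ q (w : Fin n → E),
      X.volumeForm (h • q) (fun i => translationDeriv E h q (w i)) = f q * X.volumeForm q w) :
    MDifferentiable 𝓘(ℂ, E) 𝓘(ℂ, ℂ) f := by
  intro q₀
  have : IsManifold 𝓘(ℂ, E) 1 M := IsManifold.of_le (n := ω) le_top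
  have hq₀ : q₀ ∈ (chartAt E q₀).source := mem_chart_source E q₀
  obtain ⟨e, he⟩ : ∃ e, complexFormInChart X.Ω q₀ (chartAt E q₀ q₀) e ≠ 0 := by
    by_contra! hcon
    refine volumeForm_ne_zero X q₀ (AlternatingMap.ext fun w => ?_)
    rw [volumeForm_eq_chart X q₀ hq₀, hcon]
    rfl
  obtain ⟨N, hN, hN'⟩ := differentiableAt_translation_volumeForm F hI X h q₀ e
  have hD : DifferentiableAt ℂ (fun y => complexFormInChart X.Ω q₀ y e) (chartAt E q₀ q₀) :=
    differentiableAt_alternating_apply (w := fun i _ => e i)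
      ((X.holomorphic_Ω q₀).differentiableAt ((chartAt E q₀).open_target.mem_nhds
        ((chartAt E q₀).map_source hq₀))) (fun i => differentiableAt_const _)
  have h1 : MDifferentiableAt 𝓘(ℂ, E) 𝓘(ℂ, ℂ)
      ((fun y => N y * (complexFormInChart X.Ω q₀ y e)⁻¹) ∘ chartAt E q₀) q₀ :=
    ((hN.mul (hD.fun_inv he)).mdifferentiableAt).comp q₀
      (mdifferentiableAt_atlas (I := 𝓘(ℂ, E)) (chart_mem_atlas E q₀) hq₀)
  refine h1.congr_of_eventuallyEq ?_
  have hne : ∀ᶠ q in 𝓝 q₀, complexFormInChart X.Ω q₀ (chartAt E q₀ q) e ≠ 0 :=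
    (ContinuousAt.comp (g := fun y => complexFormInChart X.Ω q₀ y e) hD.continuousAt
      ((chartAt E q₀).continuousAt hq₀)).eventually_ne he
  filter_upwards [hN', hne, (chartAt E q₀).open_source.mem_nhds hq₀] with q hq hq' hqs
  have h2 := hf q fun i => chartSymmDeriv q₀ (chartAt E q₀ q) (e i)
  rw [← hq, volumeForm_eq_chart X q₀ hqs, funext fun i => chartDeriv_symm hqs (e i)] at h2
  exact (eq_mul_inv_iff_mul_eq₀ hq').2 h2.symm

/-- Every translation multiplies the holomorphic volume form by a constant phase. -/
theorem exists_scalesVolumeForm [LieGroup 𝓘(ℝ, F) ∞ H] [ConnectedSpace H] [ConnectedSpace M]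
    [ContMDiffSMul 𝓘(ℝ, F) 𝓘(ℝ, E) ∞ H M] (hn : finrank ℂ E = n)
    (hI : PreservesComplexStructure H E M) (hμ : IsMomentMap X μ) (h : H) :
    ∃ c : ℂ, ‖c‖ = 1 ∧ ScalesVolumeForm X h c := by
  have : IsManifold 𝓘(ℂ, E) 1 M := IsManifold.of_le (n := ω) le_top
  choose f hf using exists_translation_scale hn hI X h
  have hnorm : ∀ q, ‖f q‖ = 1 := fun q => norm_translation_scale hμ (hf q)
  obtain ⟨q₀⟩ := (inferInstance : Nonempty M)
  -- Since the modulus is one everywhere, every point maximizes it; the maximum modulus principle on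
  -- the connected `M` makes the holomorphic factor constant.
  have hconst := MDifferentiableOn.eqOn_of_isPreconnected_of_isMaxOn_norm (U := univ) (c := q₀)
    (mdifferentiable_translation_scale (F := F) hI h f hf).mdifferentiableOn isPreconnected_univ isOpen_univ
    (mem_univ _) (fun q _ => by simp [hnorm])
  refine ⟨f q₀, hnorm q₀, fun q w => ?_⟩
  have h1 : f q = f q₀ := hconst (mem_univ q)
  rw [← h1]
  exact hf q w

/-- `Ω` is nonzero, so the factor can be read off from one value. It follows that `χ` is determined
by the action and is multiplicative. -/
theorem scalesVolumeForm_unique [Nonempty M] {h : H} {c c' : ℂ} (hc : ScalesVolumeForm X h c)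
    (hc' : ScalesVolumeForm X h c') : c = c' := by
  obtain ⟨p⟩ := (inferInstance : Nonempty M)
  obtain ⟨w, hw⟩ : ∃ w, X.volumeForm p w ≠ 0 := by
    by_contra! hcon
    exact volumeForm_ne_zero X p (AlternatingMap.ext hcon)
  exact mul_right_cancel₀ hw ((hc p w).symm.trans (hc' p w))

theorem scalesVolumeForm_one : ScalesVolumeForm X (1 : H) 1 := by
  rw [scalesVolumeForm_iff]
  intro p w
  rw [one_mul, one_smul]
  exact congrArg _ (funext fun i => mfderiv_translation_one E p (w i))

variable (F) in
theorem scalesVolumeForm_mul [ContMDiffSMul 𝓘(ℝ, F) 𝓘(ℝ, E) ∞ H M] {g h : H} {c c' : ℂ}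
    (hg : ScalesVolumeForm X g c) (hh : ScalesVolumeForm X h c') :
    ScalesVolumeForm X (g * h) (c * c') := by
  rw [scalesVolumeForm_iff] at *
  intro p w
  rw [mul_assoc, ← hh, ← hg, mul_smul]
  exact congrArg _ (funext fun i => mfderiv_translation_mul F E g h p (w i))

variable (F) in
theorem character_mul [ContMDiffSMul 𝓘(ℝ, F) 𝓘(ℝ, E) ∞ H M] [Nonempty M] {χ : H → ℂ}
    (hχ : ∀ h, ScalesVolumeForm X h (χ h)) (g h : H) : χ (g * h) = χ g * χ h :=
  scalesVolumeForm_unique (hχ _) (scalesVolumeForm_mul F (hχ g) (hχ h))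

theorem character_one [Nonempty M] {χ : H → ℂ} (hχ : ∀ h, ScalesVolumeForm X h (χ h)) :
    χ 1 = 1 :=
  scalesVolumeForm_unique (hχ _) scalesVolumeForm_one

/-- For fixed `p` and `w` with `Ω_p(w) ≠ 0`, `χ(h)` is the value of `Ω` at `h • p` on the translated
`w`, divided by `Ω_p(w)`. In charts this is a differentiable expression in `A` and its derivative.
-/
theorem mdifferentiableAt_character [LieGroup 𝓘(ℝ, F) ∞ H]
    [ContMDiffSMul 𝓘(ℝ, F) 𝓘(ℝ, E) ∞ H M] [Nonempty M] {χ : H → ℂ}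
    (hχ : ∀ h, ScalesVolumeForm X h (χ h)) : MDifferentiableAt 𝓘(ℝ, F) 𝓘(ℝ, ℂ) χ 1 := by
  have : IsManifold 𝓘(ℝ, E) ∞ M := isManifold_real
  have : IsManifold 𝓘(ℝ, F) 1 H := isManifold_one
  obtain ⟨p⟩ := (inferInstance : Nonempty M)
  obtain ⟨w, hw⟩ : ∃ w, X.volumeForm p w ≠ 0 := by
    by_contra! hcon
    exact volumeForm_ne_zero X p (AlternatingMap.ext hcon)
  have h1s : (1 : H) ∈ (chartAt F (1 : H)).source := mem_chart_source F 1
  have hps : p ∈ (chartAt E p).source := mem_chart_source E p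
  have hps' : (1 : H) • p ∈ (chartAt E p).source := by rwa [one_smul]
  let A := actionInChart F E (1 : H) p p
  let ψ := chartAt F (1 : H)
  let φ := chartAt E p
  have hA : ContDiffAt ℝ ∞ A (ψ 1, φ p) := contDiffAt_actionInChart h1s hps hps'
  have hA1 : A (ψ 1, φ p) = φ p :=
    (actionInChart_apply h1s hps).trans (congrArg φ (one_smul H p))
  let ev : E × (Fin n → E) → ℂ := fun z => complexFormInChart X.Ω p z.1 z.2
  let G : F → E × (Fin n → E) := fun x => (A (x, φ p), fun i =>
    fderiv ℝ A (x, φ p) (0, chartDeriv p p (w i)))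
  have hev : DifferentiableAt ℝ ev (G (ψ 1)) := by
    have h1 : DifferentiableAt ℂ ev (G (ψ 1)) := by
      refine differentiableAt_alternating_apply (w := fun i (z : E × (Fin n → E)) => z.2 i) ?_ ?_
      · refine DifferentiableAt.comp (g := complexFormInChart X.Ω p) _ ?_ differentiableAt_fst
        simp only [G, hA1]
        exact (X.holomorphic_Ω p).differentiableAt (φ.open_target.mem_nhds (φ.map_source hps))
      · intro i
        fun_prop
    exact h1.restrictScalars ℝ
  have hpair : DifferentiableAt ℝ (fun x : F => (x, φ p)) (ψ 1) := by fun_prop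
  have hG : DifferentiableAt ℝ G (ψ 1) := by
    refine DifferentiableAt.prodMk ?_ (differentiableAt_pi.2 fun i => ?_)
    · exact DifferentiableAt.comp (g := A) _ (hA.differentiableAt (by simp)) hpair
    · refine DifferentiableAt.clm_apply ?_ (differentiableAt_const _)
      exact DifferentiableAt.comp (g := fderiv ℝ A) _
        ((hA.fderiv_right (m := ∞) (by simp)).differentiableAt (by simp)) hpair
  have hcomp : MDifferentiableAt 𝓘(ℝ, F) 𝓘(ℝ, ℂ)
      ((fun x => ev (G x) * (X.volumeForm p w)⁻¹) ∘ ψ) 1 :=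
    ((DifferentiableAt.comp (g := ev) _ hev hG).mul_const _).mdifferentiableAt.comp (1 : H)
      (mdifferentiableAt_atlas (I := 𝓘(ℝ, F)) (chart_mem_atlas F (1 : H)) h1s)
  refine hcomp.congr_of_eventuallyEq ?_
  filter_upwards [eventually_mem_charts (F := F) (E := E) (H := H) p] with h hh
  have h2 := scalesVolumeForm_iff.1 (hχ h) p w
  refine (eq_mul_inv_iff_mul_eq₀ hw).2 (h2.symm.trans ?_)
  rw [volumeForm_eq_chart X p hh.2]
  have h3 : A (ψ h, φ p) = φ (h • p) := actionInChart_apply hh.1 hps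
  have h4 : ∀ u, chartDeriv p (h • p) (translationDeriv E h p u) =
      fderiv ℝ A (ψ h, φ p) (0, chartDeriv p p u) :=
    fderiv_actionInChart_right hh.1 hps hh.2
  simp only [ev, G, h3, h4]
  rfl

/-- The phase covector exists and is unique. -/
theorem existsUnique_isPhaseCovector [LieGroup 𝓘(ℝ, F) ∞ H] [ConnectedSpace H] [ConnectedSpace M]
    [ContMDiffSMul 𝓘(ℝ, F) 𝓘(ℝ, E) ∞ H M] (hn : finrank ℂ E = n)
    (hI : PreservesComplexStructure H E M) (hμ : IsMomentMap X μ) :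
    ∃! a : GroupLieAlgebra 𝓘(ℝ, F) H →L[ℝ] ℝ, IsPhaseCovector X a := by
  choose χ hnorm hχ using exists_scalesVolumeForm (X := X) hn hI hμ
  have hd := mdifferentiableAt_character (F := F) hχ
  let χ' : F →L[ℝ] ℂ := mfderiv 𝓘(ℝ, F) 𝓘(ℝ, ℂ) χ 1
  -- Differentiating `|χ|² = 1` at `χ(1) = 1` shows that `dχ` is purely imaginary, so the covector
  -- is its imaginary part.
  have hre : ∀ ξ, (χ' ξ).re = 0 := by
    intro ξ
    have h1 : HasFDerivAt (fun z : ℂ => z.re * z.re + z.im * z.im)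
        ((χ 1).re • Complex.reCLM + (χ 1).re • Complex.reCLM +
          ((χ 1).im • Complex.imCLM + (χ 1).im • Complex.imCLM)) (χ 1) :=
      (Complex.reCLM.hasFDerivAt.mul Complex.reCLM.hasFDerivAt).add
        (Complex.imCLM.hasFDerivAt.mul Complex.imCLM.hasFDerivAt)
    have h2 := h1.hasMFDerivAt.comp (1 : H) hd.hasMFDerivAt
    have h3 : ((fun z : ℂ => z.re * z.re + z.im * z.im) ∘ χ) = fun _ => (1 : ℝ) := by
      funext h
      simp only [Function.comp_apply]
      rw [← Complex.normSq_apply, Complex.normSq_eq_norm_sq, hnorm, one_pow]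
    rw [h3] at h2
    have h4 := congrArg (fun A : F →L[ℝ] ℝ => A ξ)
      (hasMFDerivAt_unique h2 (hasMFDerivAt_const (1 : ℝ) (1 : H)))
    have h5 : (χ 1).re * (χ' ξ).re + (χ 1).re * (χ' ξ).re +
      ((χ 1).im * (χ' ξ).im + (χ 1).im * (χ' ξ).im) = 0 := h4
    rw [character_one hχ] at h5
    simp at h5
    linarith
  refine ⟨(Complex.imCLM ∘L χ' : F →L[ℝ] ℝ), ⟨χ, hχ, hd, fun ξ => ?_⟩, ?_⟩
  · refine Complex.ext ?_ ?_
    · exact (hre ξ).trans (by simp)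
    · refine Eq.trans (b := (χ' ξ).im) rfl ?_
      simp
      rfl
  · rintro b ⟨χ₁, h1, -, h3⟩
    have h4 : χ₁ = χ := funext fun h => scalesVolumeForm_unique (h1 h) (hχ h)
    subst h4
    refine ContinuousLinearMap.ext fun ξ => ?_
    have h5 := congrArg Complex.im (h3 ξ)
    simp only [Complex.mul_im, Complex.I_re, Complex.I_im, Complex.ofReal_im, Complex.ofReal_re,
      zero_mul, one_mul, zero_add] at h5
    exact h5.symm

end Character

/-! ### The character on one-parameter subgroups -/

section Exponential

variable {F : Type*} [NormedAddCommGroup F] [NormedSpace ℝ F]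
  {H : Type*} [TopologicalSpace H] [ChartedSpace F H] [Group H]
  {E : Type*} [NormedAddCommGroup E] [NormedSpace ℂ E] [FiniteDimensional ℂ E]
  {M : Type*} [TopologicalSpace M] [ChartedSpace E M] [IsManifold 𝓘(ℂ, E) ω M]
  [MulAction H M] {n : ℕ} {X : CalabiYau E M n}
  {a : GroupLieAlgebra 𝓘(ℝ, F) H →L[ℝ] ℝ}

/-- A differentiable one-parameter subgroup of `ℂˣ` is an exponential. -/
theorem eq_exp_of_map_add {u : ℝ → ℂ} {b : ℂ} (hu : ∀ s t, u (s + t) = u s * u t)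
    (h0 : u 0 = 1) (hd : HasDerivAt u b 0) (t : ℝ) : u t = Complex.exp (b * t) := by
  -- The functional equation `u(s) = u(t) u(s - t)` transports the derivative at `0` to `t`; then
  -- `u(t) e^{-bt}` has zero derivative.
  have hdt : ∀ t, HasDerivAt u (u t * b) t := by
    intro t
    have h1 : HasDerivAt (fun s => s - t) 1 t := (hasDerivAt_id t).sub_const t
    have h2 : HasDerivAt (fun s => u (s - t)) b t := by
      have := HasDerivAt.scomp (g₁ := u) (h := fun s => s - t) t (by simpa using hd) h1
      simpa [Function.comp_def] using this
    have h3 := h2.const_mul (u t)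
    refine h3.congr_of_eventuallyEq (Eventually.of_forall fun s => ?_)
    change u s = u t * u (s - t)
    rw [← hu, add_sub_cancel]
  have hexp : ∀ t : ℝ, HasDerivAt (fun s : ℝ => Complex.exp (-(b * s))) (-b *
      Complex.exp (-(b * t))) t := by
    intro t
    have h1 : HasDerivAt (fun s : ℝ => -(b * (s : ℂ))) (-b) t := by
      simpa using ((Complex.ofRealCLM.hasDerivAt (x := t)).const_mul b).fun_neg
    simpa [mul_comm] using h1.cexp
  have hprod : ∀ t : ℝ, HasDerivAt (fun s : ℝ => u s * Complex.exp (-(b * s))) 0 t := by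
    intro t
    refine ((hdt t).mul (hexp t)).congr_deriv ?_
    ring
  have hconst := is_const_of_deriv_eq_zero (fun t => (hprod t).differentiableAt)
    (fun t => (hprod t).deriv) t 0
  simp only [Complex.ofReal_zero, mul_zero, neg_zero, Complex.exp_zero, mul_one, h0] at hconst
  rw [Complex.exp_neg] at hconst
  exact mul_inv_eq_one₀ (Complex.exp_ne_zero _) |>.1 hconst

/-- Composing the character with the one-parameter subgroup gives a homomorphism from `ℝ` with
derivative `i a(η)` at `0`; its value at `1` is the claimed phase. -/
theorem scalesVolumeForm_of_isExp [ContMDiffSMul 𝓘(ℝ, F) 𝓘(ℝ, E) ∞ H M] [Nonempty M]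
    (ha : IsPhaseCovector X a) {η : GroupLieAlgebra 𝓘(ℝ, F) H} {h : H} (hη : IsExp η h) :
    ScalesVolumeForm X h (Complex.exp ((a η : ℝ) * Complex.I)) := by
  obtain ⟨χ, hχ, hd, hχ'⟩ := ha
  obtain ⟨γ, hγ, hadd, h0, rfl⟩ := hη
  have hγ0 : γ 0 = 1 := by
    have := hadd 0 0
    rw [add_zero] at this
    exact left_eq_mul.1 this
  have h1 : HasMFDerivAt 𝓘(ℝ, ℝ) 𝓘(ℝ, F) γ 0 (mfderiv 𝓘(ℝ, ℝ) 𝓘(ℝ, F) γ 0) :=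
    (hγ.contMDiffAt.mdifferentiableAt (by simp)).hasMFDerivAt
  have h2 : HasMFDerivAt 𝓘(ℝ, F) 𝓘(ℝ, ℂ) χ (γ 0) (mfderiv 𝓘(ℝ, F) 𝓘(ℝ, ℂ) χ (γ 0)) := by
    rw [hγ0]; exact hd.hasMFDerivAt
  have h3 := (hasFDerivAt_of_hasMFDerivAt (h2.comp 0 h1)).hasDerivAt
  have h4 : ∀ x : H, x = 1 → ∀ ξ : F, (mfderiv 𝓘(ℝ, F) 𝓘(ℝ, ℂ) χ x ξ : ℂ) =
      Complex.I * (a ξ : ℂ) := by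
    rintro _ rfl ξ; exact hχ' ξ
  have h5 : HasDerivAt (χ ∘ γ) (Complex.I * (a η : ℂ)) 0 := by
    refine h3.congr_deriv ?_
    refine (h4 _ hγ0 _).trans ?_
    exact congrArg (fun ξ : F => Complex.I * (a ξ : ℂ)) h0
  have h6 := eq_exp_of_map_add (u := χ ∘ γ) (fun s t => by
    simp only [Function.comp_apply, hadd, character_mul F hχ]) (by
    simp only [Function.comp_apply, hγ0, character_one hχ]) h5 1
  have h7 : χ (γ 1) = Complex.exp ((a η : ℝ) * Complex.I) := by
    refine h6.trans ?_
    rw [Complex.ofReal_one, mul_one, mul_comm]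
  rw [← h7]
  exact hχ _

/-- The character takes values in an abelian group, so phases multiply and only the sum of the `η`'s
matters, even when they do not commute. -/
theorem scalesVolumeForm_prod [ContMDiffSMul 𝓘(ℝ, F) 𝓘(ℝ, E) ∞ H M] [Nonempty M]
    (ha : IsPhaseCovector X a) {ηs : List (GroupLieAlgebra 𝓘(ℝ, F) H)} {hs : List H}
    (h : List.Forall₂ IsExp ηs hs) :
    ScalesVolumeForm X hs.prod (Complex.exp ((a ηs.sum : ℝ) * Complex.I)) := by
  induction h with
  | nil => simpa using scalesVolumeForm_one (X := X) (H := H)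
  | cons h1 _ ih =>
    have h2 := scalesVolumeForm_mul F (scalesVolumeForm_of_isExp ha h1) ih
    rw [List.prod_cons, List.sum_cons, map_add, Complex.ofReal_add, add_mul, Complex.exp_add]
    exact h2

/-- If the phase covector vanishes, then the action preserves the holomorphic volume form. -/
theorem scalesVolumeForm_one_of_phase_zero [LieGroup 𝓘(ℝ, F) ∞ H] [ConnectedSpace H]
    [ContMDiffSMul 𝓘(ℝ, F) 𝓘(ℝ, E) ∞ H M] [Nonempty M]
    (ha : IsPhaseCovector X (0 : GroupLieAlgebra 𝓘(ℝ, F) H →L[ℝ] ℝ)) (h : H) :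
    ScalesVolumeForm X h 1 := by
  obtain ⟨χ, hχ, hd, hχ'⟩ := ha
  have h1 : χ h = χ 1 := by
    -- Multiplicativity gives derivative `χ(g) dχ_1 = 0` at every `g`, so connectedness of `H`
    -- covers all group elements without writing them as products of exponentials.
    refine apply_eq_of_hasMFDerivAt_mul_left (F := F) (fun g => ?_) h 1
    have h2 : HasFDerivAt (fun z : ℂ => χ g * z) (χ g • ContinuousLinearMap.id ℝ ℂ) (χ 1) :=
      (hasFDerivAt_id (χ 1)).const_mul (χ g)
    have h3 := h2.hasMFDerivAt.comp (1 : H) hd.hasMFDerivAt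
    refine (h3.congr_of_eventuallyEq (Eventually.of_forall fun h =>
      character_mul F hχ g h)).congr_mfderiv ?_
    ext ξ
    have h4 : (mfderiv 𝓘(ℝ, F) 𝓘(ℝ, ℂ) χ 1 ξ : ℂ) = 0 := by
      refine (hχ' ξ).trans ?_
      change Complex.I * ((0 : ℝ) : ℂ) = 0
      simp
    exact (congrArg (fun z : ℂ => χ g * z) h4).trans (mul_zero _)
  rw [← character_one hχ, ← h1]
  exact hχ h

end Exponential

/-! ### Local sections of submersions, local inverses of immersions -/

section LocalSections

variable {F : Type*} [NormedAddCommGroup F] [NormedSpace ℝ F] [FiniteDimensional ℝ F]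
  {E : Type*} [NormedAddCommGroup E] [NormedSpace ℝ E] [FiniteDimensional ℝ E]
  {N : Type*} [TopologicalSpace N] [ChartedSpace F N] [IsManifold 𝓘(ℝ, F) ∞ N]
  {P : Type*} [TopologicalSpace P] [ChartedSpace E P] [IsManifold 𝓘(ℝ, E) ∞ P]

theorem contDiffAt_charts {f : N → P} {x₀ : N} (hf : ContMDiffAt 𝓘(ℝ, F) 𝓘(ℝ, E) ∞ f x₀) :
    ContDiffAt ℝ ∞ (fun y => chartAt E (f x₀) (f ((chartAt F x₀).symm y))) (chartAt F x₀ x₀) := by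
  have hx₀ : x₀ ∈ (chartAt F x₀).source := mem_chart_source F x₀
  rw [← contMDiffAt_iff_contDiffAt]
  have h1 : ContMDiffAt 𝓘(ℝ, F) 𝓘(ℝ, F) ∞ (chartAt F x₀).symm (chartAt F x₀ x₀) :=
    contMDiffOn_chart_symm.contMDiffAt
      ((chartAt F x₀).open_target.mem_nhds ((chartAt F x₀).map_source hx₀))
  have h2 : ContMDiffAt 𝓘(ℝ, E) 𝓘(ℝ, E) ∞ (chartAt E (f x₀)) (f x₀) :=
    contMDiffOn_chart.contMDiffAt ((chartAt E (f x₀)).open_source.mem_nhds (mem_chart_source E _))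
  have h3 := h2.comp x₀ hf
  exact ContMDiffAt.comp_of_eq (g := chartAt E (f x₀) ∘ f) (f := (chartAt F x₀).symm)
    (x := chartAt F x₀ x₀) h3 h1 ((chartAt F x₀).left_inv hx₀)

theorem fderiv_charts {f : N → P} {x₀ : N} (hf : ContMDiffAt 𝓘(ℝ, F) 𝓘(ℝ, E) ∞ f x₀) (ξ : F) :
    fderiv ℝ (fun y => chartAt E (f x₀) (f ((chartAt F x₀).symm y))) (chartAt F x₀ x₀)
      (mfderiv 𝓘(ℝ, F) 𝓘(ℝ, F) (chartAt F x₀) x₀ ξ) =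
    (mfderiv 𝓘(ℝ, E) 𝓘(ℝ, E) (chartAt E (f x₀)) (f x₀) (mfderiv 𝓘(ℝ, F) 𝓘(ℝ, E) f x₀ ξ : E) : E) := by
  have : IsManifold 𝓘(ℝ, F) 1 N := IsManifold.of_le (n := ∞) (by simp)
  have : IsManifold 𝓘(ℝ, E) 1 P := IsManifold.of_le (n := ∞) (by simp)
  have hx₀ : x₀ ∈ (chartAt F x₀).source := mem_chart_source F x₀
  have h1 := (mdifferentiableAt_atlas (I := 𝓘(ℝ, E)) (chart_mem_atlas E (f x₀))
    (mem_chart_source E _)).hasMFDerivAt.comp x₀ (hf.mdifferentiableAt (by simp)).hasMFDerivAt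
  have h2 := ((contDiffAt_charts hf).differentiableAt
    (by simp)).hasFDerivAt.hasMFDerivAt.comp x₀
    (mdifferentiableAt_atlas (I := 𝓘(ℝ, F)) (chart_mem_atlas F x₀) hx₀).hasMFDerivAt
  have h3 := h2.congr_of_eventuallyEq (f₁ := chartAt E (f x₀) ∘ f) (by
    filter_upwards [(chartAt F x₀).open_source.mem_nhds hx₀] with z hz
    simp only [Function.comp_apply, (chartAt F x₀).left_inv hz])
  exact congrArg (fun A : F →L[ℝ] E => A ξ) (hasMFDerivAt_unique h3 h1)

theorem chartAt_mfderiv_symm_self (x₀ : N) (v : F) :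
    (mfderiv 𝓘(ℝ, F) 𝓘(ℝ, F) (chartAt F x₀) x₀
      (mfderiv 𝓘(ℝ, F) 𝓘(ℝ, F) (chartAt F x₀).symm (chartAt F x₀ x₀) v : F) : F) = v := by
  have : IsManifold 𝓘(ℝ, F) 1 N := IsManifold.of_le (n := ∞) (by simp)
  have hx₀ : x₀ ∈ (chartAt F x₀).source := mem_chart_source F x₀
  have ht := (chartAt F x₀).map_source hx₀
  refine mfderiv_leftInverse (I₁ := 𝓘(ℝ, F)) (I₂ := 𝓘(ℝ, F)) (f := (chartAt F x₀).symm)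
    ((chartAt F x₀).left_inv hx₀)
    (mdifferentiableAt_atlas_symm (chart_mem_atlas F x₀) ht)
    (mdifferentiableAt_atlas (chart_mem_atlas F x₀) hx₀) ?_ v
  filter_upwards [(chartAt F x₀).open_target.mem_nhds ht] with z hz
  exact (chartAt F x₀).right_inv hz

theorem exists_section_of_submersion {f : N → P} (hf : IsSmoothSubmersion 𝓘(ℝ, F) 𝓘(ℝ, E) f)
    (x₀ : N) : ∃ s : P → N, ContMDiffAt 𝓘(ℝ, E) 𝓘(ℝ, F) ∞ s (f x₀) ∧ s (f x₀) = x₀ ∧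
      ∀ᶠ y in 𝓝 (f x₀), f (s y) = y := by
  let e := chartAt F x₀
  let e' := chartAt E (f x₀)
  let g : F → E := fun y => e' (f (e.symm y))
  have hx₀ : x₀ ∈ e.source := mem_chart_source F x₀
  have hfx₀ : f x₀ ∈ e'.source := mem_chart_source E (f x₀)
  have hg : ContDiffAt ℝ ∞ g (e x₀) := contDiffAt_charts hf.smooth.contMDiffAt
  have hgx : g (e x₀) = e' (f x₀) := by simp only [g, e.left_inv hx₀]
  have hsurj : Function.Surjective (fderiv ℝ g (e x₀)) := by
    intro w
    obtain ⟨ξ, hξ⟩ := hf.surjective_mfderiv x₀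
      (mfderiv 𝓘(ℝ, E) 𝓘(ℝ, E) e'.symm (e' (f x₀)) w : E)
    refine ⟨mfderiv 𝓘(ℝ, F) 𝓘(ℝ, F) e x₀ ξ, (fderiv_charts hf.smooth.contMDiffAt ξ).trans ?_⟩
    have h1 := chartAt_mfderiv_symm_self (F := E) (f x₀) w
    refine Eq.trans ?_ h1
    exact congrArg (fun u : E => (mfderiv 𝓘(ℝ, E) 𝓘(ℝ, E) e' (f x₀) u : E)) hξ
  obtain ⟨s, hs, hsx, hsy⟩ := exists_local_section hg hsurj
  rw [hgx] at hs hsx hsy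
  have he' : ContMDiffAt 𝓘(ℝ, E) 𝓘(ℝ, E) ∞ e' (f x₀) :=
    contMDiffOn_chart.contMDiffAt (e'.open_source.mem_nhds hfx₀)
  have h1 : ContMDiffAt 𝓘(ℝ, F) 𝓘(ℝ, F) ∞ e.symm (e x₀) :=
    contMDiffOn_chart_symm.contMDiffAt (e.open_target.mem_nhds (e.map_source hx₀))
  have hsmooth : ContMDiffAt 𝓘(ℝ, E) 𝓘(ℝ, F) ∞ (s ∘ e') (f x₀) :=
    (hs.contMDiffAt).comp (f x₀) he'
  have hss : (s ∘ e') (f x₀) = e x₀ := hsx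
  have hsmooth' : ContMDiffAt 𝓘(ℝ, E) 𝓘(ℝ, F) ∞ (e.symm ∘ s ∘ e') (f x₀) :=
    ContMDiffAt.comp_of_eq (x := f x₀) h1 hsmooth hss
  have hval : (e.symm ∘ s ∘ e') (f x₀) = x₀ := by
    simp only [Function.comp_apply, hsx, e.left_inv hx₀]
  refine ⟨e.symm ∘ s ∘ e', hsmooth', hval, ?_⟩
  have hcont : ContinuousAt (fun y => f ((e.symm ∘ s ∘ e') y)) (f x₀) :=
    ContinuousAt.comp_of_eq (g := f) hf.smooth.continuous.continuousAt hsmooth'.continuousAt hval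
  have h2 : ∀ᶠ y in 𝓝 (f x₀), f ((e.symm ∘ s ∘ e') y) ∈ e'.source := by
    refine hcont.eventually (p := fun z => z ∈ e'.source) ?_
    change e'.source ∈ 𝓝 (f ((e.symm ∘ s ∘ e') (f x₀)))
    rw [hval]
    exact e'.open_source.mem_nhds hfx₀
  filter_upwards [h2, e'.open_source.mem_nhds hfx₀,
    (e'.continuousAt hfx₀).eventually hsy] with y hy hy' hy''
  exact e'.injOn hy hy' hy''

end LocalSections

/-! ### The orbit map -/

section OrbitMap

variable {F : Type*} [NormedAddCommGroup F] [NormedSpace ℝ F] [FiniteDimensional ℝ F]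
  {H : Type*} [TopologicalSpace H] [ChartedSpace F H] [Group H] [LieGroup 𝓘(ℝ, F) ∞ H]
  {E : Type*} [NormedAddCommGroup E] [NormedSpace ℂ E] [FiniteDimensional ℂ E]
  {M : Type*} [TopologicalSpace M] [ChartedSpace E M] [IsManifold 𝓘(ℂ, E) ω M]
  [MulAction H M] [ContMDiffSMul 𝓘(ℝ, F) 𝓘(ℝ, E) ∞ H M]
  {d : ℕ} {V : Type*} [TopologicalSpace V] [ChartedSpace (EuclideanSpace ℝ (Fin d)) V]
  {j : V → M} {K : Subgroup H} {hK : ∀ v, MulAction.stabilizer H (j v) = K} {m : ℕ}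
  [ChartedSpace (EuclideanSpace ℝ (Fin m)) (H ⧸ K)]

theorem orbitMap_mk (h : H) (v : V) : orbitMap j K hK ((h : H ⧸ K), v) = h • j v := rfl

/-- With a smooth local section `s` of `H → H ⧸ K`, the map is locally `(x, v) ↦ s x • j v`. -/
theorem contMDiff_orbitMap (hj : ContMDiff (𝓡 d) 𝓘(ℝ, E) ∞ j) (hhom : IsHomogeneousSpace F K m) :
    ContMDiff ((𝓡 m).prod (𝓡 d)) 𝓘(ℝ, E) ∞ (orbitMap j K hK) := by
  have := hhom.isManifold
  rintro ⟨x, v⟩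
  obtain ⟨h, rfl⟩ := QuotientGroup.mk_surjective x
  obtain ⟨s, hs, -, hs'⟩ := exists_section_of_submersion hhom.submersion h
  have h1 : ContMDiffAt ((𝓡 m).prod (𝓡 d)) 𝓘(ℝ, F) ∞ (s ∘ Prod.fst) ((h : H ⧸ K), v) :=
    ContMDiffAt.comp (g := s) ((h : H ⧸ K), v) hs contMDiffAt_fst
  have h2 : ContMDiffAt ((𝓡 m).prod (𝓡 d)) 𝓘(ℝ, E) ∞ (j ∘ Prod.snd) ((h : H ⧸ K), v) :=
    hj.contMDiffAt.comp ((h : H ⧸ K), v) contMDiffAt_snd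
  have h3 := (contMDiff_smul_pair F E (H := H) (M := M)).contMDiffAt.comp ((h : H ⧸ K), v)
    (h1.prodMk h2)
  refine h3.congr_of_eventuallyEq ?_
  have h4 : ∀ᶠ y in 𝓝 ((h : H ⧸ K), v), ((s y.1 : H) : H ⧸ K) = y.1 :=
    (continuousAt_fst (p := ((h : H ⧸ K), v))).eventually
      (p := fun x => ((s x : H) : H ⧸ K) = x) hs'
  filter_upwards [h4] with y hy
  obtain ⟨y1, y2⟩ := y
  conv_lhs => rw [show (y1, y2) = (((s y1 : H) : H ⧸ K), y2) from Prod.ext hy.symm rfl]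
  rfl

/-- The differential of the orbit map. -/
theorem exists_mfderiv_orbitMap (hj : ContMDiff (𝓡 d) 𝓘(ℝ, E) ∞ j)
    (hhom : IsHomogeneousSpace F K m) (h : H) (v : V) :
    ∃ τ : EuclideanSpace ℝ (Fin m) →L[ℝ] F,
      (∀ (a : EuclideanSpace ℝ (Fin m)) (b : EuclideanSpace ℝ (Fin d)),
        (mfderiv ((𝓡 m).prod (𝓡 d)) 𝓘(ℝ, E) (orbitMap j K hK) ((h : H ⧸ K), v) (a, b) : E) =
          translationDeriv E h (j v) (fundamentalVF (H := H) (τ a) (j v) +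
            (mfderiv (𝓡 d) 𝓘(ℝ, E) j v b : E))) ∧
      ∀ a, (fundamentalVF (H := H) (τ a) (j v) : E) = 0 → a = 0 := by
  have := hhom.isManifold
  have : IsManifold 𝓘(ℝ, E) ∞ M := isManifold_real
  have : FiniteDimensional ℝ E := FiniteDimensional.complexToReal E
  have : IsManifold 𝓘(ℝ, F) ∞ H := inferInstance
  obtain ⟨s, hs, hsh, hs'⟩ := exists_section_of_submersion hhom.submersion h
  -- The section is translated back to pass through `1`, so that its differential `τ` takes values
  -- in the Lie algebra and only `L_h` remains outside.
  let t : H ⧸ K → H := fun x => h⁻¹ * s x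
  have ht1 : t h = 1 := by simp only [t, hsh, inv_mul_cancel]
  have ht : MDifferentiableAt (𝓡 m) 𝓘(ℝ, F) t (h : H ⧸ K) :=
    ((contMDiff_mul_left (I := 𝓘(ℝ, F)) (n := ∞) (a := h⁻¹)).contMDiffAt.comp (h : H ⧸ K)
      hs).mdifferentiableAt (by simp)
  let τ : EuclideanSpace ℝ (Fin m) →L[ℝ] F := mfderiv (𝓡 m) 𝓘(ℝ, F) t (h : H ⧸ K)
  have hht : ∀ᶠ x in 𝓝 (h : H ⧸ K), ((h * t x : H) : H ⧸ K) = x := by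
    filter_upwards [hs'] with x hx
    simpa [t] using hx
  refine ⟨τ, fun a b => ?_, fun a ha => ?_⟩
  · have hφ : MDifferentiableAt ((𝓡 m).prod (𝓡 d)) 𝓘(ℝ, E) (orbitMap j K hK) ((h : H ⧸ K), v) :=
      (contMDiff_orbitMap hj hhom).contMDiffAt.mdifferentiableAt (by simp)
    refine (mfderiv_prod_eq_add_apply (v := (a, b)) hφ).trans ?_
    have e1 : (mfderiv (𝓡 m) 𝓘(ℝ, E) (fun x => orbitMap j K hK (x, v)) (h : H ⧸ K) a : E) =
        translationDeriv E h (j v) (fundamentalVF (H := H) (τ a) (j v)) := by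
      have h1 : (fun x => orbitMap j K hK (x, v)) =ᶠ[𝓝 (h : H ⧸ K)]
          (fun q => h • q) ∘ (fun g : H => g • j v) ∘ t := by
        filter_upwards [hht] with x hx
        have h2 : orbitMap j K hK (x, v) = orbitMap j K hK (((h * t x : H) : H ⧸ K), v) := by
          rw [hx]
        rw [h2, orbitMap_mk, mul_smul]
        rfl
      have h3 : MDifferentiableAt (𝓡 m) 𝓘(ℝ, E) ((fun g : H => g • j v) ∘ t) (h : H ⧸ K) :=
        (mdifferentiableAt_orbit F E (j v) _).comp _ ht
      have h4 := mfderiv_comp_apply_of_eq (h : H ⧸ K)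
        (mdifferentiableAt_translation F E h (j v)) h3
        (by simp only [Function.comp_apply, ht1, one_smul]) a
      have h5 := mfderiv_comp_apply_of_eq (h : H ⧸ K)
        (mdifferentiableAt_orbit F E (j v) 1) ht ht1 a
      have h6 := congrArg (fun A : EuclideanSpace ℝ (Fin m) →L[ℝ] E => A a)
        (h1.mfderiv_eq (I := 𝓡 m) (I' := 𝓘(ℝ, E)))
      exact (h6.trans h4).trans (congrArg (translationDeriv E h (j v)) h5)
    have e2 : (mfderiv (𝓡 d) 𝓘(ℝ, E) (fun z => orbitMap j K hK ((h : H ⧸ K), z)) v b : E) =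
        translationDeriv E h (j v) (mfderiv (𝓡 d) 𝓘(ℝ, E) j v b : E) :=
      mfderiv_comp_apply (g := fun q : M => h • q) (I' := 𝓘(ℝ, E)) v
        (mdifferentiableAt_translation F E h (j v))
        (hj.contMDiffAt.mdifferentiableAt (by simp)) b
    exact (congrArg₂ (fun x y : E => x + y) e1 e2).trans (map_add _ _ _).symm
  · have hex := exists_cosetSlice (F := F) (H := H) (E := E) (j v)
    rw [hK v] at hex
    obtain ⟨m', S, hS⟩ := hex
    have hr0 := hS (τ a) ha
    have hr : MDifferentiableAt 𝓘(ℝ, F) (𝓡 m') S.r 1 :=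
      (S.smooth_r.contMDiffAt (S.isOpen_U.mem_nhds S.one_mem)).mdifferentiableAt (by simp)
    have hσ : MDifferentiableAt (𝓡 m') 𝓘(ℝ, F) S.σ (S.r 1) :=
      (S.smooth_σ.contMDiffAt (S.isOpen_B.mem_nhds (S.mapsTo_r S.one_mem))).mdifferentiableAt
        (by simp)
    let π : H → H ⧸ K := fun g => ((h * g : H) : H ⧸ K)
    have hπ : ∀ g, MDifferentiableAt 𝓘(ℝ, F) (𝓡 m) π g := fun g =>
      ((hhom.submersion.smooth.comp (contMDiff_mul_left (I := 𝓘(ℝ, F)) (n := ∞)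
        (a := h))).contMDiffAt).mdifferentiableAt (by simp)
    have h1 := mfderiv_leftInverse (I₁ := 𝓡 m) (I₂ := 𝓘(ℝ, F)) ht1 ht (hπ 1) hht a
    have h2 : π =ᶠ[𝓝 1] (π ∘ S.σ) ∘ S.r := by
      filter_upwards [S.isOpen_U.mem_nhds S.one_mem] with u hu
      have h3 : S.σ (S.r u) ∈ S.U := S.mapsTo_σ (S.mapsTo_r hu)
      refine QuotientGroup.eq.2 ?_
      have h4 : (h * u)⁻¹ * (h * S.σ (S.r u)) = u⁻¹ * S.σ (S.r u) := by group
      rw [h4, S.mem_iff u hu _ h3, S.r_σ _ (S.mapsTo_r hu)]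
    have h5 := congrArg (fun A : F →L[ℝ] EuclideanSpace ℝ (Fin m) => A (τ a))
      (h2.mfderiv_eq (I := 𝓘(ℝ, F)) (I' := 𝓡 m))
    have h6 : MDifferentiableAt (𝓡 m') (𝓡 m) (π ∘ S.σ) (S.r 1) := (hπ _).comp _ hσ
    have h7 := mfderiv_comp_apply (1 : H) h6 hr (τ a)
    have h8 : (mfderiv (𝓡 m') (𝓡 m) (π ∘ S.σ) (S.r 1)
        (mfderiv 𝓘(ℝ, F) (𝓡 m') S.r 1 (τ a)) : EuclideanSpace ℝ (Fin m)) = 0 :=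
      (congrArg (fun w : EuclideanSpace ℝ (Fin m') => (mfderiv (𝓡 m') (𝓡 m) (π ∘ S.σ) (S.r 1) w :
        EuclideanSpace ℝ (Fin m))) hr0).trans (map_zero _)
    exact h1.symm.trans ((h5.trans h7).trans h8)

end OrbitMap

/-! ### Local retractions onto immersed and embedded submanifolds -/

section LocalRetraction

variable {F : Type*} [NormedAddCommGroup F] [NormedSpace ℝ F] [FiniteDimensional ℝ F]
  {E : Type*} [NormedAddCommGroup E] [NormedSpace ℝ E] [FiniteDimensional ℝ E]
  {N : Type*} [TopologicalSpace N] [ChartedSpace F N] [IsManifold 𝓘(ℝ, F) ∞ N]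
  {P : Type*} [TopologicalSpace P] [ChartedSpace E P] [IsManifold 𝓘(ℝ, E) ∞ P]

/-- For a linear left inverse `T` of the differential, `T ∘ f` has identity differential at `x₀`;
its local inverse after `T` is the retraction. -/
theorem exists_retraction_of_injective_fderiv {f : F → E} {x₀ : F} (hf : ContDiffAt ℝ ∞ f x₀)
    (hinj : Function.Injective (fderiv ℝ f x₀)) :
    ∃ r : E → F, DifferentiableAt ℝ r (f x₀) ∧ ∀ᶠ x in 𝓝 x₀, r (f x) = x := by
  obtain ⟨T₀, hT₀⟩ := (fderiv ℝ f x₀).toLinearMap.exists_leftInverse_of_injective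
    (LinearMap.ker_eq_bot.2 hinj)
  let T : E →L[ℝ] F := T₀.toContinuousLinearMap
  have hT : ∀ v, T (fderiv ℝ f x₀ v) = v := fun v => congrArg (fun g => g v) hT₀
  have h1 : HasStrictFDerivAt (fun x => T (f x))
      ((ContinuousLinearEquiv.refl ℝ F : F ≃L[ℝ] F) : F →L[ℝ] F) x₀ := by
    have h2 := T.hasStrictFDerivAt.comp x₀ (hf.hasStrictFDerivAt (by simp))
    convert h2 using 1
    ext v
    exact (hT v).symm
  refine ⟨fun y => h1.localInverse _ _ _ (T y), ?_, h1.eventually_left_inverse⟩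
  exact DifferentiableAt.comp (g := h1.localInverse _ _ _) (f x₀)
    h1.to_localInverse.hasFDerivAt.differentiableAt T.differentiableAt

/-- An immersion has a local left inverse. -/
theorem exists_retraction_of_immersion {f : N → P} {x₀ : N}
    (hf : ContMDiffAt 𝓘(ℝ, F) 𝓘(ℝ, E) ∞ f x₀)
    (hinj : Function.Injective (mfderiv 𝓘(ℝ, F) 𝓘(ℝ, E) f x₀)) :
    ∃ r : P → N, MDifferentiableAt 𝓘(ℝ, E) 𝓘(ℝ, F) r (f x₀) ∧ ∀ᶠ x in 𝓝 x₀, r (f x) = x := by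
  have : IsManifold 𝓘(ℝ, F) 1 N := IsManifold.of_le (n := ∞) (by simp)
  have : IsManifold 𝓘(ℝ, E) 1 P := IsManifold.of_le (n := ∞) (by simp)
  let e := chartAt F x₀
  let e' := chartAt E (f x₀)
  let g : F → E := fun y => e' (f (e.symm y))
  have hx₀ : x₀ ∈ e.source := mem_chart_source F x₀
  have hfx₀ : f x₀ ∈ e'.source := mem_chart_source E (f x₀)
  have hg : ContDiffAt ℝ ∞ g (e x₀) := contDiffAt_charts hf
  have hgx : g (e x₀) = e' (f x₀) := by simp only [g, e.left_inv hx₀]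
  have hgd : Function.Injective (fderiv ℝ g (e x₀)) := by
    rw [injective_iff_map_eq_zero]
    intro v hv
    let u : F := mfderiv 𝓘(ℝ, F) 𝓘(ℝ, F) e.symm (e x₀) v
    have h1 : (mfderiv 𝓘(ℝ, F) 𝓘(ℝ, F) e x₀ u : F) = v := chartAt_mfderiv_symm_self x₀ v
    have h2 := fderiv_charts hf u
    have h3 : (mfderiv 𝓘(ℝ, E) 𝓘(ℝ, E) e' (f x₀)
        (mfderiv 𝓘(ℝ, F) 𝓘(ℝ, E) f x₀ u : E) : E) = 0 := by
      refine h2.symm.trans (Eq.trans ?_ hv)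
      exact congrArg (fderiv ℝ g (e x₀)) h1
    have h4 := mfderiv_leftInverse (I₁ := 𝓘(ℝ, E)) (I₂ := 𝓘(ℝ, E)) (f := e') (g := e'.symm)
      (x := f x₀) rfl
      (mdifferentiableAt_atlas (chart_mem_atlas E (f x₀)) hfx₀)
      (mdifferentiableAt_atlas_symm (chart_mem_atlas E (f x₀)) (e'.map_source hfx₀))
      (by filter_upwards [e'.open_source.mem_nhds hfx₀] with z hz using e'.left_inv hz)
      (mfderiv 𝓘(ℝ, F) 𝓘(ℝ, E) f x₀ u)
    have h5 : (mfderiv 𝓘(ℝ, F) 𝓘(ℝ, E) f x₀ u : E) = 0 := by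
      refine h4.symm.trans ?_
      exact (congrArg (fun w : E => (mfderiv 𝓘(ℝ, E) 𝓘(ℝ, E) e'.symm (e' (f x₀)) w : E)) h3).trans
        (map_zero _)
    have h6 : u = 0 := hinj (h5.trans (map_zero (mfderiv 𝓘(ℝ, F) 𝓘(ℝ, E) f x₀)).symm)
    rw [← h1, h6]
    exact map_zero (mfderiv 𝓘(ℝ, F) 𝓘(ℝ, F) e x₀)
  obtain ⟨r, hr, hr'⟩ := exists_retraction_of_injective_fderiv hg hgd
  rw [hgx] at hr
  have hre : r (e' (f x₀)) = e x₀ := by rw [← hgx]; exact hr'.self_of_nhds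
  refine ⟨e.symm ∘ r ∘ e', ?_, ?_⟩
  · have h1 : MDifferentiableAt 𝓘(ℝ, E) 𝓘(ℝ, F) (r ∘ e') (f x₀) :=
      hr.mdifferentiableAt.comp (f x₀) (mdifferentiableAt_atlas (chart_mem_atlas E (f x₀)) hfx₀)
    exact MDifferentiableAt.comp_of_eq (g := e.symm) (f := r ∘ e') (f x₀) (y := e x₀)
      (mdifferentiableAt_atlas_symm (chart_mem_atlas F x₀) (e.map_source hx₀)) h1 hre
  · filter_upwards [(e.continuousAt hx₀).eventually hr', e.open_source.mem_nhds hx₀] with x hx hxs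
    simp only [g, e.left_inv hxs] at hx
    simp only [Function.comp_apply, hx, e.left_inv hxs]

/-- The tangent spaces of a submanifold contained in an embedded submanifold `N` are contained
in those of `N`. -/
theorem exists_mfderiv_eq_of_range_subset {G : Type*} [NormedAddCommGroup G] [NormedSpace ℝ G]
    {V : Type*} [TopologicalSpace V] [ChartedSpace G V] {f : N → P} {j : V → P}
    (hf : IsSubmanifoldEmbedding 𝓘(ℝ, F) 𝓘(ℝ, E) f) (hj : ContMDiff 𝓘(ℝ, G) 𝓘(ℝ, E) ∞ j)
    (hsub : range j ⊆ range f) {x : N} {v : V} (hxv : f x = j v) (b : G) :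
    ∃ a : F, (mfderiv 𝓘(ℝ, G) 𝓘(ℝ, E) j v b : E) = mfderiv 𝓘(ℝ, F) 𝓘(ℝ, E) f x a := by
  -- The lift of `j` through `f` is only a map of sets so far. Because `f` is an embedding, `k` is
  -- continuous, hence stays where the local retraction works and equals the differentiable map `r ∘
  -- j`.
  choose k hk using fun v => hsub (mem_range_self v)
  have hfk : f ∘ k = j := funext hk
  have hkv : k v = x := hf.embedding.injective ((hk v).trans hxv.symm)
  have hkc : Continuous k := by
    rw [hf.embedding.isInducing.continuous_iff, hfk]
    exact hj.continuous
  obtain ⟨r, hr, hr'⟩ := exists_retraction_of_immersion (hf.immersion.smooth.contMDiffAt (x := x))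
    (hf.immersion.injective_mfderiv x)
  have hkd : MDifferentiableAt 𝓘(ℝ, G) 𝓘(ℝ, F) k v := by
    have h1 : MDifferentiableAt 𝓘(ℝ, G) 𝓘(ℝ, F) (r ∘ j) v :=
      MDifferentiableAt.comp_of_eq (g := r) (f := j) v hr
        (hj.contMDiffAt.mdifferentiableAt (by simp)) hxv.symm
    refine h1.congr_of_eventuallyEq ?_
    have h2 : Tendsto k (𝓝 v) (𝓝 x) := hkv ▸ hkc.continuousAt
    filter_upwards [h2.eventually hr'] with u hu
    simp only [Function.comp_apply, ← hk u, hu]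
  have h1 := mfderiv_comp_apply_of_eq v ((hf.immersion.smooth.contMDiffAt (x := x)).mdifferentiableAt
    (by simp)) hkd hkv b
  refine ⟨mfderiv 𝓘(ℝ, G) 𝓘(ℝ, F) k v b, Eq.trans ?_ h1⟩
  rw [hfk]

end LocalRetraction

/-! ### Rotating part of a Lagrangian subspace by a right angle -/

section LagrangianFrame

variable {E : Type*} [NormedAddCommGroup E] [NormedSpace ℂ E] [FiniteDimensional ℂ E]
  {A : Type*} [AddCommGroup A] [Module ℝ A] [FiniteDimensional ℝ A]
  {P : Type*} [AddCommGroup P] [Module ℝ P] [FiniteDimensional ℝ P]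
  {Q : Type*} [AddCommGroup Q] [Module ℝ Q] [FiniteDimensional ℝ Q]
  {B : E →L[ℝ] E →L[ℝ] ℝ} {D : A →ₗ[ℝ] E} {S : P →ₗ[ℝ] E} {J : Q →ₗ[ℝ] E} {n : ℕ}

theorem exists_linear_factor {D : A →ₗ[ℝ] E} (hD : Function.Injective D) {S : P →ₗ[ℝ] E}
    (h : ∀ a, ∃ c, S a = D c) : ∃ T : P →ₗ[ℝ] A, ∀ a, S a = D (T a) := by
  obtain ⟨D', hD'⟩ := D.exists_leftInverse_of_injective (LinearMap.ker_eq_bot.2 hD)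
  refine ⟨D' ∘ₗ S, fun a => ?_⟩
  obtain ⟨c, hc⟩ := h a
  have h1 : D' (D c) = c := congrArg (fun g => g c) hD'
  rw [LinearMap.comp_apply, hc, h1]

/-- Rotating the normal component `S` of a sum `S + J`, where `S` is orthogonal to a Lagrangian
subspace `D(A)` and `J` maps into `D(A)`. -/
theorem exists_lagrangian_frame (hcomp : ∀ u v, B (Complex.I • u) (Complex.I • v) = B u v)
    (hpos : ∀ u, u ≠ 0 → 0 < B u (Complex.I • u)) (hskew : ∀ u v, B u v = - B v u)
    (hdim : finrank ℝ A = finrank ℂ E) (hD : Function.Injective D)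
    (hiso : ∀ a b, B (D a) (D b) = 0) (hS : ∀ a c, B (S a) (Complex.I • D c) = 0)
    (hJ : ∀ b, ∃ c, J b = D c) (hSJ : ∀ a b, B (S a) (J b) = 0)
    (hS0 : ∀ a, S a = 0 → a = 0) (hJ0 : ∀ b, J b = 0 → b = 0)
    (hPQ : finrank ℝ P + finrank ℝ Q = n) (α : E [⋀^Fin n]→ₗ[ℂ] ℂ) :
    ∃ T : P × Q →ₗ[ℝ] A,
      (∀ x y : P × Q, B (S x.1 + J x.2) (S y.1 + J y.2) = 0) ∧
      (∀ x : P × Q, S x.1 + J x.2 = 0 → x = 0) ∧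
      (∀ x y : P × Q, B (S x.1 + J x.2) (Complex.I • (S y.1 + J y.2)) =
        B (D (T x)) (Complex.I • D (T y))) ∧
      ∀ w : Fin n → P × Q, α (fun i => S (w i).1 + J (w i).2) =
        Complex.I ^ finrank ℝ P * α (fun i => D (T (w i))) := by
  have hII : ∀ u : E, Complex.I • Complex.I • u = -u := fun u => by
    rw [smul_smul, Complex.I_mul_I, neg_one_smul]
  obtain ⟨J', hJ'⟩ := exists_linear_factor hD hJ
  obtain ⟨S', hS'⟩ := exists_linear_factor (S := -((Complex.I • (LinearMap.id : E →ₗ[ℝ] E)) ∘ₗ S))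
    hD (fun a => by
      obtain ⟨b, hb⟩ := exists_eq_I_smul_of_perp hcomp hpos hdim hD hiso (hS a)
      refine ⟨b, ?_⟩
      simp [hb, hII])
  replace hS' : ∀ a, S a = Complex.I • D (S' a) := fun a => by
    rw [← hS' a]
    simp [hII]
  -- With `S = I D S'`, the hypothesis `ω(S, J) = 0` becomes `g`-orthogonality of `D S'` and `J`
  -- inside `D(A)`. This cancels the mixed terms in the computations of isotropy and of the Gram
  -- matrix.
  have c1 : ∀ a b, B (D (S' a)) (Complex.I • D (J' b)) = 0 := fun a b => by
    rw [← hcomp, ← hS', hII, map_neg, ← hJ', hSJ, neg_zero]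
  have c2 : ∀ a b, B (D (J' b)) (Complex.I • D (S' a)) = 0 := fun a b => by
    rw [← hS', ← hJ', hskew, hSJ, neg_zero]
  have c3 : ∀ a b, B (Complex.I • D a) (D b) = - B (D a) (Complex.I • D b) := fun a b => by
    rw [← hcomp, hII, map_neg, neg_apply]
  refine ⟨S'.coprod J', fun x y => ?_, fun x hx => ?_, fun x y => ?_, fun w => ?_⟩
  · simp only [map_add, add_apply, hS', hJ', hcomp, hiso, c3, c1, c2]
    simp
  · have h1 : S x.1 = D (-(J' x.2)) := by
      rw [map_neg, ← hJ', ← eq_neg_of_add_eq_zero_left hx]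
    have ha : S x.1 = 0 := by
      by_contra hne
      have h2 := hS x.1 (-(J' x.2))
      rw [← h1] at h2
      exact (hpos _ hne).ne' h2
    have hb : J x.2 = 0 := by simpa [ha] using hx
    exact Prod.ext (hS0 _ ha) (hJ0 _ hb)
  · simp only [LinearMap.coprod_apply, smul_add, map_add, add_apply, hS', hJ',
      hcomp, hiso, c1, c2, c3, hII, map_neg]
    simp
  · have h1 := alternating_scale α (D ∘ₗ S') (D ∘ₗ J') Complex.I hPQ w
    simp only [LinearMap.comp_apply] at h1
    simp only [hS', hJ', LinearMap.coprod_apply, map_add]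
    exact h1

end LagrangianFrame

/-! ### The Lagrangian angle of the orbit map -/

section Angle

variable {F : Type*} [NormedAddCommGroup F] [NormedSpace ℝ F]
  {H : Type*} [TopologicalSpace H] [ChartedSpace F H] [Group H]
  {E : Type*} [NormedAddCommGroup E] [NormedSpace ℂ E]
  {M : Type*} [TopologicalSpace M] [ChartedSpace E M] [MulAction H M]
  {n : ℕ} {X : CalabiYau E M n} {μ : M → GroupLieAlgebra 𝓘(ℝ, F) H →L[ℝ] ℝ}

theorem kahlerBilin_translationDeriv [LieGroup 𝓘(ℝ, F) ∞ H] [ConnectedSpace H]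
    [IsManifold 𝓘(ℂ, E) ω M] [ContMDiffSMul 𝓘(ℝ, F) 𝓘(ℝ, E) ∞ H M] (hμ : IsMomentMap X μ) (h : H)
    (p : M) (u v : E) : X.kahlerBilin (h • p) (translationDeriv E h p u)
      (translationDeriv E h p v) = X.kahlerBilin p u v := by
  rw [kahlerBilin_apply, kahlerBilin_apply]
  exact kahler_translation hμ h p u v

theorem translationDeriv_I (hI : PreservesComplexStructure H E M) (h : H) (p : M) (u : E) :
    translationDeriv E h p (Complex.I • u) = Complex.I • translationDeriv E h p u :=
  hI h p u

theorem translationDeriv_eq_zero [LieGroup 𝓘(ℝ, F) ∞ H] [ConnectedSpace H]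
    [IsManifold 𝓘(ℂ, E) ω M] [ContMDiffSMul 𝓘(ℝ, F) 𝓘(ℝ, E) ∞ H M] (hμ : IsMomentMap X μ) {h : H}
    {p : M} {u : E} (hu : translationDeriv E h p u = 0) : u = 0 := by
  by_contra hne
  have h1 := kahlerBilin_pos X p u hne
  rw [← kahlerBilin_translationDeriv hμ h, hu, map_zero] at h1
  exact lt_irrefl _ h1

/-- A family of tangent vectors `R x` at `p` that spans a Lagrangian subspace and is obtained from
a Lagrangian subspace `D(ℝⁿ)` by rotating `m` orthogonal directions by a right angle. -/
structure IsRotatedFrame {W : Type*} [AddCommGroup W] [Module ℝ W] (X : CalabiYau E M n) (p : M)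
    (m : ℕ) (D : EuclideanSpace ℝ (Fin n) →L[ℝ] E) (R : W → E)
    (T : W →ₗ[ℝ] EuclideanSpace ℝ (Fin n)) : Prop where
  isotropic : ∀ x y, X.kahlerBilin p (R x) (R y) = 0
  injective : ∀ x, R x = 0 → x = 0
  gram : ∀ x y, X.kahlerBilin p (R x) (Complex.I • R y) =
    X.kahlerBilin p (D (T x)) (Complex.I • D (T y))
  volume : ∀ w : Fin n → W, X.volumeForm p (fun i => R (w i)) =
    Complex.I ^ m * X.volumeForm p (fun i => D (T (w i)))

variable {L : Type*} [TopologicalSpace L] [ChartedSpace (EuclideanSpace ℝ (Fin n)) L]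
  {ι : L → M} {d : ℕ} {V : Type*} [TopologicalSpace V] [ChartedSpace (EuclideanSpace ℝ (Fin d)) V]
  {j : V → M} {K : Subgroup H} {hK : ∀ v, MulAction.stabilizer H (j v) = K} {m : ℕ}
  [ChartedSpace (EuclideanSpace ℝ (Fin m)) (H ⧸ K)]

/-- The fundamental vector fields lie in `I T L` where they are perpendicular to `L`. -/
theorem kahlerBilin_fundamentalVF_eq_zero [FiniteDimensional ℂ E] (hn : finrank ℂ E = n)
    (hL : X.IsLagrangianImmersion (𝓡 n) ι) {l : L}
    (hperp : ∀ (ξ : GroupLieAlgebra 𝓘(ℝ, F) H) (u : TangentSpace (𝓡 n) l),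
      X.metric (ι l) (fundamentalVF ξ (ι l)) (mfderiv (𝓡 n) 𝓘(ℝ, E) ι l u) = 0) (ξ η : F) :
    X.kahlerBilin (ι l) (fundamentalVF (H := H) ξ (ι l)) (fundamentalVF (H := H) η (ι l)) = 0 := by
  let D : EuclideanSpace ℝ (Fin n) →L[ℝ] E := mfderiv (𝓡 n) 𝓘(ℝ, E) ι l
  have hD : Function.Injective (D : EuclideanSpace ℝ (Fin n) →ₗ[ℝ] E) :=
    hL.immersion.injective_mfderiv l
  have hiso : ∀ a b, X.kahlerBilin (ι l) (D a) (D b) = 0 := fun a b =>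
    (kahlerBilin_apply X (ι l) (D a) (D b)).trans (hL.isotropic l a b)
  have h1 : ∀ ξ : F, ∃ b, (fundamentalVF (H := H) ξ (ι l) : E) = Complex.I • D b := fun ξ =>
    exists_eq_I_smul_of_perp (kahlerBilin_I_I X (ι l)) (kahlerBilin_pos X (ι l))
      (by simp [hn]) hD hiso fun a => (metric_eq X (ι l) _ (D a)).symm.trans (hperp ξ a)
  obtain ⟨a, ha⟩ := h1 ξ
  obtain ⟨b, hb⟩ := h1 η
  rw [ha, hb, kahlerBilin_I_I, hiso]

/-- The differential of the orbit map is the translate of a rotated frame of `L`. -/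
theorem exists_rotatedFrame [FiniteDimensional ℝ F] [LieGroup 𝓘(ℝ, F) ∞ H]
    [FiniteDimensional ℂ E] [IsManifold 𝓘(ℂ, E) ω M] [ContMDiffSMul 𝓘(ℝ, F) 𝓘(ℝ, E) ∞ H M]
    [IsManifold (𝓡 n) ∞ L]
    (hn : finrank ℂ E = n) (hμ : IsMomentMap X μ)
    (hι : IsSubmanifoldEmbedding (𝓡 n) 𝓘(ℝ, E) ι) (hL : X.IsLagrangianImmersion (𝓡 n) ι)
    {c : GroupLieAlgebra 𝓘(ℝ, F) H →L[ℝ] ℝ} (hj : IsSmoothImmersion (𝓡 d) 𝓘(ℝ, E) j)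
    (hVμ : ∀ v, μ (j v) = c) (hVL : range j ⊆ range ι) (hhom : IsHomogeneousSpace F K m)
    (hmd : m + d = n) {l : L} {v : V} (hl : ι l = j v)
    (hperp : ∀ (ξ : GroupLieAlgebra 𝓘(ℝ, F) H) (u : TangentSpace (𝓡 n) l),
      X.metric (ι l) (fundamentalVF ξ (ι l)) (mfderiv (𝓡 n) 𝓘(ℝ, E) ι l u) = 0) (h : H) :
    ∃ (R : EuclideanSpace ℝ (Fin m) × EuclideanSpace ℝ (Fin d) → E)
      (T : EuclideanSpace ℝ (Fin m) × EuclideanSpace ℝ (Fin d) →ₗ[ℝ] EuclideanSpace ℝ (Fin n)),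
      IsRotatedFrame X (j v) m (mfderiv (𝓡 n) 𝓘(ℝ, E) ι l) R T ∧
      ∀ x, (mfderiv ((𝓡 m).prod (𝓡 d)) 𝓘(ℝ, E) (orbitMap j K hK) ((h : H ⧸ K), v) x : E) =
        translationDeriv E h (j v) (R x) := by
  have : IsManifold 𝓘(ℝ, E) ∞ M := isManifold_real
  have : FiniteDimensional ℝ E := FiniteDimensional.complexToReal E
  obtain ⟨τ, hτ, hτ0⟩ := exists_mfderiv_orbitMap (hK := hK) hj.smooth hhom h v
  let D : EuclideanSpace ℝ (Fin n) →L[ℝ] E := mfderiv (𝓡 n) 𝓘(ℝ, E) ι l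
  let J : EuclideanSpace ℝ (Fin d) →L[ℝ] E := mfderiv (𝓡 d) 𝓘(ℝ, E) j v
  let O : F →L[ℝ] E := mfderiv 𝓘(ℝ, F) 𝓘(ℝ, E) (fun h : H => h • j v) 1
  have hD : Function.Injective (D : EuclideanSpace ℝ (Fin n) →ₗ[ℝ] E) :=
    hL.immersion.injective_mfderiv l
  have hiso : ∀ a b, X.kahlerBilin (j v) (D a) (D b) = 0 := fun a b => by
    rw [← hl]
    exact (kahlerBilin_apply X (ι l) (D a) (D b)).trans (hL.isotropic l a b)
  have hS : ∀ ξ c, X.kahlerBilin (j v) (O ξ) (Complex.I • D c) = 0 := fun ξ c => by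
    have h1 : ∀ q, q = j v → X.kahlerBilin q (fundamentalVF (H := H) ξ q) (Complex.I • D c) = 0 →
        X.kahlerBilin (j v) (O ξ) (Complex.I • D c) = 0 := by
      rintro _ rfl h2; exact h2
    exact h1 _ hl ((metric_eq X (ι l) _ (D c)).symm.trans (hperp ξ c))
  -- The moment map is constant along `V`, so `ω(ξ^#, ·) = -d⟨μ, ξ⟩` vanishes on its tangent
  -- vectors.
  have hSJ : ∀ ξ b, X.kahlerBilin (j v) (O ξ) (J b) = 0 := fun ξ b => by
    have h1 := hμ.differential (j v) ξ (J b)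
    have h2 := mfderiv_comp_apply (g := fun q => μ q ξ) (I' := 𝓘(ℝ, E)) (I'' := 𝓘(ℝ, ℝ)) v
      ((hμ.smooth ξ).contMDiffAt.mdifferentiableAt (by simp))
      (hj.smooth.contMDiffAt.mdifferentiableAt (by simp)) b
    have h3 : (fun q => μ q ξ) ∘ j = fun _ => c ξ := by
      funext v
      simp only [Function.comp_apply, hVμ]
    rw [h3, mfderiv_const] at h2
    have h4 : X.kahler (j v) ![fundamentalVF (H := H) ξ (j v), J b] = 0 :=
      neg_eq_zero.1 (h1.symm.trans h2.symm)
    exact (kahlerBilin_apply X (j v) (O ξ) (J b)).trans h4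
  obtain ⟨T, h1, h2, h3, h4⟩ := exists_lagrangian_frame
    (B := X.kahlerBilin (j v)) (D := (D : EuclideanSpace ℝ (Fin n) →ₗ[ℝ] E))
    (S := (O ∘L τ : EuclideanSpace ℝ (Fin m) →ₗ[ℝ] E))
    (J := (J : EuclideanSpace ℝ (Fin d) →ₗ[ℝ] E)) (n := n)
    (kahlerBilin_I_I X (j v)) (kahlerBilin_pos X (j v)) (kahlerBilin_swap X (j v)) (by simp [hn])
    hD hiso (fun a c => hS (τ a) c)
    (fun b => exists_mfderiv_eq_of_range_subset hι hj.smooth hVL hl b) (fun a b => hSJ (τ a) b)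
    hτ0 (fun b hb => hj.injective_mfderiv v (hb.trans (map_zero (mfderiv (𝓡 d) 𝓘(ℝ, E) j v)).symm))
    (by simpa using hmd) (X.volumeForm (j v))
  refine ⟨fun x => O (τ x.1) + J x.2, T, ⟨h1, h2, h3, fun w => ?_⟩, fun x => hτ x.1 x.2⟩
  have h5 := h4 w
  rw [finrank_euclideanSpace_fin] at h5
  exact h5

/-- The differential at `(hK, v)` is `dL_h` applied to a rotated frame. Since `dL_h` preserves `ω`
it preserves isotropy, and it is injective because `ω` is positive on complex lines. -/
theorem isLagrangianImmersion_orbitMap [FiniteDimensional ℝ F] [LieGroup 𝓘(ℝ, F) ∞ H]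
    [ConnectedSpace H] [FiniteDimensional ℂ E] [IsManifold 𝓘(ℂ, E) ω M]
    [ContMDiffSMul 𝓘(ℝ, F) 𝓘(ℝ, E) ∞ H M] (hμ : IsMomentMap X μ)
    (hj : ContMDiff (𝓡 d) 𝓘(ℝ, E) ∞ j) (hhom : IsHomogeneousSpace F K m) (hmd : m + d = n)
    (hframe : ∀ (h : H) (v : V), ∃ (D : EuclideanSpace ℝ (Fin n) →L[ℝ] E)
      (R : EuclideanSpace ℝ (Fin m) × EuclideanSpace ℝ (Fin d) → E)
      (T : EuclideanSpace ℝ (Fin m) × EuclideanSpace ℝ (Fin d) →ₗ[ℝ] EuclideanSpace ℝ (Fin n)),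
      IsRotatedFrame X (j v) m D R T ∧
      ∀ x, (mfderiv ((𝓡 m).prod (𝓡 d)) 𝓘(ℝ, E) (orbitMap j K hK) ((h : H ⧸ K), v) x : E) =
        translationDeriv E h (j v) (R x)) :
    X.IsLagrangianImmersion ((𝓡 m).prod (𝓡 d)) (orbitMap j K hK) := by
  refine ⟨⟨contMDiff_orbitMap hj hhom, ?_⟩, ?_, ?_⟩
  · rintro ⟨x, v⟩
    obtain ⟨h, rfl⟩ := QuotientGroup.mk_surjective x
    obtain ⟨D, R, T, hR, hd⟩ := hframe h v
    refine (injective_iff_map_eq_zero _).2 fun x hx => hR.injective x ?_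
    exact translationDeriv_eq_zero hμ ((hd x).symm.trans hx)
  · rintro ⟨x, v⟩ a b
    obtain ⟨h, rfl⟩ := QuotientGroup.mk_surjective x
    obtain ⟨D, R, T, hR, hd⟩ := hframe h v
    refine (kahlerBilin_apply X (h • j v) _ _).symm.trans ?_
    rw [hd a, hd b, kahlerBilin_translationDeriv hμ]
    exact hR.isotropic a b
  · simpa using hmd

/-- The Lagrangian angle of the orbit map. -/
theorem isAngleAt_orbitMap [LieGroup 𝓘(ℝ, F) ∞ H] [ConnectedSpace H] [FiniteDimensional ℂ E]
    [IsManifold 𝓘(ℂ, E) ω M] [ContMDiffSMul 𝓘(ℝ, F) 𝓘(ℝ, E) ∞ H M]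
    (hI : PreservesComplexStructure H E M) (hμ : IsMomentMap X μ) {h : H} {v : V} {l : L}
    (hl : ι l = j v) {R : EuclideanSpace ℝ (Fin m) × EuclideanSpace ℝ (Fin d) → E}
    {T : EuclideanSpace ℝ (Fin m) × EuclideanSpace ℝ (Fin d) →ₗ[ℝ] EuclideanSpace ℝ (Fin n)}
    (hR : IsRotatedFrame X (j v) m (mfderiv (𝓡 n) 𝓘(ℝ, E) ι l) R T)
    (hd : ∀ x, (mfderiv ((𝓡 m).prod (𝓡 d)) 𝓘(ℝ, E) (orbitMap j K hK) ((h : H ⧸ K), v) x : E) =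
        translationDeriv E h (j v) (R x)) {α θ : ℝ}
    (hscale : ScalesVolumeForm X h (Complex.exp (α * Complex.I)))
    (hθ : X.IsAngleAt (𝓡 n) ι l θ) :
    X.IsAngleAt ((𝓡 m).prod (𝓡 d)) (orbitMap j K hK) ((h : H ⧸ K), v)
      (α + θ - Real.pi / 2 * m) := by
  obtain ⟨vol, hvol, hΩ⟩ := hθ
  let D : EuclideanSpace ℝ (Fin n) →L[ℝ] E := mfderiv (𝓡 n) 𝓘(ℝ, E) ι l
  let volL : EuclideanSpace ℝ (Fin n) [⋀^Fin n]→L[ℝ] ℝ := vol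
  -- Rotation by `I` gives the factor `i ^ m`, whereas the angle `-πm/2` stands for `(-i) ^ m`. The
  -- difference `(-1) ^ m` is a change of orientation and is absorbed into the volume form.
  let vol' : (EuclideanSpace ℝ (Fin m) × EuclideanSpace ℝ (Fin d)) [⋀^Fin n]→L[ℝ] ℝ :=
    (-1 : ℝ) ^ m • volL.compContinuousLinearMap (LinearMap.toContinuousLinearMap T)
  have hvol' : ∀ w, vol' w = (-1) ^ m * volL (fun i => T (w i)) := fun w => rfl
  -- `T` is an isometry from the metric induced by the orbit map to that of `L`: the translation
  -- preserves `ω` and `I`, and the rotated frame has the same Gram matrix. So pulling back by `T`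
  -- takes volume forms to volume forms.
  have hmetric : ∀ a b : EuclideanSpace ℝ (Fin m) × EuclideanSpace ℝ (Fin d),
      X.metric (orbitMap j K hK ((h : H ⧸ K), v))
        (mfderiv ((𝓡 m).prod (𝓡 d)) 𝓘(ℝ, E) (orbitMap j K hK) ((h : H ⧸ K), v) a)
        (mfderiv ((𝓡 m).prod (𝓡 d)) 𝓘(ℝ, E) (orbitMap j K hK) ((h : H ⧸ K), v) b) =
      X.metric (ι l) (D (T a)) (D (T b)) := by
    intro a b
    refine (metric_eq X (h • j v) _ _).trans (Eq.trans ?_ (metric_eq X (ι l) (D (T a)) (D (T b))).symm)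
    rw [hd a, hd b, ← translationDeriv_I hI, kahlerBilin_translationDeriv hμ, hl]
    exact hR.gram a b
  refine ⟨vol', fun w => ?_, fun w => ?_⟩
  · have h1 := hvol fun i => T (w i)
    have h2 : (vol' w) ^ 2 = (volL fun i => T (w i)) ^ 2 := by
      refine (congrArg (· ^ 2) (hvol' w)).trans ?_
      rw [mul_pow, ← pow_mul, mul_comm m, pow_mul, neg_one_sq, one_pow, one_mul]
    refine h2.trans (h1.trans ?_)
    congr 1
    ext i k
    exact (hmetric (w i) (w k)).symm
  · have h1 : X.volumeForm (h • j v) (fun i => translationDeriv E h (j v) (R (w i))) =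
        Complex.exp (α * Complex.I) * X.volumeForm (j v) (fun i => R (w i)) :=
      scalesVolumeForm_iff.1 hscale (j v) fun i => R (w i)
    have h2 : X.volumeForm (ι l) (fun i => D (T (w i))) =
        Complex.exp (θ * Complex.I) * (volL (fun i => T (w i)) : ℂ) := hΩ fun i => T (w i)
    have h3 := hR.volume w
    rw [hl] at h2
    have h4 : X.volumeForm (j v) (fun i => R (w i)) =
        Complex.I ^ m * (Complex.exp (θ * Complex.I) * (volL (fun i => T (w i)) : ℂ)) :=
      h3.trans (congrArg (Complex.I ^ m * ·) h2)
    have h5 : X.volumeForm (h • j v) (fun i => (mfderiv ((𝓡 m).prod (𝓡 d)) 𝓘(ℝ, E)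
        (orbitMap j K hK) ((h : H ⧸ K), v) (w i) : E)) =
        X.volumeForm (h • j v) (fun i => translationDeriv E h (j v) (R (w i))) :=
      congrArg _ (funext fun i => hd (w i))
    have h6 : Complex.exp (((α + θ - Real.pi / 2 * m : ℝ) : ℂ) * Complex.I) =
        Complex.exp (α * Complex.I) * Complex.exp (θ * Complex.I) * (-Complex.I) ^ m := by
      have h7 : Complex.exp (-(Real.pi / 2 * Complex.I)) = -Complex.I := by
        rw [Complex.exp_neg, Complex.exp_pi_div_two_mul_I, Complex.inv_I]
      rw [← h7, ← Complex.exp_nat_mul, ← Complex.exp_add, ← Complex.exp_add]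
      congr 1
      push_cast
      ring
    have h9 : ∀ t : ℝ, Complex.exp (α * Complex.I) *
        (Complex.I ^ m * (Complex.exp (θ * Complex.I) * (t : ℂ))) =
        Complex.exp (((α + θ - Real.pi / 2 * m : ℝ) : ℂ) * Complex.I) *
          (((-1) ^ m * t : ℝ) : ℂ) := by
      intro t
      have h8 : (-Complex.I) ^ m * (-1) ^ m = Complex.I ^ m := by
        rw [← mul_pow]; simp
      rw [h6, ← h8]
      push_cast
      ring
    exact h5.trans ((h1.trans (congrArg _ h4)).trans (h9 _))

end Angle

end PerpSLag

end

theorem corollary4p12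
    -- the connected Calabi–Yau manifold `M`, of complex dimension `n`
    {n : ℕ} {E : Type*} [NormedAddCommGroup E] [NormedSpace ℂ E] [FiniteDimensional ℂ E]
    (hn : Module.finrank ℂ E = n)
    {M : Type*} [TopologicalSpace M] [T2Space M] [ConnectedSpace M] [ChartedSpace E M]
    [IsManifold 𝓘(ℂ, E) ω M]
    (X : PerpSLag.CalabiYau E M n)
    -- the connected Lie group `H`, acting smoothly and preserving `I`, with moment map `μ`
    {F : Type*} [NormedAddCommGroup F] [NormedSpace ℝ F] [FiniteDimensional ℝ F]
    {H : Type*} [TopologicalSpace H] [ConnectedSpace H] [ChartedSpace F H] [Group H]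
    [LieGroup 𝓘(ℝ, F) ∞ H] [MulAction H M] [ContMDiffSMul 𝓘(ℝ, F) 𝓘(ℝ, E) ∞ H M]
    (hI : PerpSLag.PreservesComplexStructure H E M)
    (μ : M → GroupLieAlgebra 𝓘(ℝ, F) H →L[ℝ] ℝ) (hμ : PerpSLag.IsMomentMap X μ)
    -- the Lagrangian submanifold `ι : L → M`
    {L : Type*} [TopologicalSpace L] [ChartedSpace (EuclideanSpace ℝ (Fin n)) L]
    [IsManifold (𝓡 n) ∞ L]
    (ι : L → M) (hι : PerpSLag.IsSubmanifoldEmbedding (𝓡 n) 𝓘(ℝ, E) ι)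
    (hL : X.IsLagrangianImmersion (𝓡 n) ι)
    -- the submanifold `j : V → M` contained in `μ⁻¹(c) ∩ L`
    (c : GroupLieAlgebra 𝓘(ℝ, F) H →L[ℝ] ℝ)
    {d : ℕ} {V : Type*} [Nonempty V] [TopologicalSpace V]
    [ChartedSpace (EuclideanSpace ℝ (Fin d)) V] [IsManifold (𝓡 d) ∞ V]
    (j : V → M) (hj : PerpSLag.IsSubmanifoldEmbedding (𝓡 d) 𝓘(ℝ, E) j)
    (hVμ : ∀ v, μ (j v) = c) (hVL : Set.range j ⊆ Set.range ι)
    -- the isotropy subgroup is the constant `K` along `V`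
    (K : Subgroup H) (hK : ∀ v, MulAction.stabilizer H (j v) = K)
    -- the fundamental vector fields are perpendicular to `L` along `V`
    (hperp : ∀ l : L, ι l ∈ Set.range j →
      ∀ (ξ : GroupLieAlgebra 𝓘(ℝ, F) H) (u : TangentSpace (𝓡 n) l),
        X.metric (ι l) (PerpSLag.fundamentalVF ξ (ι l)) (mfderiv (𝓡 n) 𝓘(ℝ, E) ι l u) = 0) :
    -- `c` is central
    c ∈ PerpSLag.coadjointCenter (F := F) (H := H) ∧
    -- the covector `a_H` exists and is unique
    (∃! a : GroupLieAlgebra 𝓘(ℝ, F) H →L[ℝ] ℝ, PerpSLag.IsPhaseCovector X a) ∧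
    -- `H / K` is a homogeneous space
    (∃ (m : ℕ) (_ : ChartedSpace (EuclideanSpace ℝ (Fin m)) (H ⧸ K)),
      PerpSLag.IsHomogeneousSpace F K m) ∧
    -- for the manifold `H / K`, with `dim (H / K) + dim V = n`:
    ∀ (m : ℕ) [ChartedSpace (EuclideanSpace ℝ (Fin m)) (H ⧸ K)],
      PerpSLag.IsHomogeneousSpace F K m → m + d = n →
      -- `φ_c` is a Lagrangian immersion
      X.IsLagrangianImmersion ((𝓡 m).prod (𝓡 d)) (PerpSLag.orbitMap j K hK) ∧
      ∀ a : GroupLieAlgebra 𝓘(ℝ, F) H →L[ℝ] ℝ, PerpSLag.IsPhaseCovector X a →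
        -- transformation of `Ω`, for `h = exp η₁ ⋯ exp ηₗ`
        (∀ (ηs : List (GroupLieAlgebra 𝓘(ℝ, F) H)) (hs : List H),
          List.Forall₂ PerpSLag.IsExp ηs hs →
          PerpSLag.ScalesVolumeForm X hs.prod (Complex.exp ((a ηs.sum : ℝ) * Complex.I))) ∧
        -- Lagrangian angle of `φ_c`, for `h = exp η₁ ⋯ exp ηₗ`
        (∀ (U : Set L) (θ : L → ℝ), X.IsLocalLagrangianAngle (𝓡 n) ι U θ →
          ∀ (v : V) (l : L), l ∈ U → ι l = j v →
          ∀ (ηs : List (GroupLieAlgebra 𝓘(ℝ, F) H)) (hs : List H),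
            List.Forall₂ PerpSLag.IsExp ηs hs →
            X.IsAngleAt ((𝓡 m).prod (𝓡 d)) (PerpSLag.orbitMap j K hK)
              ((hs.prod : H ⧸ K), v) (a ηs.sum + θ l - Real.pi / 2 * m)) ∧
        -- the special Lagrangian case
        ((∃ θ₀ : ℝ, ∀ l : L, ι l ∈ Set.range j → X.IsAngleAt (𝓡 n) ι l θ₀) → a = 0 →
          X.IsSpecialLagrangianImmersion ((𝓡 m).prod (𝓡 d)) (PerpSLag.orbitMap j K hK)) := by
  have hmain : ∀ v : V, ∃ l : L, ι l = j v := fun v => hVL ⟨v, rfl⟩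
  have hiso : ∀ (v : V) (ξ η : F), X.kahlerBilin (j v)
      (PerpSLag.fundamentalVF (H := H) ξ (j v)) (PerpSLag.fundamentalVF (H := H) η (j v)) = 0 := by
    intro v ξ η
    obtain ⟨l, hl⟩ := hmain v
    have h1 := PerpSLag.kahlerBilin_fundamentalVF_eq_zero hn hL (hperp l ⟨v, hl.symm⟩) ξ η
    have h2 : ∀ q, q = j v → X.kahlerBilin q (PerpSLag.fundamentalVF (H := H) ξ q)
        (PerpSLag.fundamentalVF (H := H) η q) = 0 → X.kahlerBilin (j v)
        (PerpSLag.fundamentalVF (H := H) ξ (j v)) (PerpSLag.fundamentalVF (H := H) η (j v)) = 0 := by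
      rintro _ rfl h; exact h
    exact h2 _ hl h1
  refine ⟨?_, PerpSLag.existsUnique_isPhaseCovector hn hI hμ, ?_, ?_⟩
  · obtain ⟨v⟩ := (inferInstance : Nonempty V)
    rw [← hVμ v]
    exact PerpSLag.mem_coadjointCenter hμ (j v) (hiso v)
  · obtain ⟨v⟩ := (inferInstance : Nonempty V)
    have : IsManifold 𝓘(ℝ, E) ∞ M := PerpSLag.isManifold_real
    have : FiniteDimensional ℝ E := FiniteDimensional.complexToReal E
    have hex := PerpSLag.exists_cosetSlice (F := F) (H := H) (E := E) (j v)
    rw [hK v] at hex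
    obtain ⟨m, S, -⟩ := hex
    exact ⟨m, S.chartedSpace, S.isHomogeneousSpace⟩
  · intro m _ hhom hmd
    have hframe := fun (h : H) (v : V) (l : L) (hl : ι l = j v) =>
      PerpSLag.exists_rotatedFrame (hK := hK) hn hμ hι hL hj.immersion hVμ hVL hhom hmd hl
        (hperp l ⟨v, hl.symm⟩) h
    have hLag : X.IsLagrangianImmersion ((𝓡 m).prod (𝓡 d)) (PerpSLag.orbitMap j K hK) := by
      refine PerpSLag.isLagrangianImmersion_orbitMap hμ hj.immersion.smooth hhom hmd fun h v => ?_
      obtain ⟨l, hl⟩ := hmain v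
      obtain ⟨R, T, hR, hd⟩ := hframe h v l hl
      exact ⟨_, R, T, hR, hd⟩
    refine ⟨hLag, fun a ha => ⟨fun ηs hs h => PerpSLag.scalesVolumeForm_prod ha h, ?_, ?_⟩⟩
    · intro U θ hθ v l hlU hl ηs hs h
      obtain ⟨R, T, hR, hd⟩ := hframe hs.prod v l hl
      exact PerpSLag.isAngleAt_orbitMap hI hμ hl hR hd (PerpSLag.scalesVolumeForm_prod ha h)
        (hθ.angle l hlU)
    · rintro ⟨θ₀, hθ₀⟩ rfl
      -- With `a_H = 0` every `h ∈ H` preserves `Ω`, so its phase is `0` and the angle formula gives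
      -- this same constant at every point of `(H/K) × V_c`.
      refine ⟨hLag, 0 + θ₀ - Real.pi / 2 * m, ?_⟩
      rintro ⟨x, v⟩
      obtain ⟨h, rfl⟩ := QuotientGroup.mk_surjective x
      obtain ⟨l, hl⟩ := hmain v
      obtain ⟨R, T, hR, hd⟩ := hframe h v l hl
      refine PerpSLag.isAngleAt_orbitMap hI hμ hl hR hd ?_ (hθ₀ l ⟨v, hl.symm⟩)
      simpa using PerpSLag.scalesVolumeForm_one_of_phase_zero ha h
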